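/- Let $M$ be a smooth manifold (finite-dimensional, Hausdorff, without boundary), and let $E=\bigoplus_{q\in\mathbb Z}E^q$ be a smooth $\mathbb Z$-graded real vector bundle of finite total rank on $M$. For $U\subseteq M$ open, let $\Omega^\bullet(U,E)=\Gamma(U,\Lambda^\bullet T^*M\otimes E)$, graded by total degree, $\Omega^\bullet(U,E)^n=\bigoplus_{p+q=n}\Omega^p(U,E^q)$. A flat $\mathbb Z$-graded superconnection on $E|_U$ is a linear operator $D$ on $\Omega^\bullet(U,E)$ of degree $1$ with $D^2=0$ and $$D(\sigma\wedge\omega)=d\sigma\wedge\omega+(-1)^k\sigma\wedge D\omega\qquad(\sigma\in\Omega^k(U),\ \omega\in\Omega^\bullet(U,E));$$ the pair $(E|_U,D)$ is then called an $\infty$-local system on $U$. For $D$ on $M$, the restriction $D|_U$ is the superconnection on $E|_U$ with $D|_U(\omega|_U)=(D\omega)|_U$ for all $\omega\in\Omega^\bullet(M,E)$. An isomorphism $(E,D)\to(E',D')$ of $\infty$-local systems on $U$ is a bijective linear map $\Omega^\bullet(U,E)\to\Omega^\bullet(U,E')$ of degree $0$ which is $\Omega^\bullet(U)$-linear and commutes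 with $D$ and $D'$. The constant $\infty$-local system on $U$ with fibre a finite-dimensional cochain complex $(V,\delta)$ of real vector spaces is the pullback of $(V,\delta)$ from the point, that is $(U\times V,\,d+\delta)$, where $d$ is the de Rham differential and $\delta$ sends $\eta\in\Omega^p(U,V^q)$ to $(-1)^p\,\delta\circ\eta\in\Omega^p(U,V^{q+1})$. **Corollary 5.4.** Every $\infty$-local system $(E,D)$ on $M$ is locally isomorphic to a constant one: every point $x\in M$ has an open neighbourhood $U$ such that $(E|_U,D|_U)$ is isomorphic to $(U\times V,\,d+\delta)$ for some finite-dimensional cochain complex $(V,\delta)$. -/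

import Mathlib

open Bundle TopologicalSpace
open scoped Manifold ContDiff Topology

noncomputable section

/-! ### Wedge product of alternating maps -/

section Wedge

variable {V V' N N' : Type*} [AddCommGroup V] [Module ℝ V] [TopologicalSpace V]
  [AddCommGroup V'] [Module ℝ V'] [TopologicalSpace V']
  [AddCommGroup N] [Module ℝ N] [TopologicalSpace N]
  [AddCommGroup N'] [Module ℝ N'] [TopologicalSpace N'] {k p m : ℕ}

theorem lid_summand_mk (a : V [⋀^Fin k]→L[ℝ] ℝ) (b : V [⋀^Fin p]→L[ℝ] N)
    (s : Equiv.Perm (Fin k ⊕ Fin p)) (v : Fin k ⊕ Fin p → V) :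
    TensorProduct.lid ℝ N (AlternatingMap.domCoprod.summand a.toAlternatingMap b.toAlternatingMap
      (Quotient.mk'' s) v) = ((Equiv.Perm.sign s : ℤ) : ℝ) •
        (a (fun i => v (s (Sum.inl i))) • b (fun i => v (s (Sum.inr i)))) := by
  rw [AlternatingMap.domCoprod.summand_mk'']
  change TensorProduct.lid ℝ N (((Equiv.Perm.sign s : ℤ)) •
    (a (fun i => v (s (Sum.inl i))) ⊗ₜ[ℝ] b (fun i => v (s (Sum.inr i))))) = _
  rw [map_zsmul, TensorProduct.lid_tmul, Int.cast_smul_eq_zsmul]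

/-- The wedge product of a scalar alternating `k`-form `a` and an alternating `p`-form `b` with
values in `N`, as an `m`-form, where `m = k + p`:
`(a ∧ b) (v₁, …, vₘ) = ∑ sign(s) a(v_{s(1)}, …, v_{s(k)}) • b(v_{s(k+1)}, …, v_{s(m)})`,
the sum running over the `(k, p)`-shuffles `s`. -/
def altWedge [IsTopologicalAddGroup N] [ContinuousSMul ℝ N] (h : k + p = m)
    (a : V [⋀^Fin k]→L[ℝ] ℝ) (b : V [⋀^Fin p]→L[ℝ] N) : V [⋀^Fin m]→L[ℝ] N :=
  { ((TensorProduct.lid ℝ N).toLinearMap.compAlternatingMap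
      (a.toAlternatingMap.domCoprod b.toAlternatingMap)).domDomCongr
        (finSumFinEquiv.trans (finCongr h)) with
    cont := by
      change Continuous fun v : Fin m → V =>
        TensorProduct.lid ℝ N ((∑ s : Equiv.Perm.ModSumCongr (Fin k) (Fin p),
          AlternatingMap.domCoprod.summand a.toAlternatingMap b.toAlternatingMap s)
            (fun i => v ((finSumFinEquiv.trans (finCongr h)) i)))
      simp only [sum_apply, map_sum]
      refine continuous_finsetSum _ fun s _ => ?_
      induction s using Quotient.inductionOn' with | _ s
      simp only [lid_summand_mk]
      fun_prop }

variable [IsTopologicalAddGroup N] [ContinuousSMul ℝ N] [IsTopologicalAddGroup N']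
  [ContinuousSMul ℝ N'] (h : k + p = m)

theorem altWedge_apply (a : V [⋀^Fin k]→L[ℝ] ℝ) (b : V [⋀^Fin p]→L[ℝ] N) (v : Fin m → V) :
    altWedge h a b v = ∑ s : Equiv.Perm.ModSumCongr (Fin k) (Fin p), TensorProduct.lid ℝ N
      (AlternatingMap.domCoprod.summand a.toAlternatingMap b.toAlternatingMap s
        (fun i => v (finCongr h (finSumFinEquiv i)))) := by
  change TensorProduct.lid ℝ N ((∑ s : Equiv.Perm.ModSumCongr (Fin k) (Fin p),
    AlternatingMap.domCoprod.summand a.toAlternatingMap b.toAlternatingMap s)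
      (fun i => v ((finSumFinEquiv.trans (finCongr h)) i))) = _
  simp only [sum_apply, map_sum]
  rfl

/-- The wedge product commutes with linear substitutions and with linear maps of the values. -/
theorem altWedge_comp (a : V [⋀^Fin k]→L[ℝ] ℝ) (b : V [⋀^Fin p]→L[ℝ] N) (f : V' →L[ℝ] V)
    (g : N →L[ℝ] N') :
    (g.compContinuousAlternatingMap (altWedge h a b)).compContinuousLinearMap f =
      altWedge h (a.compContinuousLinearMap f)
        ((g.compContinuousAlternatingMap b).compContinuousLinearMap f) := by
  ext v
  change g (altWedge h a b (f ∘ v)) = _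
  rw [altWedge_apply, altWedge_apply, map_sum]
  refine Finset.sum_congr rfl fun s _ => ?_
  induction s using Quotient.inductionOn' with | _ s
  simp only [lid_summand_mk, map_smul]
  rfl

theorem altWedge_add_left (a a' : V [⋀^Fin k]→L[ℝ] ℝ) (b : V [⋀^Fin p]→L[ℝ] N) :
    altWedge h (a + a') b = altWedge h a b + altWedge h a' b := by
  ext v
  simp only [ContinuousAlternatingMap.add_apply, altWedge_apply, ← Finset.sum_add_distrib]
  refine Finset.sum_congr rfl fun s _ => ?_
  induction s using Quotient.inductionOn' with | _ s
  simp only [lid_summand_mk, ContinuousAlternatingMap.add_apply, add_smul, smul_add]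

theorem altWedge_add_right (a : V [⋀^Fin k]→L[ℝ] ℝ) (b b' : V [⋀^Fin p]→L[ℝ] N) :
    altWedge h a (b + b') = altWedge h a b + altWedge h a b' := by
  ext v
  simp only [ContinuousAlternatingMap.add_apply, altWedge_apply, ← Finset.sum_add_distrib]
  refine Finset.sum_congr rfl fun s _ => ?_
  induction s using Quotient.inductionOn' with | _ s
  simp only [lid_summand_mk, ContinuousAlternatingMap.add_apply, smul_add]

theorem altWedge_smul_left (c : ℝ) (a : V [⋀^Fin k]→L[ℝ] ℝ) (b : V [⋀^Fin p]→L[ℝ] N) :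
    altWedge h (c • a) b = c • altWedge h a b := by
  ext v
  simp only [ContinuousAlternatingMap.smul_apply, altWedge_apply, Finset.smul_sum]
  refine Finset.sum_congr rfl fun s _ => ?_
  induction s using Quotient.inductionOn' with | _ s
  simp only [lid_summand_mk, ContinuousAlternatingMap.smul_apply, smul_eq_mul, smul_smul]
  ring_nf

theorem altWedge_smul_right (c : ℝ) (a : V [⋀^Fin k]→L[ℝ] ℝ) (b : V [⋀^Fin p]→L[ℝ] N) :
    altWedge h a (c • b) = c • altWedge h a b := by
  ext v
  simp only [ContinuousAlternatingMap.smul_apply, altWedge_apply, Finset.smul_sum]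
  refine Finset.sum_congr rfl fun s _ => ?_
  induction s using Quotient.inductionOn' with | _ s
  simp only [lid_summand_mk, ContinuousAlternatingMap.smul_apply, smul_smul]
  ring_nf

end Wedge

section WedgeNormed

variable {V N : Type*} [NormedAddCommGroup V] [NormedSpace ℝ V] [NormedAddCommGroup N]
  [NormedSpace ℝ N] {k p m : ℕ}

theorem norm_altWedge_le (h : k + p = m) (a : V [⋀^Fin k]→L[ℝ] ℝ) (b : V [⋀^Fin p]→L[ℝ] N) :
    ‖altWedge h a b‖ ≤ (Fintype.card (Equiv.Perm.ModSumCongr (Fin k) (Fin p)) : ℝ) * ‖a‖ * ‖b‖ := by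
  refine ContinuousAlternatingMap.opNorm_le_bound _ (by positivity) fun v => ?_
  rw [altWedge_apply]
  refine (norm_sum_le _ _).trans ?_
  rw [mul_assoc, mul_assoc, ← nsmul_eq_mul, ← Finset.card_univ]
  refine Finset.sum_le_card_nsmul _ _ _ fun s _ => ?_
  induction s using Quotient.inductionOn' with | _ s
  rw [lid_summand_mk, norm_smul, norm_smul]
  have h1 : ‖((Equiv.Perm.sign s : ℤ) : ℝ)‖ = 1 := by
    rcases Int.units_eq_one_or (Equiv.Perm.sign s) with h | h <;> simp [h]
  rw [h1, one_mul]
  have h2 : ∏ i, ‖v i‖ = (∏ i : Fin k, ‖v (finCongr h (finSumFinEquiv (s (Sum.inl i))))‖) *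
      ∏ i : Fin p, ‖v (finCongr h (finSumFinEquiv (s (Sum.inr i))))‖ := by
    rw [← Fintype.prod_sum_type
      (f := fun i => ‖v (finCongr h (finSumFinEquiv (s i)))‖)]
    exact (Equiv.prod_comp (s.trans (finSumFinEquiv.trans (finCongr h))) fun i => ‖v i‖).symm
  rw [h2, ← mul_assoc ‖a‖, mul_mul_mul_comm]
  exact mul_le_mul (a.le_opNorm _) (b.le_opNorm _) (norm_nonneg _) (by positivity)

/-- The wedge product on normed spaces as a continuous bilinear map. -/
def altWedgeL (V N : Type*) [NormedAddCommGroup V] [NormedSpace ℝ V] [NormedAddCommGroup N]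
    [NormedSpace ℝ N] (h : k + p = m) :
    (V [⋀^Fin k]→L[ℝ] ℝ) →L[ℝ] (V [⋀^Fin p]→L[ℝ] N) →L[ℝ] (V [⋀^Fin m]→L[ℝ] N) :=
  LinearMap.mkContinuous₂ (LinearMap.mk₂ ℝ
      (fun (a : V [⋀^Fin k]→L[ℝ] ℝ) (b : V [⋀^Fin p]→L[ℝ] N) => altWedge h a b)
      (altWedge_add_left h) (altWedge_smul_left h) (altWedge_add_right h)
      (altWedge_smul_right h))
    (Fintype.card (Equiv.Perm.ModSumCongr (Fin k) (Fin p)) : ℝ)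
    (fun a b => norm_altWedge_le h a b)

end WedgeNormed

set_option synthInstance.maxHeartbeats 200000 in
theorem contDiffAt_extDeriv {V N : Type*} [NormedAddCommGroup V] [NormedSpace ℝ V]
    [NormedAddCommGroup N] [NormedSpace ℝ N] {p : ℕ} {f : V → V [⋀^Fin p]→L[ℝ] N} {y : V}
    (h : ContDiffAt ℝ ∞ f y) : ContDiffAt ℝ ∞ (extDeriv f) y := by
  refine ((ContinuousAlternatingMap.alternatizeUncurryFinCLM (n := p) ℝ V
    N).contDiff.contDiffAt.comp y (h.fderiv_right (m := ∞) (by simp))).congr_of_eventuallyEq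
      (Filter.Eventually.of_forall fun z => ?_)
  rw [Function.comp_apply, ContinuousAlternatingMap.alternatizeUncurryFinCLM_apply]
  rfl

/-! ### Differential forms with values in a vector bundle -/

section Forms

variable (B : Type*) [NormedAddCommGroup B] [NormedSpace ℝ B]
  {M : Type*} [TopologicalSpace M] [ChartedSpace B M] [IsManifold 𝓘(ℝ, B) ∞ M]
  (F : Type*) [NormedAddCommGroup F] [NormedSpace ℝ F]
  (E : M → Type*) [∀ x, AddCommGroup (E x)] [∀ x, Module ℝ (E x)]
  [∀ x, TopologicalSpace (E x)] [∀ x, IsTopologicalAddGroup (E x)]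
  [∀ x, ContinuousSMul ℝ (E x)]
  [TopologicalSpace (TotalSpace F E)] [FiberBundle F E] [VectorBundle ℝ F E]

variable {B F E} in
/-- A family `η x ∈ Λᵖ T*ₓM ⊗ Eₓ`, `x ∈ U`, is a smooth section of `Λᵖ T*M ⊗ E` over `U`. -/
def IsSmoothForm {U : Opens M} {p : ℕ}
    (η : ∀ x : U, TangentSpace 𝓘(ℝ, B) (x : M) [⋀^Fin p]→L[ℝ] E x) : Prop :=
  ContMDiff 𝓘(ℝ, B) (𝓘(ℝ, B).prod 𝓘(ℝ, B [⋀^Fin p]→L[ℝ] F)) ∞ fun x : U =>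
    TotalSpace.mk' (B [⋀^Fin p]→L[ℝ] F)
      (E := fun x : M => TangentSpace 𝓘(ℝ, B) x [⋀^Fin p]→L[ℝ] E x) (x : M) (η x)

variable {B F E} in
theorem isSmoothForm_iff {U : Opens M} {p : ℕ}
    (η : ∀ x : U, TangentSpace 𝓘(ℝ, B) (x : M) [⋀^Fin p]→L[ℝ] E x) :
    IsSmoothForm (F := F) η ↔ ∀ x₀ : U, ContMDiffAt 𝓘(ℝ, B) 𝓘(ℝ, B [⋀^Fin p]→L[ℝ] F) ∞
      (fun x : U => ContinuousAlternatingMap.inCoordinates (𝕜 := ℝ) B F (x₀ : M) (x : M) (x₀ : M)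
        (x : M) (η x)) x₀ := by
  refine forall_congr' fun x₀ => ?_
  rw [contMDiffAt_totalSpace]
  exact and_iff_right contMDiff_subtype_val.contMDiffAt

/-- The space `Ωᵖ(U, E)` of smooth `p`-forms on the open set `U ⊆ M` with values in the vector
bundle `E`. -/
def Form (U : Opens M) (p : ℕ) :
    Submodule ℝ (∀ x : U, TangentSpace 𝓘(ℝ, B) (x : M) [⋀^Fin p]→L[ℝ] E x) where
  carrier := {η | IsSmoothForm (F := F) η}
  zero_mem' := by
    refine (isSmoothForm_iff _).2 fun x₀ => ?_
    refine (contMDiffAt_const (c := 0)).congr_of_eventuallyEq (Filter.Eventually.of_forall ?_)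
    intro x
    ext v
    simp [ContinuousAlternatingMap.inCoordinates]
  add_mem' := by
    intro a b ha hb
    refine (isSmoothForm_iff _).2 fun x₀ => ?_
    refine (((isSmoothForm_iff a).1 ha x₀).add ((isSmoothForm_iff b).1 hb x₀)).congr_of_eventuallyEq
      (Filter.Eventually.of_forall fun x => ?_)
    ext v
    simp [ContinuousAlternatingMap.inCoordinates]
  smul_mem' := by
    intro c a ha
    refine (isSmoothForm_iff _).2 fun x₀ => ?_
    refine (((contDiff_const_smul c).contMDiff.contMDiffAt).comp x₀
      ((isSmoothForm_iff a).1 ha x₀)).congr_of_eventuallyEq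
        (Filter.Eventually.of_forall fun x => ?_)
    ext v
    simp [ContinuousAlternatingMap.inCoordinates]

instance (U : Opens M) (p : ℕ) : AddCommGroup (Form B F E U p) := inferInstance

instance (U : Opens M) (p : ℕ) : Module ℝ (Form B F E U p) := inferInstance

variable {B F E}

theorem inCoordinates_trivial {V : Type*} [NormedAddCommGroup V] [NormedSpace ℝ V] {p : ℕ}
    (x₀ x : M) (η : TangentSpace 𝓘(ℝ, B) x [⋀^Fin p]→L[ℝ] Trivial M V x) :
    ContinuousAlternatingMap.inCoordinates (𝕜 := ℝ) B V x₀ x x₀ x η =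
      η.compContinuousLinearMap
        ((trivializationAt B (TangentSpace 𝓘(ℝ, B)) x₀).symmL ℝ x) := by
  unfold ContinuousAlternatingMap.inCoordinates
  have h : (trivializationAt V (Trivial M V) x₀).continuousLinearMapAt ℝ x =
      ContinuousLinearMap.id ℝ V := Trivial.continuousLinearMapAt_trivialization ℝ M V x
  rw [h]
  rfl

/-- Restriction of forms to a smaller open set. -/
def formRestrict {U W : Opens M} (hUW : U ≤ W) {p : ℕ} : Form B F E W p →ₗ[ℝ] Form B F E U p where
  toFun η := ⟨fun x => η.1 ⟨x, hUW x.2⟩, by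
    have := η.2
    exact ContMDiff.comp this (contMDiff_inclusion hUW)⟩
  map_add' _ _ := rfl
  map_smul' _ _ := rfl

/-- The wedge product `σ ∧ η ∈ Ωᵐ(U, E)` of `σ ∈ Ωᵏ(U)` and `η ∈ Ωᵖ(U, E)`, where `m = k + p`. -/
def formWedge {U : Opens M} {k p m : ℕ} (h : k + p = m) (σ : Form B ℝ (Trivial M ℝ) U k)
    (η : Form B F E U p) : Form B F E U m :=
  ⟨fun x => altWedge h (σ.1 x) (η.1 x), by
    refine (isSmoothForm_iff _).2 fun x₀ => ?_
    have h1 := (isSmoothForm_iff _).1 σ.2 x₀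
    have h2 := (isSmoothForm_iff _).1 η.2 x₀
    have h3 : ContDiff ℝ ∞ fun q : (B [⋀^Fin k]→L[ℝ] ℝ) × (B [⋀^Fin p]→L[ℝ] F) =>
        altWedge h q.1 q.2 := (altWedgeL B F h).isBoundedBilinearMap.contDiff
    refine (h3.contMDiff.contMDiffAt.comp x₀ (h1.prodMk_space h2)).congr_of_eventuallyEq
      (Filter.Eventually.of_forall fun x => ?_)
    change ContinuousAlternatingMap.inCoordinates (𝕜 := ℝ) B F (x₀ : M) (x : M) (x₀ : M) (x : M)
      (altWedge h (σ.1 x) (η.1 x)) = altWedge h (ContinuousAlternatingMap.inCoordinates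
        (𝕜 := ℝ) B ℝ (x₀ : M) (x : M) (x₀ : M) (x : M) (σ.1 x)) _
    rw [inCoordinates_trivial]
    exact altWedge_comp (N := E x) (N' := F) h (σ.1 x) (η.1 x) _ _⟩


/-! ### The exterior derivative -/

section ExteriorDerivative

variable {V : Type*} [NormedAddCommGroup V] [NormedSpace ℝ V] {U : Opens M} {p : ℕ}

open Classical in
/-- The coefficient at `z ∈ U` of a `V`-valued form `η` on `U` in the coordinates of the preferred
chart of `M` at `x₀`: the alternating map `η z` on the tangent space at `z`, transported to the
model space `B` by means of that chart. The value for `z ∉ U` is `0`. -/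
def formCoord (η : Form B V (Trivial M V) U p) (x₀ z : M) : B [⋀^Fin p]→L[ℝ] V :=
  if h : z ∈ U then (η.1 ⟨z, h⟩).compContinuousLinearMap
    ((trivializationAt B (TangentSpace 𝓘(ℝ, B)) x₀).symmL ℝ z) else 0

/-- A `V`-valued form `η` on `U` read in the preferred chart `φ` of `M` at `x₀`, i.e. the pullback
of `η` along `φ⁻¹`, a form on an open subset of the model space `B`. -/
def formInChart (η : Form B V (Trivial M V) U p) (x₀ : M) (y : B) : B [⋀^Fin p]→L[ℝ] V :=
  formCoord η x₀ ((extChartAt 𝓘(ℝ, B) x₀).symm y)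

theorem formCoord_of_mem (η : Form B V (Trivial M V) U p) (x₀ z : M) (h : z ∈ U) :
    formCoord η x₀ z = (η.1 ⟨z, h⟩).compContinuousLinearMap
      ((trivializationAt B (TangentSpace 𝓘(ℝ, B)) x₀).symmL ℝ z) := dif_pos h

theorem formCoord_of_not_mem (η : Form B V (Trivial M V) U p) (x₀ z : M) (h : z ∉ U) :
    formCoord η x₀ z = 0 := dif_neg h

theorem formInChart_contDiffAt (η : Form B V (Trivial M V) U p) (x₀ : U) :
    ContDiffAt ℝ ∞ (formInChart η x₀) (extChartAt 𝓘(ℝ, B) (x₀ : M) x₀) := by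
  have h1 := (isSmoothForm_iff _).1 η.2 x₀
  have h2 : ContMDiffAt 𝓘(ℝ, B) 𝓘(ℝ, B [⋀^Fin p]→L[ℝ] V) ∞ (formCoord η x₀) (x₀ : M) := by
    rw [← contMDiffAt_subtype_iff]
    refine h1.congr_of_eventuallyEq (Filter.Eventually.of_forall fun x => ?_)
    exact (formCoord_of_mem η x₀ x x.2).trans (inCoordinates_trivial (x₀ : M) (x : M) (η.1 x)).symm
  have h3 : ContMDiffAt 𝓘(ℝ, B) 𝓘(ℝ, B) ∞ (extChartAt 𝓘(ℝ, B) (x₀ : M)).symm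
      (extChartAt 𝓘(ℝ, B) (x₀ : M) x₀) :=
    (contMDiffOn_extChartAt_symm (x₀ : M)).contMDiffAt (extChartAt_target_mem_nhds _)
  have h4 : ContMDiffAt 𝓘(ℝ, B) 𝓘(ℝ, B [⋀^Fin p]→L[ℝ] V) ∞
      (formCoord η x₀ ∘ (extChartAt 𝓘(ℝ, B) (x₀ : M)).symm) (extChartAt 𝓘(ℝ, B) (x₀ : M) x₀) := by
    refine ContMDiffAt.comp _ ?_ h3
    rwa [extChartAt_to_inv]
  exact h4.contDiffAt

/-- The value at `x` of the exterior derivative: the exterior derivative in the model space of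
the form read in the preferred chart at `x`, carried back to `x`. -/
def formDAt (η : Form B V (Trivial M V) U p) (x : U) :
    TangentSpace 𝓘(ℝ, B) (x : M) [⋀^Fin (p + 1)]→L[ℝ] V :=
  (extDeriv (formInChart η x) (extChartAt 𝓘(ℝ, B) (x : M) x)).compContinuousLinearMap
    ((trivializationAt B (TangentSpace 𝓘(ℝ, B)) (x : M)).continuousLinearMapAt ℝ x)

/-- The exterior derivative may be computed in any preferred chart. -/
theorem formDAt_eq (η : Form B V (Trivial M V) U p) (x₀ : M) (x : U)
    (hx : (x : M) ∈ (chartAt B x₀).source)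
    (hd : DifferentiableAt ℝ (formInChart η x₀) (extChartAt 𝓘(ℝ, B) x₀ x)) :
    (formDAt η x).compContinuousLinearMap
      ((trivializationAt B (TangentSpace 𝓘(ℝ, B)) x₀).symmL ℝ x) =
        extDeriv (formInChart η x₀) (extChartAt 𝓘(ℝ, B) x₀ x) := by
  have hsrc : ∀ z w : M, z ∈ (chartAt B w).source → z ∈ (extChartAt 𝓘(ℝ, B) w).source :=
    fun z w h => by rwa [extChartAt_source]
  let ψ : B → B := extChartAt 𝓘(ℝ, B) x₀ ∘ (extChartAt 𝓘(ℝ, B) (x : M)).symm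
  have hψd : ∀ z : M, z ∈ (chartAt B (x : M)).source → z ∈ (chartAt B x₀).source →
      HasFDerivAt ψ (tangentCoordChange 𝓘(ℝ, B) (x : M) x₀ z)
        (extChartAt 𝓘(ℝ, B) (x : M) z) := by
    intro z h1 h2
    have := hasFDerivWithinAt_tangentCoordChange (I := 𝓘(ℝ, B)) ⟨hsrc z x h1, hsrc z x₀ h2⟩
    rwa [modelWithCornersSelf_coe, Set.range_id, hasFDerivWithinAt_univ] at this
  have hxx := mem_chart_source B (x : M)
  have hψx : ψ (extChartAt 𝓘(ℝ, B) (x : M) x) = extChartAt 𝓘(ℝ, B) x₀ x := by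
    simp only [ψ, Function.comp_apply, extChartAt_to_inv]
  have hψ : ContDiffAt ℝ ∞ ψ (extChartAt 𝓘(ℝ, B) (x : M) x) := by
    have h1 : ContMDiffAt 𝓘(ℝ, B) 𝓘(ℝ, B) ∞ (extChartAt 𝓘(ℝ, B) (x : M)).symm
        (extChartAt 𝓘(ℝ, B) (x : M) x) :=
      (contMDiffOn_extChartAt_symm (x : M)).contMDiffAt (extChartAt_target_mem_nhds _)
    have h2 : ContMDiffAt 𝓘(ℝ, B) 𝓘(ℝ, B) ∞ (extChartAt 𝓘(ℝ, B) x₀)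
        ((extChartAt 𝓘(ℝ, B) (x : M)).symm (extChartAt 𝓘(ℝ, B) (x : M) x)) := by
      rw [extChartAt_to_inv]
      exact contMDiffAt_extChartAt' hx
    exact (h2.comp _ h1).contDiffAt
  have hloc : formInChart η x =ᶠ[𝓝 (extChartAt 𝓘(ℝ, B) (x : M) x)] fun y =>
      (formInChart η x₀ (ψ y)).compContinuousLinearMap (fderiv ℝ ψ y) := by
    have h1 : ∀ᶠ y in 𝓝 (extChartAt 𝓘(ℝ, B) (x : M) x),
        y ∈ (extChartAt 𝓘(ℝ, B) (x : M)).target := extChartAt_target_mem_nhds _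
    have h2 : ∀ᶠ y in 𝓝 (extChartAt 𝓘(ℝ, B) (x : M) x),
        (extChartAt 𝓘(ℝ, B) (x : M)).symm y ∈ (chartAt B x₀).source := by
      refine (continuousAt_extChartAt_symm (I := 𝓘(ℝ, B)) (x : M)).eventually ?_
      rw [extChartAt_to_inv]
      exact (chartAt B x₀).open_source.mem_nhds hx
    filter_upwards [h1, h2] with y hy1 hy2
    obtain ⟨z, hz⟩ : ∃ z, z = (extChartAt 𝓘(ℝ, B) (x : M)).symm y := ⟨_, rfl⟩
    have hz1 : z ∈ (chartAt B (x : M)).source := by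
      rw [hz, ← extChartAt_source 𝓘(ℝ, B)]
      exact (extChartAt 𝓘(ℝ, B) (x : M)).map_target hy1
    have hzy : extChartAt 𝓘(ℝ, B) (x : M) z = y := by
      rw [hz]; exact (extChartAt 𝓘(ℝ, B) (x : M)).right_inv hy1
    have hz2 : z ∈ (chartAt B x₀).source := by rwa [hz]
    have hzψ : (extChartAt 𝓘(ℝ, B) x₀).symm (ψ y) = z := by
      simp only [ψ, Function.comp_apply, ← hz]
      exact (extChartAt 𝓘(ℝ, B) x₀).left_inv (hsrc z x₀ hz2)
    have hder : fderiv ℝ ψ y = tangentCoordChange 𝓘(ℝ, B) (x : M) x₀ z := by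
      rw [← hzy]; exact (hψd z hz1 hz2).fderiv
    rw [hder]
    by_cases hU : z ∈ U
    · simp only [formInChart, hzψ, ← hz]
      rw [formCoord_of_mem η _ z hU, formCoord_of_mem η _ z hU,
        TangentBundle.symmL_trivializationAt_eq_core hz1,
        TangentBundle.symmL_trivializationAt_eq_core hz2]
      ext v
      refine congrArg (η.1 ⟨z, hU⟩) (funext fun i => ?_)
      exact (tangentCoordChange_comp (I := 𝓘(ℝ, B)) (w := (x : M)) (x := x₀) (y := z)
        ⟨⟨hsrc z x hz1, hsrc z x₀ hz2⟩, hsrc z z (mem_chart_source B z)⟩).symm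
    · simp only [formInChart, hzψ, ← hz]
      rw [formCoord_of_not_mem η _ z hU, formCoord_of_not_mem η _ z hU]
      rfl
  rw [formDAt, hloc.extDeriv_eq, extDeriv_pullback (r := ∞) (by rwa [hψx]) hψ
      (by rw [minSmoothness_of_isRCLikeNormedField]; exact WithTop.coe_le_coe.2 le_top),
    hψx, (hψd x hxx hx).fderiv, TangentBundle.symmL_trivializationAt_eq_core hx,
    TangentBundle.continuousLinearMapAt_trivializationAt_eq_core hxx]
  ext v
  refine congrArg (extDeriv (formInChart η x₀) (extChartAt 𝓘(ℝ, B) x₀ x)) (funext fun i => ?_)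
  change tangentCoordChange 𝓘(ℝ, B) (x : M) x₀ x (tangentCoordChange 𝓘(ℝ, B) (x : M) x x
    (tangentCoordChange 𝓘(ℝ, B) x₀ x x (v i))) = v i
  rw [tangentCoordChange_self (hsrc _ _ hxx),
    tangentCoordChange_comp ⟨⟨hsrc _ _ hx, hsrc _ _ hxx⟩, hsrc _ _ hx⟩,
    tangentCoordChange_self (hsrc _ _ hx)]

/-- The exterior derivative (de Rham differential) `d : Ωᵖ(U, V) → Ωᵖ⁺¹(U, V)`. -/
def formD : Form B V (Trivial M V) U p →ₗ[ℝ] Form B V (Trivial M V) U (p + 1) where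
  toFun η := ⟨formDAt η, by
    refine (isSmoothForm_iff (F := V) (E := Trivial M V) (formDAt η)).2 fun x₀ => ?_
    have h0 := formInChart_contDiffAt η x₀
    have h1 := contDiffAt_extDeriv h0
    have h2 : ContMDiffAt 𝓘(ℝ, B) 𝓘(ℝ, B [⋀^Fin (p + 1)]→L[ℝ] V) ∞
        (fun z : M => extDeriv (formInChart η x₀) (extChartAt 𝓘(ℝ, B) (x₀ : M) z)) x₀ :=
      h1.contMDiffAt.comp (x₀ : M) contMDiffAt_extChartAt
    rw [← contMDiffAt_subtype_iff] at h2
    refine h2.congr_of_eventuallyEq ?_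
    have h3 : ∀ᶠ z in 𝓝 (x₀ : M), DifferentiableAt ℝ (formInChart η x₀)
        (extChartAt 𝓘(ℝ, B) (x₀ : M) z) := by
      have h4 : ∀ᶠ y in 𝓝 (extChartAt 𝓘(ℝ, B) (x₀ : M) x₀),
          DifferentiableAt ℝ (formInChart η x₀) y :=
        ((h0.of_le (m := 1) (by simp)).eventually (by simp)).mono
          fun y hy => hy.differentiableAt (by simp)
      exact (continuousAt_extChartAt (I := 𝓘(ℝ, B)) (x₀ : M)).eventually h4
    have h5 : ∀ᶠ z in 𝓝 (x₀ : M), z ∈ (chartAt B (x₀ : M)).source :=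
      chart_source_mem_nhds B (x₀ : M)
    filter_upwards [continuous_subtype_val.continuousAt.eventually (h3.and h5)] with x hx
    exact (inCoordinates_trivial (x₀ : M) (x : M) (formDAt η x)).trans
      (formDAt_eq η x₀ x hx.2 hx.1)⟩
  map_add' a b := by
    refine Subtype.ext (funext fun x => ?_)
    have h : formInChart (a + b) x = formInChart a x + formInChart b x := by
      funext y
      by_cases hy : (extChartAt 𝓘(ℝ, B) (x : M)).symm y ∈ U
      · simp only [formInChart, Pi.add_apply, formCoord_of_mem _ _ _ hy]
        rfl
      · simp only [formInChart, Pi.add_apply, formCoord_of_not_mem _ _ _ hy, add_zero]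
    have ha := (formInChart_contDiffAt a x).differentiableAt (by simp)
    have hb := (formInChart_contDiffAt b x).differentiableAt (by simp)
    change formDAt (a + b) x = formDAt a x + formDAt b x
    rw [formDAt, h, extDeriv_add ha hb]
    rfl
  map_smul' c a := by
    refine Subtype.ext (funext fun x => ?_)
    have h : formInChart (c • a) x = c • formInChart a x := by
      funext y
      by_cases hy : (extChartAt 𝓘(ℝ, B) (x : M)).symm y ∈ U
      · simp only [formInChart, Pi.smul_apply, formCoord_of_mem _ _ _ hy]
        rfl
      · simp only [formInChart, Pi.smul_apply, formCoord_of_not_mem _ _ _ hy, smul_zero]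
    change formDAt (c • a) x = c • formDAt a x
    rw [formDAt, h, extDeriv_smul]
    rfl

end ExteriorDerivative


/-- Composition of a `V`-valued form with a constant linear map `g : V → V'`. -/
def formMap {V V' : Type*} [NormedAddCommGroup V] [NormedSpace ℝ V] [NormedAddCommGroup V']
    [NormedSpace ℝ V'] {U : Opens M} {p : ℕ} (g : V →L[ℝ] V') :
    Form B V (Trivial M V) U p →ₗ[ℝ] Form B V' (Trivial M V') U p where
  toFun η := ⟨fun x => g.compContinuousAlternatingMap (η.1 x), by
    refine (isSmoothForm_iff (F := V') (E := Trivial M V') _).2 fun x₀ => ?_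
    have h1 := (isSmoothForm_iff _).1 η.2 x₀
    refine ((ContinuousLinearMap.compContinuousAlternatingMapCLM (ι := Fin p) ℝ B V V'
      g).contDiff.contMDiff.contMDiffAt.comp x₀ h1).congr_of_eventuallyEq
        (Filter.Eventually.of_forall fun x => ?_)
    refine (inCoordinates_trivial (x₀ : M) (x : M) _).trans ?_
    rw [Function.comp_apply, inCoordinates_trivial]
    rfl⟩
  map_add' a b := by
    refine Subtype.ext (funext fun x => ?_)
    ext v
    exact map_add g (a.1 x v) (b.1 x v)
  map_smul' c a := by
    refine Subtype.ext (funext fun x => ?_)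
    ext v
    exact map_smul g c (a.1 x v)

end Forms

/-! ### Forms with values in a graded vector bundle and flat superconnections -/

section Superconnections

variable (B : Type*) [NormedAddCommGroup B] [NormedSpace ℝ B]
  {M : Type*} [TopologicalSpace M] [ChartedSpace B M] [IsManifold 𝓘(ℝ, B) ∞ M]
  (F : ℤ → Type*) [∀ q, NormedAddCommGroup (F q)] [∀ q, NormedSpace ℝ (F q)]
  (E : ℤ → M → Type*) [∀ q x, AddCommGroup (E q x)] [∀ q x, Module ℝ (E q x)]
  [∀ q x, TopologicalSpace (E q x)] [∀ q x, IsTopologicalAddGroup (E q x)]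
  [∀ q x, ContinuousSMul ℝ (E q x)] [∀ q, TopologicalSpace (TotalSpace (F q) (E q))]
  [∀ q, FiberBundle (F q) (E q)] [∀ q, VectorBundle ℝ (F q) (E q)]

/-- The space `Ω(U, E)` of all smooth forms on `U` with values in the graded vector bundle
`E = ⨁ E^q`; the component `η p q` of such a form `η` lies in `Ωᵖ(U, E^q)`. (If `M` is
finite-dimensional and `E` has finite total rank, then only finitely many of the spaces
`Ωᵖ(U, E^q)` are nonzero, so that their product is their direct sum.) -/
abbrev TotalForms (U : Opens M) := ∀ (p : ℕ) (q : ℤ), Form B (F q) (E q) U p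

instance (U : Opens M) : AddCommGroup (TotalForms B F E U) := inferInstance

instance (U : Opens M) : Module ℝ (TotalForms B F E U) := inferInstance

variable {B F E}

/-- `η` is homogeneous of total degree `m`, i.e. lies in the sum of the `Ωᵖ(U, E^q)` with
`p + q = m`. -/
def IsHomogeneousForm {U : Opens M} (m : ℤ) (η : TotalForms B F E U) : Prop :=
  ∀ (p : ℕ) (q : ℤ), (p : ℤ) + q ≠ m → η p q = 0

/-- The product `σ ∧ η` of a scalar form `σ ∈ Ωᵏ(U)` and `η ∈ Ω(U, E)`. -/
def totalWedge {U : Opens M} {k : ℕ} (σ : Form B ℝ (Trivial M ℝ) U k) (η : TotalForms B F E U) :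
    TotalForms B F E U :=
  fun m q => if h : k ≤ m then formWedge (Nat.add_sub_of_le h) σ (η (m - k) q) else 0

/-- Restriction `Ω(W, E) → Ω(U, E)` for `U ⊆ W`. -/
def totalRestrict {U W : Opens M} (hUW : U ≤ W) :
    TotalForms B F E W →ₗ[ℝ] TotalForms B F E U where
  toFun η := fun p q => formRestrict hUW (η p q)
  map_add' _ _ := rfl
  map_smul' _ _ := rfl

variable (B F E) in
/-- A flat `ℤ`-graded superconnection `D` on the restriction of `E` to the open set `U`. The pair
`(E|_U, D)` is an `∞`-local system on `U`. -/
structure FlatSuperconnection (U : Opens M) where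
  /-- the operator `D` on `Ω(U, E)` -/
  D : TotalForms B F E U →ₗ[ℝ] TotalForms B F E U
  degree_one : ∀ (m : ℤ) (η : TotalForms B F E U),
    IsHomogeneousForm m η → IsHomogeneousForm (m + 1) (D η)
  leibniz : ∀ (k : ℕ) (σ : Form B ℝ (Trivial M ℝ) U k) (η : TotalForms B F E U),
    D (totalWedge σ η) = totalWedge (formD σ) η + (-1 : ℝ) ^ k • totalWedge σ (D η)
  flat : ∀ η : TotalForms B F E U, D (D η) = 0

/-- `D'` on `E|_U` is the restriction `D|_U` of the superconnection `D` on `E|_W`: for every form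
`η` on `W` one has `D' (η|_U) = (D η)|_U`. As superconnections are local operators, `D'` is
determined by `D` when `M` is a Hausdorff finite-dimensional manifold. -/
def FlatSuperconnection.IsRestriction {U W : Opens M} (D : FlatSuperconnection B F E W)
    (hUW : U ≤ W) (D' : FlatSuperconnection B F E U) : Prop :=
  ∀ η : TotalForms B F E W, D'.D (totalRestrict hUW η) = totalRestrict hUW (D.D η)

/-- A differential of degree `1` on a graded vector space `V = ⨁ V^i`, making it a cochain
complex: `d i j : V^i → V^j` is zero unless `j = i + 1`. -/
structure GradedDifferential (V : ℤ → Type*) [∀ i, NormedAddCommGroup (V i)]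
    [∀ i, NormedSpace ℝ (V i)] where
  d : ∀ i j : ℤ, V i →L[ℝ] V j
  shape : ∀ i j : ℤ, i + 1 ≠ j → d i j = 0
  d_comp_d : ∀ i j k : ℤ, (d j k).comp (d i j) = 0

/-- The operator `d + δ` on `Ω(U, U × V)`, where `(V, δ)` is a cochain complex: the de Rham
differential plus multiplication by the constant endomorphism `δ` of degree `1`. Thus
`η ∈ Ωᵖ(U, V^q)` is sent to `dη + (-1)ᵖ δ ∘ η` in `Ωᵖ⁺¹(U, V^q) ⊕ Ωᵖ(U, V^(q+1))`. This is
the constant `∞`-local system on `U` with fibre `(V, δ)`. -/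
def constantSuperconnection {V : ℤ → Type*} [∀ i, NormedAddCommGroup (V i)]
    [∀ i, NormedSpace ℝ (V i)] (U : Opens M) (δ : GradedDifferential V) :
    TotalForms B V (fun q => Trivial M (V q)) U →ₗ[ℝ]
      TotalForms B V (fun q => Trivial M (V q)) U where
  toFun η
    | 0, q => formMap (δ.d (q - 1) q) (η 0 (q - 1))
    | p + 1, q => formD (η p q) + (-1 : ℝ) ^ (p + 1) • formMap (δ.d (q - 1) q) (η (p + 1) (q - 1))
  map_add' a b := by
    funext p q
    cases p with
    | zero => exact map_add (formMap (δ.d (q - 1) q)) (a 0 (q - 1)) (b 0 (q - 1))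
    | succ p =>
      change formD (a p q + b p q) +
        (-1 : ℝ) ^ (p + 1) • formMap (δ.d (q - 1) q) (a (p + 1) (q - 1) + b (p + 1) (q - 1)) = _
      rw [map_add, map_add, smul_add, add_add_add_comm]
      rfl
  map_smul' c a := by
    funext p q
    cases p with
    | zero => exact map_smul (formMap (δ.d (q - 1) q)) c (a 0 (q - 1))
    | succ p =>
      change formD (c • a p q) +
        (-1 : ℝ) ^ (p + 1) • formMap (δ.d (q - 1) q) (c • a (p + 1) (q - 1)) = _
      rw [map_smul, map_smul, smul_comm _ c, ← smul_add]
      rfl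

/-- An isomorphism between `∞`-local systems `(E, D)` and `(E', D')` on `U`: an invertible linear
map `Ω(U, E) → Ω(U, E')` of degree `0` which is `Ω(U)`-linear and intertwines `D` and `D'`. -/
structure LocalSystemIso {F' : ℤ → Type*} [∀ q, NormedAddCommGroup (F' q)]
    [∀ q, NormedSpace ℝ (F' q)] {E' : ℤ → M → Type*} [∀ q x, AddCommGroup (E' q x)]
    [∀ q x, Module ℝ (E' q x)] [∀ q x, TopologicalSpace (E' q x)]
    [∀ q x, IsTopologicalAddGroup (E' q x)] [∀ q x, ContinuousSMul ℝ (E' q x)]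
    [∀ q, TopologicalSpace (TotalSpace (F' q) (E' q))] [∀ q, FiberBundle (F' q) (E' q)]
    [∀ q, VectorBundle ℝ (F' q) (E' q)] {U : Opens M}
    (D : TotalForms B F E U →ₗ[ℝ] TotalForms B F E U)
    (D' : TotalForms B F' E' U →ₗ[ℝ] TotalForms B F' E' U) where
  Φ : TotalForms B F E U ≃ₗ[ℝ] TotalForms B F' E' U
  degree_zero : ∀ (m : ℤ) (η : TotalForms B F E U),
    IsHomogeneousForm m η → IsHomogeneousForm m (Φ η)
  wedge_linear : ∀ (k : ℕ) (σ : Form B ℝ (Trivial M ℝ) U k) (η : TotalForms B F E U),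
    Φ (totalWedge σ η) = totalWedge σ (Φ η)
  comm : ∀ η : TotalForms B F E U, Φ (D η) = D' (Φ η)

end Superconnections

end

noncomputable section

set_option synthInstance.maxHeartbeats 400000
set_option linter.unusedSectionVars false

universe u v

/-! ### Associativity and low-degree formulas for the wedge product -/

section WedgeAlgebra

/-! Let `c` be the image of the given point in a chart. Choose local trivializations and a
homogeneous basis `e i` of the fibre. Superconnections are local (`FlatSuperconnection.at_eq_zero`),
so by the Leibniz rule D becomes d + A near `c`. Here A sends ∑ aᵢ ⊗ eᵢ to ∑ ± aᵢ ∧ βᵢ with βᵢ = D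
eᵢ and the sign (-1)ᵖ on p-forms (`FlatSuperconnection.exists_connOp`).

Let K be the Poincaré cone operator along the rays through `c`. It satisfies dK + Kd = 1 in positive
degree, K dη = η - η(c) on functions, and (Kη)(c) = 0; see `coneIntegral_homotopy`. The frame that
trivializes D is the solution of the integral equations Sᵢ + K A Sᵢ = eᵢ.

The point is that D Sᵢ solves an equation of the same kind. Flatness D²S = 0 reads d(AS) = -A(DS),
whence DS + K A DS = dS + AS - K d(AS) = d(S + K A S) + (AS)₀(c). The first term is d of a constant,
and the second is δ eᵢ, where δ is the part of A of form degree zero, evaluated at `c`; flatness at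
`c` gives δ² = 0. This is `connOp_add_homotopyConn`. By linearity the combination ∑ⱼ δⱼᵢ Sⱼ has the
same right hand side, so uniqueness gives D Sᵢ = ∑ⱼ δⱼᵢ Sⱼ (`connOp_eq_extend`). As Sᵢ(c) = eᵢ, the
frame is invertible near `c` (`exists_inverse_frame`), and by the Leibniz rule a ↦ ∑ aᵢ ∧ Sᵢ
intertwines d + δ with D (`connOp_extend_frame`).

On the analytic side, K A is a Volterra operator along rays whose kernel contains the contraction
with y - c, hence is small near `c`. Restricted to one ray, the equation lives in C([0,1], W) and is
solved by inverting 1 + T with ‖T‖ ≤ 1/2; smooth dependence on the ray gives a smooth solution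
(`exists_contDiff_volterra`). Uniqueness is a maximum argument (`eventually_eq_zero_of_volterra`).

The superconnection on U is defined by transporting d + δ through the frame, and only afterwards is
it recognised as the restriction of D (`IsFramePair.isRestriction`). Thus D never has to be applied
to forms that live on U only. -/

theorem alternatization_domDomCongr {V N ι ι' : Type*} [AddCommGroup V] [Module ℝ V]
    [AddCommGroup N] [Module ℝ N] [Fintype ι] [DecidableEq ι] [Fintype ι'] [DecidableEq ι']
    (e : ι ≃ ι') (f : MultilinearMap ℝ (fun _ : ι => V) N) :
    MultilinearMap.alternatization (f.domDomCongr e) =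
      (MultilinearMap.alternatization f).domDomCongr e := by
  ext v
  rw [AlternatingMap.domDomCongr_apply, MultilinearMap.alternatization_apply,
    MultilinearMap.alternatization_apply]
  refine (Equiv.sum_comp e.permCongr _).symm.trans (Finset.sum_congr rfl fun s _ => ?_)
  rw [Equiv.Perm.sign_permCongr]
  congr 1
  simp [MultilinearMap.domDomCongr_apply, Equiv.permCongr_apply]

section

variable {V N : Type*} [AddCommGroup V] [Module ℝ V] [AddCommGroup N] [Module ℝ N] {k l p m n : ℕ}

/-- The tensor product of a scalar multilinear map and a vector valued multilinear map. -/
def finTensor (h : k + p = m) (a : MultilinearMap ℝ (fun _ : Fin k => V) ℝ)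
    (b : MultilinearMap ℝ (fun _ : Fin p => V) N) : MultilinearMap ℝ (fun _ : Fin m => V) N :=
  ((TensorProduct.lid ℝ N).toLinearMap.compMultilinearMap (a.domCoprod b)).domDomCongr
    (finSumFinEquiv.trans (finCongr h))

theorem finTensor_apply (h : k + p = m) (a : MultilinearMap ℝ (fun _ : Fin k => V) ℝ)
    (b : MultilinearMap ℝ (fun _ : Fin p => V) N) (v : Fin m → V) :
    finTensor h a b v = a (fun i => v (Fin.cast h (Fin.castAdd p i))) •
      b (fun i => v (Fin.cast h (Fin.natAdd k i))) := by
  simp [finTensor, MultilinearMap.domDomCongr_apply]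

/-- The wedge product on alternating maps without topology. -/
def algWedge (h : k + p = m) (a : V [⋀^Fin k]→ₗ[ℝ] ℝ) (b : V [⋀^Fin p]→ₗ[ℝ] N) :
    V [⋀^Fin m]→ₗ[ℝ] N :=
  ((TensorProduct.lid ℝ N).toLinearMap.compAlternatingMap (a.domCoprod b)).domDomCongr
    (finSumFinEquiv.trans (finCongr h))

/-- Up to factorials every alternating map is an alternatization, so this identity transfers
properties of the tensor product, which has no sum over shuffles, to the wedge product. -/
theorem algWedge_alternatization (h : k + p = m) (a : MultilinearMap ℝ (fun _ : Fin k => V) ℝ)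
    (b : MultilinearMap ℝ (fun _ : Fin p => V) N) :
    algWedge h (MultilinearMap.alternatization a) (MultilinearMap.alternatization b) =
      MultilinearMap.alternatization (finTensor h a b) := by
  rw [finTensor, alternatization_domDomCongr, algWedge, ← MultilinearMap.domCoprod_alternization,
    LinearMap.compMultilinearMap_alternatization]

theorem algWedge_smul_left (h : k + p = m) (c : ℕ) (a : V [⋀^Fin k]→ₗ[ℝ] ℝ)
    (b : V [⋀^Fin p]→ₗ[ℝ] N) : algWedge h (c • a) b = c • algWedge h a b := by
  unfold algWedge
  rw [← AlternatingMap.domCoprod'_apply, ← AlternatingMap.domCoprod'_apply,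
    ← TensorProduct.smul_tmul', LinearMap.map_smul_of_tower AlternatingMap.domCoprod']
  ext v
  simp

theorem algWedge_smul_right (h : k + p = m) (c : ℕ) (a : V [⋀^Fin k]→ₗ[ℝ] ℝ)
    (b : V [⋀^Fin p]→ₗ[ℝ] N) : algWedge h a (c • b) = c • algWedge h a b := by
  unfold algWedge
  rw [← AlternatingMap.domCoprod'_apply, ← AlternatingMap.domCoprod'_apply,
    TensorProduct.tmul_smul, LinearMap.map_smul_of_tower AlternatingMap.domCoprod']
  ext v
  simp

theorem finTensor_assoc {kl lp : ℕ} (h : kl + p = m) (h₁ : k + l = kl) (h' : k + lp = m)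
    (h₂ : l + p = lp) (a : MultilinearMap ℝ (fun _ : Fin k => V) ℝ)
    (b : MultilinearMap ℝ (fun _ : Fin l => V) ℝ) (c : MultilinearMap ℝ (fun _ : Fin p => V) N) :
    finTensor h (finTensor h₁ a b) c = finTensor h' a (finTensor h₂ b c) := by
  subst h₁ h₂ h
  ext v
  simp only [finTensor_apply, smul_eq_mul, mul_smul]
  congr 2
  refine congrArg c (funext fun i => congrArg v (Fin.ext ?_))
  simp [add_assoc]

/-- The tensor product of multilinear maps is visibly associative, and alternatization carries it to
the wedge product. -/
theorem algWedge_assoc {kl lp : ℕ} (h : kl + p = m) (h₁ : k + l = kl) (h' : k + lp = m)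
    (h₂ : l + p = lp) (a : V [⋀^Fin k]→ₗ[ℝ] ℝ) (b : V [⋀^Fin l]→ₗ[ℝ] ℝ) (c : V [⋀^Fin p]→ₗ[ℝ] N) :
    algWedge h (algWedge h₁ a b) c = algWedge h' a (algWedge h₂ b c) := by
  -- Alternatizing an alternating `k`-form multiplies it by k!, so the transfer yields associativity
  -- up to these factorials, which are invertible over ℝ.
  have key : (k.factorial * (l.factorial * p.factorial)) • algWedge h (algWedge h₁ a b) c =
      (k.factorial * (l.factorial * p.factorial)) • algWedge h' a (algWedge h₂ b c) := by
    have h1 := algWedge_alternatization h₁ a.toMultilinearMap b.toMultilinearMap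
    have h2 := algWedge_alternatization h₂ b.toMultilinearMap c.toMultilinearMap
    have h3 : algWedge h (algWedge h₁ (MultilinearMap.alternatization a.toMultilinearMap)
        (MultilinearMap.alternatization b.toMultilinearMap))
          (MultilinearMap.alternatization c.toMultilinearMap) =
        algWedge h' (MultilinearMap.alternatization a.toMultilinearMap)
          (algWedge h₂ (MultilinearMap.alternatization b.toMultilinearMap)
          (MultilinearMap.alternatization c.toMultilinearMap)) := by
      rw [h1, h2, algWedge_alternatization, algWedge_alternatization,
        finTensor_assoc h h₁ h' h₂]
    simp only [AlternatingMap.coe_alternatization, algWedge_smul_left, algWedge_smul_right,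
      Fintype.card_fin] at h3
    simp only [mul_smul]
    rw [smul_comm (l.factorial) (p.factorial), smul_comm (k.factorial) (p.factorial),
      smul_comm (k.factorial) (l.factorial), h3, smul_comm (l.factorial) (k.factorial),
      smul_comm (p.factorial) (k.factorial), smul_comm (p.factorial) (l.factorial)]
  have h0 : ((k.factorial * (l.factorial * p.factorial) : ℕ) : ℝ) ≠ 0 := by positivity
  rw [← Nat.cast_smul_eq_nsmul ℝ, ← Nat.cast_smul_eq_nsmul ℝ] at key
  exact smul_right_injective _ h0 key

end

section

variable {V N N' : Type*} [AddCommGroup V] [Module ℝ V] [TopologicalSpace V]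
  [AddCommGroup N] [Module ℝ N] [TopologicalSpace N] [IsTopologicalAddGroup N]
  [ContinuousSMul ℝ N] [AddCommGroup N'] [Module ℝ N'] [TopologicalSpace N']
  [IsTopologicalAddGroup N'] [ContinuousSMul ℝ N'] {k l p m n : ℕ}

theorem altWedge_assoc {kl lp : ℕ} (h : kl + p = m) (h₁ : k + l = kl) (h' : k + lp = m)
    (h₂ : l + p = lp) (a : V [⋀^Fin k]→L[ℝ] ℝ) (b : V [⋀^Fin l]→L[ℝ] ℝ) (c : V [⋀^Fin p]→L[ℝ] N) :
    altWedge h (altWedge h₁ a b) c = altWedge h' a (altWedge h₂ b c) :=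
  ContinuousAlternatingMap.toAlternatingMap_injective
    (algWedge_assoc h h₁ h' h₂ a.toAlternatingMap b.toAlternatingMap c.toAlternatingMap)

theorem altWedge_zero_form_left (h : 0 + p = p) (a : V [⋀^Fin 0]→L[ℝ] ℝ) (b : V [⋀^Fin p]→L[ℝ] N) :
    altWedge h a b = a ![] • b := by
  ext v
  rw [altWedge_apply]
  -- With an empty first block every permutation preserves the blocks, so the identity is the only
  -- shuffle.
  have : Subsingleton (Equiv.Perm.ModSumCongr (Fin 0) (Fin p)) := by
    refine ⟨?_⟩
    rintro ⟨s⟩ ⟨t⟩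
    refine Quotient.sound' (QuotientGroup.leftRel_apply.2 ?_)
    refine Equiv.Perm.mem_sumCongrHom_range_of_perm_mapsTo_inl ?_
    rintro _ ⟨i, _⟩
    exact i.elim0
  refine (Fintype.sum_subsingleton _ (Quotient.mk'' 1)).trans ?_
  rw [lid_summand_mk]
  simp only [Equiv.Perm.sign_one, Units.val_one, Int.cast_one, one_smul, Equiv.Perm.coe_one, id,
    ContinuousAlternatingMap.smul_apply]
  congr 2
  · exact Subsingleton.elim _ _
  · funext i
    congr 1
    ext
    simp

theorem altWedge_zero_form_right (h : k + 0 = k) (a : V [⋀^Fin k]→L[ℝ] ℝ)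
    (b : V [⋀^Fin 0]→L[ℝ] N) : altWedge h a b = a.smulRight (b ![]) := by
  ext v
  rw [altWedge_apply]
  have : Subsingleton (Equiv.Perm.ModSumCongr (Fin k) (Fin 0)) := by
    refine ⟨?_⟩
    rintro ⟨s⟩ ⟨t⟩
    refine Quotient.sound' (QuotientGroup.leftRel_apply.2 ?_)
    refine Equiv.Perm.mem_sumCongrHom_range_of_perm_mapsTo_inl ?_
    rintro _ ⟨i, _⟩
    rcases h : (s⁻¹ * t) (Sum.inl i) with j | j
    · exact ⟨j, by simp_all⟩
    · exact j.elim0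
  refine (Fintype.sum_subsingleton _ (Quotient.mk'' 1)).trans ?_
  rw [lid_summand_mk]
  simp only [Equiv.Perm.sign_one, Units.val_one, Int.cast_one, one_smul, Equiv.Perm.coe_one, id,
    ContinuousAlternatingMap.smulRight_apply]
  congr 2
  exact Subsingleton.elim _ _

theorem altWedge_compCLM (h : k + p = m) (a : V [⋀^Fin k]→L[ℝ] ℝ) (b : V [⋀^Fin p]→L[ℝ] N)
    (g : N →L[ℝ] N') : g.compContinuousAlternatingMap (altWedge h a b) =
      altWedge h a (g.compContinuousAlternatingMap b) :=
  altWedge_comp h a b (ContinuousLinearMap.id ℝ V) g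

/-- A (1, p)-shuffle is determined by the place `i` to which the single element of the first block
goes, and its sign is (-1)ⁱ. -/
theorem altWedge_one_form (h : 1 + p = p + 1) (θ : V [⋀^Fin 1]→L[ℝ] ℝ) (b : V [⋀^Fin p]→L[ℝ] N)
    (v : Fin (p + 1) → V) :
    altWedge h θ b v = ∑ i : Fin (p + 1), (-1 : ℝ) ^ (i : ℕ) • θ ![v i] • b (i.removeNth v) := by
  rw [altWedge_apply]
  let E : Fin 1 ⊕ Fin p ≃ Fin (p + 1) := finSumFinEquiv.trans (finCongr h)
  have hE0 : E (Sum.inl 0) = 0 := by ext; simp [E]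
  have hE1 (j : Fin p) : E (Sum.inr j) = j.succ := by ext; simp [E]
  have hE0' : E.symm 0 = Sum.inl 0 := by rw [Equiv.symm_apply_eq, hE0]
  -- The inverse cycle moves 0 to `i` and keeps the other indices in order, so it represents the
  -- `i`-th shuffle.
  let s : Fin (p + 1) → Equiv.Perm (Fin 1 ⊕ Fin p) := fun i => E.symm.permCongr i.cycleRange.symm
  have hs0 (i : Fin (p + 1)) : E (s i (Sum.inl 0)) = i := by
    simp [s, Equiv.permCongr_apply, hE0]
  have hs1 (i : Fin (p + 1)) (j : Fin p) : E (s i (Sum.inr j)) = i.succAbove j := by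
    simp [s, Equiv.permCongr_apply, hE1]
  have hbij : Function.Bijective
      (fun i => (Quotient.mk'' (s i) : Equiv.Perm.ModSumCongr (Fin 1) (Fin p))) := by
    constructor
    · intro i j hij
      have h1 := QuotientGroup.leftRel_apply.1 (Quotient.exact' hij)
      obtain ⟨⟨sl, sr⟩, h2⟩ := h1
      replace h2 := inv_mul_eq_iff_eq_mul.mp h2.symm
      have h3 : s j (Sum.inl 0) = s i (Sum.inl 0) := by
        rw [h2]
        simp [Subsingleton.elim (sl 0) 0]
      rw [← hs0 i, ← hs0 j, h3]
    · rintro ⟨t⟩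
      refine ⟨E (t (Sum.inl 0)), Quotient.sound' (QuotientGroup.leftRel_apply.2 ?_)⟩
      refine Equiv.Perm.mem_sumCongrHom_range_of_perm_mapsTo_inl ?_
      rintro _ ⟨i, rfl⟩
      rw [Subsingleton.elim i 0]
      refine ⟨0, ?_⟩
      rw [Equiv.Perm.mul_apply, Equiv.Perm.eq_inv_iff_eq]
      exact E.injective (hs0 _)
  refine (Fintype.sum_bijective _ hbij _ _ fun _ => rfl).symm.trans ?_
  refine Finset.sum_congr rfl fun i _ => ?_
  rw [lid_summand_mk]
  have hsign : ((Equiv.Perm.sign (s i) : ℤ) : ℝ) = (-1 : ℝ) ^ (i : ℕ) := by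
    simp [s, Equiv.Perm.sign_permCongr, Equiv.Perm.sign_symm, Fin.sign_cycleRange]
  rw [hsign]
  congr 2
  · refine congrArg θ (funext fun j => ?_)
    rw [Subsingleton.elim j 0]
    exact congrArg v (hs0 i)
  · refine congrArg b (funext fun j => ?_)
    exact congrArg v (hs1 i j)

end

end WedgeAlgebra

/-! ### Smooth dependence of integrals on parameters -/

section ParametricIntegral


/-- Evaluation of a family of continuous linear maps parametrised by a compact space. -/
def ContinuousMap.flipCLM (K : Type*) [TopologicalSpace K] [CompactSpace K] (B Y : Type*)
    [NormedAddCommGroup B] [NormedSpace ℝ B] [NormedAddCommGroup Y] [NormedSpace ℝ Y] :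
    C(K, B →L[ℝ] Y) →L[ℝ] B →L[ℝ] C(K, Y) :=
  LinearMap.mkContinuous₂ (LinearMap.mk₂ ℝ
      (fun (g : C(K, B →L[ℝ] Y)) (v : B) => (⟨fun k => g k v, by fun_prop⟩ : C(K, Y)))
      (fun _ _ _ => rfl) (fun _ _ _ => rfl) (fun g v w => by ext k; exact map_add (g k) v w)
      (fun c g v => by ext k; exact map_smul (g k) c v)) 1
    (fun g v => by
      rw [one_mul]
      refine (ContinuousMap.norm_le _ (by positivity)).2 fun k => ?_
      exact (g k).le_of_opNorm_le (g.norm_coe_le_norm k) v)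

theorem continuous_compactCurry {K Z B Y : Type*} [TopologicalSpace K] [CompactSpace K]
    [NormedAddCommGroup Z] [NormedAddCommGroup B] [NormedAddCommGroup Y] (φ : C(K, Z))
    (f : C(Z × B, Y)) : Continuous fun y : B => (⟨fun k => f (φ k, y), by fun_prop⟩ : C(K, Y)) :=
  ContinuousMap.continuous_of_continuous_uncurry _ (by
    change Continuous fun q : B × K => f (φ q.2, q.1)
    fun_prop)

/-- The remainder must be small uniformly over the compact space. By the mean value inequality it is
controlled by the oscillation of the partial derivative, which is uniformly small because that
derivative is again a continuous curried map. -/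
theorem hasFDerivAt_compactCurry {K Z B Y : Type*} [TopologicalSpace K] [CompactSpace K]
    [NormedAddCommGroup Z] [NormedAddCommGroup B] [NormedSpace ℝ B] [NormedAddCommGroup Y]
    [NormedSpace ℝ Y] (φ : C(K, Z)) (f : C(Z × B, Y)) (f' : C(Z × B, B →L[ℝ] Y))
    (h : ∀ z y, HasFDerivAt (fun y => f (z, y)) (f' (z, y)) y) (y : B) :
    HasFDerivAt (fun y : B => (⟨fun k => f (φ k, y), by fun_prop⟩ : C(K, Y)))
      (ContinuousMap.flipCLM K B Y ⟨fun k => f' (φ k, y), by fun_prop⟩) y := by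
  rw [hasFDerivAt_iff_isLittleO_nhds_zero, Asymptotics.isLittleO_iff]
  intro ε hε
  have h1 := (continuous_compactCurry φ f').continuousAt (x := y)
  obtain ⟨δ, hδ, h2⟩ := Metric.continuousAt_iff.1 h1 ε hε
  filter_upwards [Metric.ball_mem_nhds (0 : B) hδ] with v hv
  refine (ContinuousMap.norm_le _ (by positivity)).2 fun k => ?_
  have h3 := (convex_ball y δ).norm_image_sub_le_of_norm_hasFDerivWithin_le'
    (f := fun y => f (φ k, y)) (f' := fun y => f' (φ k, y)) (φ := f' (φ k, y)) (C := ε)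
    (fun z _ => (h _ z).hasFDerivWithinAt) (fun z hz => ?_) (Metric.mem_ball_self hδ)
    (y := y + v) (by simpa using hv)
  · rw [add_sub_cancel_left] at h3
    exact h3
  · have h4 := (h2 hz).le
    rw [dist_eq_norm] at h4
    exact (ContinuousMap.norm_coe_le_norm _ k).trans h4

/-- The derivative of a curried map is, up to the linear map `ContinuousMap.flipCLM`, the curried
map of the partial derivative, so induction on the order applies. The universe of `Y` contains that
of `B`, so that `B →L[ℝ] Y` may replace `Y` in the induction. -/
theorem contDiff_compactCurry {K Z : Type*} {B : Type u} {Y : Type max u v} [TopologicalSpace K]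
    [CompactSpace K] [NormedAddCommGroup Z] [NormedSpace ℝ Z] [NormedAddCommGroup B]
    [NormedSpace ℝ B] [NormedAddCommGroup Y] [NormedSpace ℝ Y] (φ : C(K, Z)) (f : C(Z × B, Y))
    (hf : ContDiff ℝ ∞ f) :
    ContDiff ℝ ∞ fun y : B => (⟨fun k => f (φ k, y), by fun_prop⟩ : C(K, Y)) := by
  rw [contDiff_infty]
  intro n
  induction n generalizing Y with
  | zero => exact contDiff_zero.2 (continuous_compactCurry φ f)
  | succ n ih =>
    have h1 : ContDiff ℝ ∞ fun q : Z × B =>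
        (fderiv ℝ f q).comp (ContinuousLinearMap.inr ℝ Z B) :=
      (hf.fderiv_right (m := ∞) (by simp)).clm_comp contDiff_const
    have h2 := ih ⟨_, h1.continuous⟩ h1
    rw [Nat.cast_succ, contDiff_succ_iff_hasFDerivAt]
    refine ⟨_, (ContinuousMap.flipCLM K B Y).contDiff.comp h2, fun y => ?_⟩
    refine hasFDerivAt_compactCurry φ f ⟨_, h1.continuous⟩ (fun z y => ?_) y
    have h3 : HasFDerivAt (fun y : B => (z, y)) (ContinuousLinearMap.inr ℝ Z B) y :=
      hasFDerivAt_prodMk_right z y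
    exact ((hf.differentiable (by simp)) (z, y)).hasFDerivAt.comp y h3

/-- Integration over the unit interval. -/
def unitIntegralCLM (Y : Type*) [NormedAddCommGroup Y] [NormedSpace ℝ Y] :
    C(Set.Icc (0 : ℝ) 1, Y) →L[ℝ] Y :=
  LinearMap.mkContinuous
    { toFun := fun g => ∫ t in (0 : ℝ)..1, g (Set.projIcc 0 1 zero_le_one t)
      map_add' := fun a b => by
        refine intervalIntegral.integral_add ?_ ?_ <;>
          exact ((ContinuousMap.continuous _).comp continuous_projIcc).intervalIntegrable _ _
      map_smul' := fun c a => intervalIntegral.integral_smul _ _ } 1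
    (fun g => by
      have := intervalIntegral.norm_integral_le_of_norm_le_const (a := 0) (b := 1) (C := ‖g‖)
        (f := fun t => g (Set.projIcc 0 1 zero_le_one t)) fun t _ => g.norm_coe_le_norm _
      simpa using this)

theorem unitIntegralCLM_apply {Y : Type*} [NormedAddCommGroup Y] [NormedSpace ℝ Y]
    (g : C(Set.Icc (0 : ℝ) 1, Y)) (f : ℝ → Y) (h : ∀ t, g t = f t) :
    unitIntegralCLM Y g = ∫ t in (0 : ℝ)..1, f t := by
  refine intervalIntegral.integral_congr fun t ht => ?_
  rw [Set.uIcc_of_le zero_le_one] at ht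
  change g (Set.projIcc 0 1 zero_le_one t) = _
  rw [Set.projIcc_of_mem zero_le_one ht, h]

theorem norm_unitIntegralCLM_apply_le {Y : Type*} [NormedAddCommGroup Y] [NormedSpace ℝ Y]
    (g : C(Set.Icc (0 : ℝ) 1, Y)) : ‖unitIntegralCLM Y g‖ ≤ ‖g‖ := by
  simpa using (unitIntegralCLM Y).le_of_opNorm_le (LinearMap.mkContinuous_norm_le _ zero_le_one _) g

variable {B : Type u} {Y : Type max u v} [NormedAddCommGroup B] [NormedSpace ℝ B]
  [NormedAddCommGroup Y] [NormedSpace ℝ Y] {f : ℝ × B → Y}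

theorem contDiff_unitIntegral (hf : ContDiff ℝ ∞ f) :
    ContDiff ℝ ∞ fun y => ∫ t in (0 : ℝ)..1, f (t, y) := by
  have h1 := (unitIntegralCLM Y).contDiff.comp (contDiff_compactCurry
    (⟨Subtype.val, continuous_subtype_val⟩ : C(Set.Icc (0 : ℝ) 1, ℝ)) ⟨f, hf.continuous⟩ hf)
  have h2 : (unitIntegralCLM Y ∘ fun y : B =>
      (⟨fun k => f (k.1, y), by have := hf.continuous; fun_prop⟩ : C(Set.Icc (0 : ℝ) 1, Y))) =
        fun y => ∫ t in (0 : ℝ)..1, f (t, y) :=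
    funext fun y => unitIntegralCLM_apply _ _ fun t => rfl
  exact h2 ▸ h1

theorem fderiv_unitIntegral (hf : ContDiff ℝ ∞ f) (y v : B) :
    fderiv ℝ (fun y => ∫ t in (0 : ℝ)..1, f (t, y)) y v =
      ∫ t in (0 : ℝ)..1, fderiv ℝ (fun y => f (t, y)) y v := by
  let φ : C(Set.Icc (0 : ℝ) 1, ℝ) := ⟨Subtype.val, continuous_subtype_val⟩
  have h1 : ContDiff ℝ ∞ fun q : ℝ × B => (fderiv ℝ f q).comp (ContinuousLinearMap.inr ℝ ℝ B) :=
    (hf.fderiv_right (m := ∞) (by simp)).clm_comp contDiff_const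
  have h2 (t : ℝ) (y : B) : HasFDerivAt (fun y => f (t, y))
      ((fderiv ℝ f (t, y)).comp (ContinuousLinearMap.inr ℝ ℝ B)) y :=
    ((hf.differentiable (by simp)) (t, y)).hasFDerivAt.comp y (hasFDerivAt_prodMk_right t y)
  have h3 := (unitIntegralCLM Y).hasFDerivAt.comp y
    (hasFDerivAt_compactCurry φ ⟨f, hf.continuous⟩ ⟨_, h1.continuous⟩ h2 y)
  have h4 : (unitIntegralCLM Y ∘ fun y : B =>
      (⟨fun k => f (φ k, y), by fun_prop⟩ : C(Set.Icc (0 : ℝ) 1, Y))) =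
        fun y => ∫ t in (0 : ℝ)..1, f (t, y) :=
    funext fun y => unitIntegralCLM_apply _ _ fun t => rfl
  erw [h4] at h3
  rw [h3.fderiv]
  refine unitIntegralCLM_apply _ _ fun t => ?_
  rw [(h2 t y).fderiv]
  rfl

end ParametricIntegral

/-! ### Smooth solutions of Volterra equations along rays -/

section Volterra


/-- The bound makes `1 + T y` a unit of the Banach algebra of operators, and inversion is smooth on
units. The equivalence records uniqueness as well, which is needed to compare solutions on different
rays. -/
theorem exists_contDiff_one_add {B X : Type*} [NormedAddCommGroup B] [NormedSpace ℝ B]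
    [NormedAddCommGroup X] [NormedSpace ℝ X] [CompleteSpace X] (T : B → X →L[ℝ] X)
    (hT : ContDiff ℝ ∞ T) (hTn : ∀ y, ‖T y‖ ≤ 1 / 2) (x : X) :
    ∃ σ : B → X, ContDiff ℝ ∞ σ ∧ ∀ y ρ, ρ + T y ρ = x ↔ ρ = σ y := by
  have hunit (y : B) : IsUnit (1 + T y) := by
    have h1 : ‖-T y‖ < 1 := by
      rw [norm_neg]
      exact (hTn y).trans_lt (by norm_num)
    have := isUnit_one_sub_of_norm_lt_one h1
    rwa [sub_neg_eq_add] at this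
  refine ⟨fun y => Ring.inverse (1 + T y) x, ?_, fun y ρ => ⟨fun h => ?_, fun h => ?_⟩⟩
  · have h1 : ContDiff ℝ ∞ fun y => Ring.inverse (1 + T y) := by
      rw [contDiff_iff_contDiffAt]
      intro y
      obtain ⟨x, hx⟩ := hunit y
      have h2 : ContDiffAt ℝ ∞ Ring.inverse (1 + T y) := by
        rw [← hx]
        exact contDiffAt_ringInverse ℝ x
      exact h2.comp y (contDiff_const.add hT).contDiffAt
    exact h1.clm_apply contDiff_const
  · have h1 := Ring.inverse_mul_cancel _ (hunit y)
    have h2 := congrArg (fun L : X →L[ℝ] X => L ρ) h1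
    change Ring.inverse (1 + T y) (ρ + T y ρ) = ρ at h2
    rw [← h2, h]
  · have h1 := Ring.mul_inverse_cancel _ (hunit y)
    rw [h]
    exact congrArg (fun L : X →L[ℝ] X => L x) h1

section

variable {A W : Type*} [NormedAddCommGroup A] [NormedSpace ℝ A] [NormedAddCommGroup W]
  [NormedSpace ℝ W]

/-- The function `τ ↦ ∫₀¹ κ(τ, t) σ(t τ) dt`, where `κ` acts through the bilinear map `L`. -/
def volterraFun (L : A →L[ℝ] W →L[ℝ] W) (κ : C(Set.Icc (0 : ℝ) 1 × Set.Icc (0 : ℝ) 1, A))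
    (σ : C(Set.Icc (0 : ℝ) 1, W)) : C(Set.Icc (0 : ℝ) 1, W) :=
  ⟨fun τ => unitIntegralCLM W ⟨fun t => L (κ (τ, t)) (σ (t * τ)), by fun_prop⟩, by
    refine (unitIntegralCLM W).continuous.comp
      (ContinuousMap.continuous_of_continuous_uncurry _ ?_)
    change Continuous fun q : Set.Icc (0 : ℝ) 1 × Set.Icc (0 : ℝ) 1 => L (κ q) (σ (q.2 * q.1))
    fun_prop⟩

theorem volterraFun_apply (L : A →L[ℝ] W →L[ℝ] W)
    (κ : C(Set.Icc (0 : ℝ) 1 × Set.Icc (0 : ℝ) 1, A)) (σ : C(Set.Icc (0 : ℝ) 1, W))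
    (τ : Set.Icc (0 : ℝ) 1) : volterraFun L κ σ τ =
      unitIntegralCLM W ⟨fun t => L (κ (τ, t)) (σ (t * τ)), by fun_prop⟩ := rfl

theorem norm_volterraFun_le (L : A →L[ℝ] W →L[ℝ] W)
    (κ : C(Set.Icc (0 : ℝ) 1 × Set.Icc (0 : ℝ) 1, A)) (σ : C(Set.Icc (0 : ℝ) 1, W)) :
    ‖volterraFun L κ σ‖ ≤ ‖L‖ * ‖κ‖ * ‖σ‖ := by
  refine (ContinuousMap.norm_le _ (by positivity)).2 fun τ => ?_
  refine (norm_unitIntegralCLM_apply_le _).trans ?_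
  refine (ContinuousMap.norm_le _ (by positivity)).2 fun t => ?_
  exact (L (κ (τ, t))).le_of_opNorm_le_of_le
    (L.le_of_opNorm_le_of_le le_rfl (κ.norm_coe_le_norm _)) (σ.norm_coe_le_norm _)

/-- `volterraFun` as a bilinear map. -/
def volterraCLM (L : A →L[ℝ] W →L[ℝ] W) :
    C(Set.Icc (0 : ℝ) 1 × Set.Icc (0 : ℝ) 1, A) →L[ℝ]
      C(Set.Icc (0 : ℝ) 1, W) →L[ℝ] C(Set.Icc (0 : ℝ) 1, W) :=
  LinearMap.mkContinuous₂ (LinearMap.mk₂ ℝ (volterraFun L)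
      (fun a b σ => by
        refine ContinuousMap.ext fun τ => Eq.trans ?_ (map_add (unitIntegralCLM W) _ _)
        rw [volterraFun_apply]
        congr 1
        ext t
        simp)
      (fun c a σ => by
        refine ContinuousMap.ext fun τ => Eq.trans ?_ (map_smul (unitIntegralCLM W) c _)
        rw [volterraFun_apply]
        congr 1
        ext t
        simp)
      (fun κ σ σ' => by
        refine ContinuousMap.ext fun τ => Eq.trans ?_ (map_add (unitIntegralCLM W) _ _)
        rw [volterraFun_apply]
        congr 1
        ext t
        simp)
      (fun c κ σ => by
        refine ContinuousMap.ext fun τ => Eq.trans ?_ (map_smul (unitIntegralCLM W) c _)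
        rw [volterraFun_apply]
        congr 1
        ext t
        simp)) ‖L‖
    (norm_volterraFun_le L)

theorem norm_volterraCLM_apply_le (L : A →L[ℝ] W →L[ℝ] W)
    (κ : C(Set.Icc (0 : ℝ) 1 × Set.Icc (0 : ℝ) 1, A)) : ‖volterraCLM L κ‖ ≤ ‖L‖ * ‖κ‖ :=
  ContinuousLinearMap.opNorm_le_bound _ (by positivity) (norm_volterraFun_le L κ)

theorem contDiff_volterraCLM (L : A →L[ℝ] W →L[ℝ] W) : ContDiff ℝ ∞ (volterraCLM L) :=
  by fun_prop

end

open AffineMap in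
/-- A linear Volterra equation along the rays through `c`, with smooth small kernel, has a smooth
solution. -/
theorem exists_contDiff_volterra {B : Type u} {A : Type max u v} {W : Type*}
    [NormedAddCommGroup B] [NormedSpace ℝ B] [NormedAddCommGroup A] [NormedSpace ℝ A]
    [NormedAddCommGroup W] [NormedSpace ℝ W] [CompleteSpace W] (L : A →L[ℝ] W →L[ℝ] W)
    (hL : ‖L‖ ≤ 1) (k : ℝ × B → A) (hk : ContDiff ℝ ∞ k) (c : B)
    (hsmall : ∀ t ∈ Set.Icc (0 : ℝ) 1, ∀ y, ‖k (t, y)‖ ≤ 1 / 2) (w : W) :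
    ∃ s : B → W, ContDiff ℝ ∞ s ∧
      ∀ y, s y + ∫ t in (0 : ℝ)..1, L (k (t, y)) (s (lineMap c y t)) = w := by
  let φ : C(Set.Icc (0 : ℝ) 1 × Set.Icc (0 : ℝ) 1, ℝ × ℝ) := ⟨fun q => (q.1, q.2), by fun_prop⟩
  have hline : ContDiff ℝ ∞ fun q : (ℝ × ℝ) × B => (q.1.2, lineMap c q.2 q.1.1) := by
    simp only [lineMap_apply_module']
    exact (contDiff_snd.comp contDiff_fst).prodMk (((contDiff_fst.comp contDiff_fst).smul
      (contDiff_snd.sub contDiff_const)).add contDiff_const)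
  -- If `s` solves the equation, then its restriction σ(τ) = s(c + τ(y - c)) to a ray satisfies σ(τ)
  -- + ∫ κ(τ, t) σ(tτ) dt = w with this kernel. As a curried smooth map, the kernel depends smoothly
  -- on `y` in the supremum norm.
  let κ : B → C(Set.Icc (0 : ℝ) 1 × Set.Icc (0 : ℝ) 1, A) := fun y =>
    ⟨fun q => k (q.2, lineMap c y (q.1 : ℝ)), by
      have := hk.continuous.comp hline.continuous
      exact this.comp (f := fun q : Set.Icc (0 : ℝ) 1 × Set.Icc (0 : ℝ) 1 =>
        (((q.1 : ℝ), (q.2 : ℝ)), y)) (by fun_prop)⟩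
  have hκ : ContDiff ℝ ∞ κ :=
    contDiff_compactCurry φ ⟨_, (hk.comp hline).continuous⟩ (hk.comp hline)
  have hκn (y : B) : ‖κ y‖ ≤ 1 / 2 :=
    (ContinuousMap.norm_le _ (by positivity)).2 fun q => hsmall _ q.2.2 _
  have hT : ContDiff ℝ ∞ fun y => volterraCLM L (κ y) := (contDiff_volterraCLM L).comp hκ
  obtain ⟨σ, hσ, hσeq⟩ := exists_contDiff_one_add (fun y => volterraCLM L (κ y))
    hT (fun y => by
      refine (norm_volterraCLM_apply_le L (κ y)).trans ?_
      calc ‖L‖ * ‖κ y‖ ≤ 1 * (1 / 2) := by gcongr; exact hκn y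
        _ = 1 / 2 := one_mul _) (ContinuousMap.const _ w)
  have hσ1 (y : B) := (hσeq y _).2 rfl
  -- The solutions on different rays fit together: τ ↦ σ y (t τ) solves the equation attached to the
  -- point c + t(y - c), hence equals its solution by uniqueness. Therefore the values at the end
  -- points of the rays define one function on `B`.
  have hscale (y : B) (t : Set.Icc (0 : ℝ) 1) : σ y t = σ (lineMap c y (t : ℝ)) 1 := by
    let ρ : C(Set.Icc (0 : ℝ) 1, W) := ⟨fun τ => σ y (t * τ), by fun_prop⟩
    have h1 : ρ = σ (lineMap c y (t : ℝ)) := by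
      refine (hσeq _ _).1 (ContinuousMap.ext fun τ => ?_)
      have h2 := congrArg (fun g : C(Set.Icc (0 : ℝ) 1, W) => g (t * τ)) (hσ1 y)
      refine Eq.trans ?_ h2
      change σ y (t * τ) + volterraFun L (κ _) ρ τ =
        σ y (t * τ) + volterraFun L (κ y) (σ y) (t * τ)
      rw [volterraFun_apply, volterraFun_apply]
      congr 2
      refine ContinuousMap.ext fun u => ?_
      change L (k (u, lineMap c (lineMap c y (t : ℝ)) (τ : ℝ))) (σ y (t * (u * τ))) =
        L (k (u, lineMap c y ((t : ℝ) * τ))) (σ y (u * (t * τ)))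
      have h3 : lineMap c (lineMap c y (t : ℝ)) (τ : ℝ) = lineMap c y ((t : ℝ) * τ) := by
        simp only [lineMap_apply_module']
        rw [add_sub_cancel_right, smul_smul, mul_comm]
      rw [mul_left_comm t u τ, h3]
    rw [← h1]
    exact congrArg (σ y) (mul_one t).symm
  refine ⟨fun y => σ y 1, ?_, fun y => ?_⟩
  · exact (ContinuousMap.evalCLM ℝ (1 : Set.Icc (0 : ℝ) 1)).contDiff.comp hσ
  · have h1 := congrArg (fun g : C(Set.Icc (0 : ℝ) 1, W) => g 1) (hσ1 y)
    refine Eq.trans ?_ h1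
    change _ = σ y 1 + volterraFun L (κ y) (σ y) 1
    congr 1
    rw [volterraFun_apply]
    refine (unitIntegralCLM_apply _ _ fun t => ?_).symm
    change L (k (t, lineMap c y (1 : ℝ))) (σ y (t * 1)) = _
    rw [lineMap_apply_one, mul_one, hscale]

end Volterra

/-! ### Graded commutativity with one-forms and the Leibniz rule -/

section WedgeCalculus

section

variable {V N : Type*} [AddCommGroup V] [Module ℝ V] [TopologicalSpace V]
  [AddCommGroup N] [Module ℝ N] [TopologicalSpace N] [IsTopologicalAddGroup N]
  [ContinuousSMul ℝ N] {k p m : ℕ} (h : k + p = m)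

theorem altWedge_zero_left (b : V [⋀^Fin p]→L[ℝ] N) :
    altWedge h (0 : V [⋀^Fin k]→L[ℝ] ℝ) b = 0 := by
  simpa using altWedge_smul_left h (0 : ℝ) (0 : V [⋀^Fin k]→L[ℝ] ℝ) b

theorem altWedge_zero_right (a : V [⋀^Fin k]→L[ℝ] ℝ) :
    altWedge h a (0 : V [⋀^Fin p]→L[ℝ] N) = 0 := by
  simpa using altWedge_smul_right h (0 : ℝ) a (0 : V [⋀^Fin p]→L[ℝ] N)

theorem altWedge_sum_left {ι : Type*} (s : Finset ι) (a : ι → V [⋀^Fin k]→L[ℝ] ℝ)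
    (b : V [⋀^Fin p]→L[ℝ] N) : altWedge h (∑ i ∈ s, a i) b = ∑ i ∈ s, altWedge h (a i) b := by
  induction s using Finset.cons_induction with
  | empty => simp [altWedge_zero_left]
  | cons i s hi ih => rw [Finset.sum_cons, Finset.sum_cons, altWedge_add_left, ih]

theorem altWedge_sum_right {ι : Type*} (s : Finset ι) (a : V [⋀^Fin k]→L[ℝ] ℝ)
    (b : ι → V [⋀^Fin p]→L[ℝ] N) : altWedge h a (∑ i ∈ s, b i) = ∑ i ∈ s, altWedge h a (b i) := by
  induction s using Finset.cons_induction with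
  | empty => simp [altWedge_zero_right]
  | cons i s hi ih => rw [Finset.sum_cons, Finset.sum_cons, altWedge_add_right, ih]

theorem altWedge_one_form_self (h₁ : 1 + p = p + 1) (h₂ : 1 + (p + 1) = p + 2)
    (θ : V [⋀^Fin 1]→L[ℝ] ℝ) (b : V [⋀^Fin p]→L[ℝ] N) :
    altWedge h₂ θ (altWedge h₁ θ b) = 0 := by
  -- Both terms of the shuffle formula for θ ∧ θ are products of the same two values with opposite
  -- signs; associativity then gives the claim.
  have h0 : altWedge (rfl : 1 + 1 = 2) θ θ = 0 := by
    ext v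
    rw [altWedge_one_form, Fin.sum_univ_two]
    have h1 (w : Fin 1 → V) : w = ![w 0] := by
      ext i
      rw [Subsingleton.elim i 0]
      rfl
    rw [h1 ((0 : Fin 2).removeNth v), h1 ((1 : Fin 2).removeNth v)]
    simp [Fin.removeNth, Fin.succAbove, mul_comm (θ ![v 1])]
  rw [← altWedge_assoc (show 2 + p = p + 2 by omega) rfl, h0, altWedge_zero_left]

theorem altWedge_one_form_swap (h₁ : 1 + p = p + 1) (h₂ : 1 + (p + 1) = p + 2)
    (θ θ' : V [⋀^Fin 1]→L[ℝ] ℝ) (b : V [⋀^Fin p]→L[ℝ] N) :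
    altWedge h₂ θ (altWedge h₁ θ' b) = -altWedge h₂ θ' (altWedge h₁ θ b) := by
  -- Polarization of (θ + θ') ∧ (θ + θ') ∧ b = 0.
  have h0 := altWedge_one_form_self h₁ h₂ (θ + θ') b
  simp only [altWedge_add_left, altWedge_add_right, altWedge_one_form_self, zero_add,
    add_zero] at h0
  exact eq_neg_of_add_eq_zero_right h0

end

variable {V N : Type*} [NormedAddCommGroup V] [NormedSpace ℝ V] [FiniteDimensional ℝ V]
  [NormedAddCommGroup N] [NormedSpace ℝ N] {k p m : ℕ}

open ContinuousAlternatingMap Module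

variable (V) in
/-- The coordinate one-forms with respect to a basis of `V`. -/
def coordForm (j : Fin (finrank ℝ V)) : V [⋀^Fin 1]→L[ℝ] ℝ :=
  ofSubsingleton ℝ V ℝ 0 (LinearMap.toContinuousLinearMap ((finBasis ℝ V).coord j))

theorem coordForm_apply (j : Fin (finrank ℝ V)) (v : V) :
    coordForm V j ![v] = (finBasis ℝ V).coord j v := rfl

/-- Applied to a derivative this is d = ∑ dxⱼ ∧ ∂ⱼ, which reduces the Leibniz rule for d to that for
partial derivatives. -/
theorem alternatizeUncurryFin_eq_sum (h : 1 + p = p + 1) (f : V →L[ℝ] V [⋀^Fin p]→L[ℝ] N) :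
    alternatizeUncurryFin f = ∑ j, altWedge h (coordForm V j) (f (finBasis ℝ V j)) := by
  ext v
  rw [alternatizeUncurryFin_apply, ContinuousAlternatingMap.sum_apply]
  simp only [altWedge_one_form, coordForm_apply]
  rw [Finset.sum_comm]
  refine Finset.sum_congr rfl fun i _ => ?_
  rw [← Finset.smul_sum]
  have h1 : f (v i) = ∑ j, (finBasis ℝ V).coord j (v i) • f (finBasis ℝ V j) := by
    simp only [← map_smul, ← _root_.map_sum]
    exact congrArg f ((finBasis ℝ V).sum_repr (v i)).symm
  rw [h1, ContinuousAlternatingMap.sum_apply, ← Int.cast_smul_eq_zsmul ℝ]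
  simp

/-- Euler's identity ∑ dxⱼ ∧ ιⱼ a = (p + 1) a. It writes any form of positive degree through
one-forms and forms of lower degree, which permits induction on the degree. -/
theorem eq_sum_coordForm_wedge (h : 1 + p = p + 1) (a : V [⋀^Fin (p + 1)]→L[ℝ] N) :
    a = ((p : ℝ) + 1)⁻¹ • ∑ j, altWedge h (coordForm V j) (a.curryLeft (finBasis ℝ V j)) := by
  rw [← alternatizeUncurryFin_eq_sum, alternatizeUncurryFin_curryLeft,
    ← Nat.cast_smul_eq_nsmul ℝ, smul_smul]
  push_cast
  rw [inv_mul_cancel₀ (by positivity), one_smul]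

/-- Induction on `k`: after expanding `a` by Euler's identity, θ passes one coordinate form, with a
sign, and then a form of degree `k`. -/
theorem altWedge_one_form_comm (h : k + p = m) (h₁ : 1 + m = m + 1) (h₂ : 1 + p = p + 1)
    (h₃ : k + (p + 1) = m + 1) (θ : V [⋀^Fin 1]→L[ℝ] ℝ) (a : V [⋀^Fin k]→L[ℝ] ℝ)
    (b : V [⋀^Fin p]→L[ℝ] N) : altWedge h₁ θ (altWedge h a b) =
      (-1 : ℝ) ^ k • altWedge h₃ a (altWedge h₂ θ b) := by
  induction k generalizing m with
  | zero =>
    obtain rfl : p = m := by omega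
    rw [altWedge_zero_form_left, altWedge_zero_form_left, altWedge_smul_right, pow_zero, one_smul]
  | succ k ih =>
    obtain ⟨n, rfl⟩ : ∃ n, m = n + 1 := ⟨k + p, by omega⟩
    have hk : 1 + k = k + 1 := by omega
    rw [eq_sum_coordForm_wedge hk a]
    simp only [altWedge_smul_left, altWedge_smul_right, altWedge_sum_left, altWedge_sum_right]
    rw [smul_comm]
    congr 1
    rw [Finset.smul_sum]
    refine Finset.sum_congr rfl fun j _ => ?_
    rw [altWedge_assoc h hk (show 1 + n = n + 1 by omega) (show k + p = n by omega),
      altWedge_assoc h₃ hk (show 1 + (n + 1) = n + 1 + 1 by omega)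
        (show k + (p + 1) = n + 1 by omega), altWedge_one_form_swap,
      ih (show k + p = n by omega) (by omega) (by omega), altWedge_smul_right, pow_succ]
    simp

omit [FiniteDimensional ℝ V] in
theorem fderiv_altWedge (h : k + p = m) {a : V → V [⋀^Fin k]→L[ℝ] ℝ} {b : V → V [⋀^Fin p]→L[ℝ] N}
    {x : V} (ha : DifferentiableAt ℝ a x) (hb : DifferentiableAt ℝ b x) (v : V) :
    fderiv ℝ (fun y => altWedge h (a y) (b y)) x v =
      altWedge h (fderiv ℝ a x v) (b x) + altWedge h (a x) (fderiv ℝ b x v) := by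
  have h1 := (altWedgeL V N h).hasFDerivAt_of_bilinear ha.hasFDerivAt hb.hasFDerivAt
  have h2 := congrArg (fun L => L v) h1.fderiv
  exact h2.trans (add_comm _ _)

theorem extDeriv_eq_sum (h : 1 + p = p + 1) (b : V → V [⋀^Fin p]→L[ℝ] N) (x : V) :
    extDeriv b x = ∑ j, altWedge h (coordForm V j) (fderiv ℝ b x (finBasis ℝ V j)) :=
  alternatizeUncurryFin_eq_sum h _

/-- The Leibniz rule for the exterior derivative of a wedge product. -/
theorem extDeriv_altWedge (h : k + p = m) (h₁ : k + 1 + p = m + 1) (h₂ : k + (p + 1) = m + 1)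
    {a : V → V [⋀^Fin k]→L[ℝ] ℝ} {b : V → V [⋀^Fin p]→L[ℝ] N} {x : V}
    (ha : DifferentiableAt ℝ a x) (hb : DifferentiableAt ℝ b x) :
    extDeriv (fun y => altWedge h (a y) (b y)) x =
      altWedge h₁ (extDeriv a x) (b x) + (-1 : ℝ) ^ k • altWedge h₂ (a x) (extDeriv b x) := by
  have h₃ : 1 + m = m + 1 := by omega
  have h₄ : 1 + k = k + 1 := by omega
  have h₅ : 1 + p = p + 1 := by omega
  rw [extDeriv_eq_sum h₃, extDeriv_eq_sum h₄, extDeriv_eq_sum h₅,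
    altWedge_sum_left, altWedge_sum_right, Finset.smul_sum, ← Finset.sum_add_distrib]
  refine Finset.sum_congr rfl fun j _ => ?_
  -- For each `j`, dxⱼ is absorbed into ∂ⱼa by associativity and moved past the undifferentiated `a`
  -- in the other term, which produces (-1)ᵏ.
  rw [fderiv_altWedge h ha hb, altWedge_add_right,
    altWedge_assoc h₁ h₄ h₃ h, altWedge_one_form_comm h h₃ h₅ h₂ (coordForm V j) (a x)]

end WedgeCalculus

/-! ### The abstract cone operator and its homotopy formula -/

section ConeHomotopy

open AffineMap


variable {V : Type u} {X Y : Type max u v} {X₂ : Type*} [NormedAddCommGroup V] [NormedSpace ℝ V]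
  [NormedAddCommGroup X] [NormedSpace ℝ X] [NormedAddCommGroup Y] [NormedSpace ℝ Y]
  [NormedAddCommGroup X₂] [NormedSpace ℝ X₂] {p : ℕ}

/-- The cone operator `∫₀¹ tᵖ C(η(c + t(y - c)), y - c) dt` for a bilinear map `C`. -/
def coneIntegral (C : X →L[ℝ] V →L[ℝ] Y) (p : ℕ) (c : V) (η : V → X) (y : V) : Y :=
  ∫ t in (0 : ℝ)..1, t ^ p • C (η (lineMap c y t)) (y - c)

variable (C : X →L[ℝ] V →L[ℝ] Y) (c : V) {η : V → X}

theorem contDiff_lineMap_uncurry : ContDiff ℝ ∞ fun q : ℝ × V => lineMap c q.2 q.1 := by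
  simp only [lineMap_apply_module']
  exact (contDiff_fst.smul (contDiff_snd.sub contDiff_const)).add contDiff_const

theorem contDiff_coneIntegral_integrand (p : ℕ) (hη : ContDiff ℝ ∞ η) :
    ContDiff ℝ ∞ fun q : ℝ × V => q.1 ^ p • C (η (lineMap c q.2 q.1)) (q.2 - c) := by
  have h1 : ContDiff ℝ ∞ fun q : ℝ × V => η (lineMap c q.2 q.1) :=
    hη.comp (contDiff_lineMap_uncurry c)
  exact (contDiff_fst.pow p).smul
    ((C.contDiff.comp h1).clm_apply (contDiff_snd.sub contDiff_const))

theorem contDiff_coneIntegral (hη : ContDiff ℝ ∞ η) : ContDiff ℝ ∞ (coneIntegral C p c η) :=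
  contDiff_unitIntegral.{u, max u v} (contDiff_coneIntegral_integrand C c p hη)

/-- The derivative of the integrand in `coneIntegral`. -/
def coneIntegrandDeriv (C : X →L[ℝ] V →L[ℝ] Y) (p : ℕ) (c : V) (η : V → X) (y : V) (t : ℝ) :
    V →L[ℝ] Y :=
  t ^ p • (C (η (lineMap c y t)) + t • (C.flip (y - c)).comp (fderiv ℝ η (lineMap c y t)))

theorem continuous_coneIntegrandDeriv (hη : ContDiff ℝ ∞ η) (y : V) :
    Continuous (coneIntegrandDeriv C p c η y) := by
  have hl : Continuous fun t : ℝ => lineMap c y t := lineMap_continuous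
  have h1 : Continuous fun t : ℝ => η (lineMap c y t) := hη.continuous.comp hl
  have h2 : Continuous fun t : ℝ => fderiv ℝ η (lineMap c y t) :=
    (hη.continuous_fderiv (by simp)).comp hl
  unfold coneIntegrandDeriv
  exact (continuous_id.pow p).smul ((C.continuous.comp h1).add
    (continuous_id.smul (continuous_const.clm_comp h2)))

theorem fderiv_coneIntegral (hη : ContDiff ℝ ∞ η) (y : V) :
    fderiv ℝ (coneIntegral C p c η) y =
      ∫ t in (0 : ℝ)..1, coneIntegrandDeriv C p c η y t := by
  ext1 v
  rw [ContinuousLinearMap.intervalIntegral_apply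
    ((continuous_coneIntegrandDeriv C c hη y).intervalIntegrable _ _)]
  refine (fderiv_unitIntegral.{u, max u v} (contDiff_coneIntegral_integrand C c p hη) y v).trans ?_
  refine intervalIntegral.integral_congr fun t _ => ?_
  have h1 : HasFDerivAt (fun y => lineMap c y t) (t • ContinuousLinearMap.id ℝ V) y := by
    simp only [lineMap_apply_module']
    exact (((hasFDerivAt_id y).sub_const c).const_smul t).add_const c
  have h2 := ((hη.differentiable (by simp)) (lineMap c y t)).hasFDerivAt.comp y h1
  have h3 := (C.hasFDerivAt_of_bilinear h2 ((hasFDerivAt_id y).sub_const c)).const_smul (t ^ p)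
  have h4 : fderiv ℝ (fun y => t ^ p • C (η (lineMap c y t)) (y - c)) y = _ := h3.fderiv
  change fderiv ℝ (fun y => t ^ p • C (η (lineMap c y t)) (y - c)) y v = _
  rw [h4]
  simp [coneIntegrandDeriv]

/-- The sum of the two integrands is the derivative of tᵖ⁺¹ η(c + t(y - c)), so the integral from 0
to 1 is η(y). Only two linear identities matter: `h₁` is Euler's identity, and `h₂` is the algebraic
part of Cartan's formula ι d + d ι for a contraction with a constant vector. -/
theorem coneIntegral_homotopy [CompleteSpace X] [CompleteSpace Y]
    (A : (V →L[ℝ] Y) →L[ℝ] X) (d : (V →L[ℝ] X) →L[ℝ] X₂) (C₂ : X₂ →L[ℝ] V →L[ℝ] X)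
    (h₁ : ∀ a, A (C a) = ((p : ℝ) + 1) • a)
    (h₂ : ∀ f x, C₂ (d f) x + A ((C.flip x).comp f) = f x) (hη : ContDiff ℝ ∞ η) (y : V) :
    A (fderiv ℝ (coneIntegral C p c η) y) +
      ∫ t in (0 : ℝ)..1, t ^ (p + 1) • C₂ (d (fderiv ℝ η (lineMap c y t))) (y - c) = η y := by
  have hl : Continuous fun t : ℝ => lineMap c y t := lineMap_continuous
  have h0 : Continuous fun t : ℝ => fderiv ℝ η (lineMap c y t) :=
    (hη.continuous_fderiv (by simp)).comp hl
  have h3 := continuous_coneIntegrandDeriv (p := p) C c hη y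
  have h4 : Continuous fun t : ℝ => A (coneIntegrandDeriv C p c η y t) := A.continuous.comp h3
  have h5 : Continuous fun t : ℝ =>
      t ^ (p + 1) • C₂ (d (fderiv ℝ η (lineMap c y t))) (y - c) := by fun_prop
  rw [fderiv_coneIntegral C c hη, ← A.intervalIntegral_comp_comm (h3.intervalIntegrable _ _),
    ← intervalIntegral.integral_add (h4.intervalIntegrable _ _) (h5.intervalIntegrable _ _)]
  -- `h₂` applied to `y - c` turns the two terms containing the derivative of η into the derivative
  -- along the ray, and `h₁` provides the factor p + 1 from differentiating tᵖ⁺¹.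
  have h6 (t : ℝ) : HasDerivAt (fun t : ℝ => t ^ (p + 1) • η (lineMap c y t))
      (A (coneIntegrandDeriv C p c η y t) +
        t ^ (p + 1) • C₂ (d (fderiv ℝ η (lineMap c y t))) (y - c)) t := by
    have h7 : HasDerivAt (fun t : ℝ => lineMap c y t) (y - c) t := hasDerivAt_lineMap
    have h8 := ((hη.differentiable (by simp)) (lineMap c y t)).hasFDerivAt.comp_hasDerivAt t h7
    refine ((hasDerivAt_pow (p + 1) t).smul h8).congr_deriv ?_
    rw [← h₂, coneIntegrandDeriv, map_smul, map_add, map_smul, h₁]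
    simp only [Function.comp_apply, add_tsub_cancel_right]
    push_cast
    module
  rw [intervalIntegral.integral_eq_sub_of_hasDerivAt (fun t _ => h6 t)
    ((h4.add h5).intervalIntegrable _ _)]
  simp

end ConeHomotopy

/-! ### The Poincaré lemma for alternating forms -/

section Poincare

open ContinuousAlternatingMap AffineMap


variable {V : Type u} {N : Type v} [NormedAddCommGroup V] [NormedSpace ℝ V]
  [NormedAddCommGroup N] [NormedSpace ℝ N] {p : ℕ}

variable (V N p) in
/-- `curryLeft` as a continuous linear map. -/
def curryLeftCLM : (V [⋀^Fin (p + 1)]→L[ℝ] N) →L[ℝ] V →L[ℝ] V [⋀^Fin p]→L[ℝ] N :=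
  curryLeftLI.toContinuousLinearMap

/-- The homotopy operator of the Poincaré lemma for a star-shaped domain with centre `c`. -/
def poincareHomotopy (c : V) (η : V → V [⋀^Fin (p + 1)]→L[ℝ] N) (y : V) : V [⋀^Fin p]→L[ℝ] N :=
  coneIntegral (curryLeftCLM V N p) p c η y

theorem poincareHomotopy_apply (c : V) (η : V → V [⋀^Fin (p + 1)]→L[ℝ] N) (y : V) :
    poincareHomotopy c η y =
      ∫ t in (0 : ℝ)..1, t ^ p • (η (lineMap c y t)).curryLeft (y - c) := rfl

theorem contDiff_poincareHomotopy (c : V) {η : V → V [⋀^Fin (p + 1)]→L[ℝ] N}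
    (hη : ContDiff ℝ ∞ η) : ContDiff ℝ ∞ (poincareHomotopy c η) :=
  contDiff_coneIntegral _ c hη

/-- In the first alternating sum the term in which the derivative takes the inserted vector is `f
x`; the remaining terms cancel against the second sum, where the slots are shifted by one and so
carry the opposite sign. -/
theorem curryLeft_alternatizeUncurryFin_add (f : V →L[ℝ] V [⋀^Fin (p + 1)]→L[ℝ] N) (x : V)
    (g : V →L[ℝ] V [⋀^Fin p]→L[ℝ] N) (hg : ∀ v, g v = (f v).curryLeft x) :
    (alternatizeUncurryFin f).curryLeft x + alternatizeUncurryFin g = f x := by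
  ext w
  rw [ContinuousAlternatingMap.add_apply, curryLeft_apply_apply, alternatizeUncurryFin_apply,
    alternatizeUncurryFin_apply, Fin.sum_univ_succ, add_assoc, ← Finset.sum_add_distrib,
    Finset.sum_eq_zero fun i _ => ?_]
  · simp
  · rw [hg, curryLeft_apply_apply, Fin.val_succ, pow_succ]
    have h1 : i.succ.removeNth (Matrix.vecCons x w) = Matrix.vecCons x (i.removeNth w) := by
      funext j
      refine Fin.cases ?_ (fun j => ?_) j
      · simp [Fin.removeNth]
      · simp [Fin.removeNth]
    rw [h1]
    simp

variable [CompleteSpace N]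

/-- The homotopy formula of the Poincaré lemma, in positive degree. -/
theorem extDeriv_poincareHomotopy_add (c : V) {η : V → V [⋀^Fin (p + 1)]→L[ℝ] N}
    (hη : ContDiff ℝ ∞ η) (y : V) :
    extDeriv (poincareHomotopy c η) y + poincareHomotopy c (extDeriv η) y = η y :=
  coneIntegral_homotopy (curryLeftCLM V N p) c (alternatizeUncurryFinCLM ℝ V N)
    (alternatizeUncurryFinCLM ℝ V N) (curryLeftCLM V N (p + 1))
    (fun a => by
      refine (alternatizeUncurryFin_curryLeft a).trans ?_
      rw [← Nat.cast_smul_eq_nsmul ℝ]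
      push_cast
      rfl)
    (fun f x => curryLeft_alternatizeUncurryFin_add f x _ fun v => rfl) hη y

/-- The homotopy formula of the Poincaré lemma, in degree zero. -/
theorem poincareHomotopy_extDeriv_zero_form (c : V) {η : V → V [⋀^Fin 0]→L[ℝ] N}
    (hη : ContDiff ℝ ∞ η) (y : V) : poincareHomotopy c (extDeriv η) y = η y - η c := by
  have hd : ContDiff ℝ ∞ (extDeriv η) :=
    contDiff_iff_contDiffAt.2 fun z => contDiffAt_extDeriv hη.contDiffAt
  -- In degree zero the integrand is the derivative of η along the ray, and the fundamental theorem
  -- of calculus leaves the boundary value at `c`.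
  have h2 : Continuous fun t : ℝ => t ^ 0 • (extDeriv η (lineMap c y t)).curryLeft (y - c) :=
    (contDiff_coneIntegral_integrand (curryLeftCLM V N 0) c 0 hd).continuous.comp
      (f := fun t : ℝ => (t, y)) (by fun_prop)
  have h3 (t : ℝ) : HasDerivAt (fun t : ℝ => η (lineMap c y t))
      (t ^ 0 • (extDeriv η (lineMap c y t)).curryLeft (y - c)) t := by
    have h4 : HasDerivAt (fun t : ℝ => lineMap c y t) (y - c) t := hasDerivAt_lineMap
    convert! ((hη.differentiable (by simp)) (lineMap c y t)).hasFDerivAt.comp_hasDerivAt t h4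
    ext w
    rw [pow_zero, one_smul, curryLeft_apply_apply, extDeriv, alternatizeUncurryFin_apply]
    rw [Fin.sum_univ_succ, Fin.sum_univ_zero, add_zero, Fin.val_zero, pow_zero, one_smul]
    exact congrArg _ (Subsingleton.elim _ _)
  rw [poincareHomotopy_apply, intervalIntegral.integral_eq_sub_of_hasDerivAt (fun t _ => h3 t)
    (h2.intervalIntegrable _ _)]
  simp

end Poincare

/-! ### Forms of mixed degree at a point and maps linear over the exterior algebra -/

section PointwiseTotal

/-- A homogeneous basis `e i`, of degree `deg i`, of a graded vector space `F`, with coordinate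
functionals `ε i`. -/
structure GradedBasis (F : ℤ → Type*) [∀ q, NormedAddCommGroup (F q)] [∀ q, NormedSpace ℝ (F q)]
    (ι : Type*) [Fintype ι] where
  deg : ι → ℤ
  e : ∀ i, F (deg i)
  ε : ∀ i, F (deg i) →L[ℝ] ℝ
  sum_eq : ∀ (a : ∀ q, F q) (q : ℤ), ∑ i, ε i (a (deg i)) • (Pi.single (deg i) (e i) : ∀ q, F q) q =
    a q

variable {V V' : Type*} [AddCommGroup V] [Module ℝ V] [TopologicalSpace V]
  [AddCommGroup V'] [Module ℝ V'] [TopologicalSpace V']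
  {F : ℤ → Type*} [∀ q, NormedAddCommGroup (F q)] [∀ q, NormedSpace ℝ (F q)]
  {N N' : ℤ → Type*} [∀ q, AddCommGroup (N q)] [∀ q, Module ℝ (N q)] [∀ q, TopologicalSpace (N q)]
  [∀ q, IsTopologicalAddGroup (N q)] [∀ q, ContinuousSMul ℝ (N q)]
  [∀ q, AddCommGroup (N' q)] [∀ q, Module ℝ (N' q)] [∀ q, TopologicalSpace (N' q)]
  [∀ q, IsTopologicalAddGroup (N' q)] [∀ q, ContinuousSMul ℝ (N' q)]
  {ι : Type*} [Fintype ι] {k l m n p : ℕ} {q : ℤ}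

variable (V N) in
/-- Alternating forms of all degrees on `V` with values in the graded vector space `N`. -/
abbrev PtTotal := ∀ (p : ℕ) (q : ℤ), V [⋀^Fin p]→L[ℝ] N q

/-- The product of a scalar `k`-form and a form of mixed degree. -/
def ptWedge (σ : V [⋀^Fin k]→L[ℝ] ℝ) (a : PtTotal V N) : PtTotal V N :=
  fun m q => if h : k ≤ m then altWedge (Nat.add_sub_of_le h) σ (a (m - k) q) else 0

theorem ptWedge_of_add (h : k + p = m) (σ : V [⋀^Fin k]→L[ℝ] ℝ) (a : PtTotal V N) :
    ptWedge σ a m q = altWedge h σ (a p q) := by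
  obtain rfl : p = m - k := by omega
  rw [ptWedge, dif_pos (by omega)]

theorem ptWedge_of_lt (h : m < k) (σ : V [⋀^Fin k]→L[ℝ] ℝ) (a : PtTotal V N) :
    ptWedge σ a m q = 0 := by
  rw [ptWedge, dif_neg (by omega)]

/-- Splitting the indices into those below `k` and those of the form `k + p` removes the case
distinction and the truncated subtraction from `ptWedge`. -/
theorem ptWedge_ext {σ : V [⋀^Fin k]→L[ℝ] ℝ} {a : PtTotal V N} {c : PtTotal V N}
    (h₁ : ∀ m q, m < k → c m q = 0)
    (h₂ : ∀ p q, c (k + p) q = altWedge rfl σ (a p q)) : ptWedge σ a = c := by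
  funext m q
  rcases lt_or_ge m k with h | h
  · rw [ptWedge_of_lt h, h₁ m q h]
  · obtain ⟨p, rfl⟩ := Nat.exists_eq_add_of_le h
    rw [ptWedge_of_add rfl, h₂]

theorem ptWedge_add_left (σ τ : V [⋀^Fin k]→L[ℝ] ℝ) (a : PtTotal V N) :
    ptWedge (σ + τ) a = ptWedge σ a + ptWedge τ a :=
  ptWedge_ext (fun m q h => by simp [ptWedge_of_lt h])
    fun p q => by simp only [Pi.add_apply, ptWedge_of_add rfl, altWedge_add_left]

theorem ptWedge_smul_left (c : ℝ) (σ : V [⋀^Fin k]→L[ℝ] ℝ) (a : PtTotal V N) :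
    ptWedge (c • σ) a = c • ptWedge σ a :=
  ptWedge_ext (fun m q h => by simp [ptWedge_of_lt h])
    fun p q => by simp only [Pi.smul_apply, ptWedge_of_add rfl, altWedge_smul_left]

theorem ptWedge_zero_left (a : PtTotal V N) : ptWedge (0 : V [⋀^Fin k]→L[ℝ] ℝ) a = 0 := by
  simpa using ptWedge_smul_left (0 : ℝ) (0 : V [⋀^Fin k]→L[ℝ] ℝ) a

/-- `ptWedge` as a linear map in its second argument. -/
def ptWedgeₗ (σ : V [⋀^Fin k]→L[ℝ] ℝ) : PtTotal V N →ₗ[ℝ] PtTotal V N where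
  toFun := ptWedge σ
  map_add' a b := ptWedge_ext (fun m q h => by simp [ptWedge_of_lt h])
    fun p q => by simp only [Pi.add_apply, ptWedge_of_add rfl, altWedge_add_right]
  map_smul' c a := ptWedge_ext (fun m q h => by simp [ptWedge_of_lt h])
    fun p q => by
      simp only [Pi.smul_apply, ptWedge_of_add rfl, altWedge_smul_right, RingHom.id_apply]

theorem ptWedge_add (σ : V [⋀^Fin k]→L[ℝ] ℝ) (a b : PtTotal V N) :
    ptWedge σ (a + b) = ptWedge σ a + ptWedge σ b := map_add (ptWedgeₗ σ) a b

theorem ptWedge_smul (σ : V [⋀^Fin k]→L[ℝ] ℝ) (c : ℝ) (a : PtTotal V N) :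
    ptWedge σ (c • a) = c • ptWedge σ a := map_smul (ptWedgeₗ σ) c a

theorem ptWedge_zero (σ : V [⋀^Fin k]→L[ℝ] ℝ) : ptWedge σ (0 : PtTotal V N) = 0 :=
  map_zero (ptWedgeₗ σ)

theorem ptWedge_ptWedge (h : k + l = n) (σ : V [⋀^Fin k]→L[ℝ] ℝ) (τ : V [⋀^Fin l]→L[ℝ] ℝ)
    (a : PtTotal V N) : ptWedge (altWedge h σ τ) a = ptWedge σ (ptWedge τ a) := by
  refine ptWedge_ext (fun m q hm => ?_) fun p q => ?_
  · rcases lt_or_ge m k with hk | hk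
    · exact ptWedge_of_lt hk _ _
    · rw [ptWedge_of_add (Nat.add_sub_of_le hk), ptWedge_of_lt (by omega), altWedge_zero_right]
  · rw [ptWedge_of_add (show k + (l + p) = n + p by omega), ptWedge_of_add rfl]
    exact (altWedge_assoc _ _ _ _ _ _ _).symm

/-- `a` is homogeneous of total degree `m`. -/
def PtHomogeneous (m : ℤ) (a : PtTotal V N) : Prop :=
  ∀ (p : ℕ) (q : ℤ), (p : ℤ) + q ≠ m → a p q = 0

theorem PtHomogeneous.ptWedge {d : ℤ} {a : PtTotal V N} (ha : PtHomogeneous d a)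
    (σ : V [⋀^Fin k]→L[ℝ] ℝ) : PtHomogeneous (k + d) (ptWedge σ a) := by
  intro m q h
  rcases lt_or_ge m k with hk | hk
  · exact ptWedge_of_lt hk _ _
  · rw [ptWedge_of_add (Nat.add_sub_of_le hk), ha _ _ (by push_cast [hk]; omega),
      altWedge_zero_right]

variable (V N) in
/-- The sign operator `(-1)ᵖ` on `p`-forms. -/
def ptParity : PtTotal V N →ₗ[ℝ] PtTotal V N where
  toFun a := fun p q => (-1 : ℝ) ^ p • a p q
  map_add' a b := by funext p q; exact smul_add _ _ _
  map_smul' c a := by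
    funext p q
    change (-1 : ℝ) ^ p • c • a p q = c • (-1 : ℝ) ^ p • a p q
    rw [smul_comm]

theorem ptParity_apply (a : PtTotal V N) : ptParity V N a p q = (-1 : ℝ) ^ p • a p q := rfl

theorem ptParity_ptWedge (σ : V [⋀^Fin k]→L[ℝ] ℝ) (a : PtTotal V N) :
    ptParity V N (ptWedge σ a) = (-1 : ℝ) ^ k • ptWedge σ (ptParity V N a) := by
  rw [← ptWedge_smul]
  refine (ptWedge_ext (fun m q h => ?_) fun p q => ?_).symm
  · rw [ptParity_apply, ptWedge_of_lt h, smul_zero]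
  · rw [ptParity_apply, ptWedge_of_add rfl, Pi.smul_apply, Pi.smul_apply, ptParity_apply,
      smul_smul, altWedge_smul_right, pow_add]

/-- The action on forms of linear maps of the arguments and of the values. -/
def ptMap (f : V' →L[ℝ] V) (g : ∀ q, N q →L[ℝ] N' q) : PtTotal V N →ₗ[ℝ] PtTotal V' N' where
  toFun a := fun p q => ((g q).compContinuousAlternatingMap (a p q)).compContinuousLinearMap f
  map_add' a b := by
    funext p q
    ext v
    exact map_add (g q) _ _
  map_smul' c a := by
    funext p q
    ext v
    exact map_smul (g q) _ _

theorem ptMap_apply (f : V' →L[ℝ] V) (g : ∀ q, N q →L[ℝ] N' q) (a : PtTotal V N) :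
    ptMap f g a p q = ((g q).compContinuousAlternatingMap (a p q)).compContinuousLinearMap f := rfl

theorem ptMap_ptWedge (f : V' →L[ℝ] V) (g : ∀ q, N q →L[ℝ] N' q) (σ : V [⋀^Fin k]→L[ℝ] ℝ)
    (a : PtTotal V N) :
    ptMap f g (ptWedge σ a) = ptWedge (σ.compContinuousLinearMap f) (ptMap f g a) := by
  refine (ptWedge_ext (fun m q h => ?_) fun p q => ?_).symm
  · rw [ptMap_apply, ptWedge_of_lt h]
    ext v
    exact map_zero (g q)
  · rw [ptMap_apply, ptWedge_of_add rfl, altWedge_comp]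
    rfl

variable (V) in
/-- A vector of `N` as a form of degree zero. -/
def ptConst : (∀ q, N q) →ₗ[ℝ] PtTotal V N where
  toFun a
    | 0, q => ContinuousAlternatingMap.constOfIsEmpty ℝ V (Fin 0) (a q)
    | _ + 1, _ => 0
  map_add' a b := by
    funext p q
    cases p with
    | zero => rfl
    | succ p => exact (add_zero _).symm
  map_smul' c a := by
    funext p q
    cases p with
    | zero => rfl
    | succ p =>
      change (0 : V [⋀^Fin (p + 1)]→L[ℝ] N q) = c • 0
      rw [smul_zero]

theorem ptConst_succ (a : ∀ q, N q) : ptConst V a (p + 1) q = 0 := rfl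

theorem ptWedge_ptConst (σ : V [⋀^Fin k]→L[ℝ] ℝ) (a : ∀ q, N q) :
    ptWedge σ (ptConst V a) k q = σ.smulRight (a q) := by
  rw [ptWedge_of_add (add_zero k), altWedge_zero_form_right]
  rfl

theorem ptWedge_ptConst_of_ne (h : m ≠ k) (σ : V [⋀^Fin k]→L[ℝ] ℝ) (a : ∀ q, N q) :
    ptWedge σ (ptConst V a) m q = 0 := by
  rcases lt_or_ge m k with hk | hk
  · exact ptWedge_of_lt hk _ _
  · obtain ⟨r, rfl⟩ : ∃ r, m = k + (r + 1) := ⟨m - k - 1, by omega⟩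
    rw [ptWedge_of_add rfl, ptConst_succ, altWedge_zero_right]

namespace GradedBasis

variable (b : GradedBasis F ι)

/-- The coordinate forms of a form with values in `F`. -/
def coord (i : ι) (a : PtTotal V F) (p : ℕ) : V [⋀^Fin p]→L[ℝ] ℝ :=
  (b.ε i).compContinuousAlternatingMap (a p (b.deg i))

theorem coord_add (i : ι) (a a' : PtTotal V F) (p : ℕ) :
    b.coord i (a + a') p = b.coord i a p + b.coord i a' p := by
  ext v
  exact map_add (b.ε i) _ _

theorem coord_smul (i : ι) (c : ℝ) (a : PtTotal V F) (p : ℕ) :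
    b.coord i (c • a) p = c • b.coord i a p := by
  ext v
  exact map_smul (b.ε i) _ _

theorem coord_eq_zero {i : ι} {a : PtTotal V F} {p : ℕ} (h : a p (b.deg i) = 0) :
    b.coord i a p = 0 := by
  rw [coord, h]
  ext v
  exact map_zero (b.ε i)

theorem coord_ptWedge (i : ι) (h : k + p = m) (σ : V [⋀^Fin k]→L[ℝ] ℝ) (a : PtTotal V F) :
    b.coord i (ptWedge σ a) m = altWedge h σ (b.coord i a p) := by
  rw [coord, ptWedge_of_add h, altWedge_compCLM]
  rfl

theorem coord_ptWedge_of_lt (i : ι) (h : m < k) (σ : V [⋀^Fin k]→L[ℝ] ℝ) (a : PtTotal V F) :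
    b.coord i (ptWedge σ a) m = 0 := b.coord_eq_zero (ptWedge_of_lt h _ _)

/-- The basis vectors as constant forms. -/
def const (V : Type*) [AddCommGroup V] [Module ℝ V] [TopologicalSpace V] (i : ι) : PtTotal V F :=
  ptConst V (Pi.single (b.deg i) (b.e i))

theorem homogeneous_const (i : ι) : PtHomogeneous (b.deg i) (b.const V i) := by
  intro p q h
  cases p with
  | zero =>
    ext v
    refine Pi.single_eq_of_ne ?_ _
    rintro rfl
    simp at h
  | succ p => rfl

/-- The extension of a family `u i` to a map which is linear over the exterior algebra:
`∑ aᵢ ⊗ eᵢ` is sent to `∑ aᵢ ∧ uᵢ`. -/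
def extend (u : ι → PtTotal V N) : PtTotal V F →ₗ[ℝ] PtTotal V N where
  toFun a := fun m q => ∑ p ∈ Finset.range (m + 1), ∑ i, ptWedge (b.coord i a p) (u i) m q
  map_add' a a' := by
    funext m q
    simp only [coord_add, ptWedge_add_left, Pi.add_apply, Finset.sum_add_distrib]
  map_smul' c a := by
    funext m q
    simp only [coord_smul, ptWedge_smul_left, Pi.smul_apply, Finset.smul_sum, RingHom.id_apply]

/-- Coordinates of degree above `m` cannot contribute in degree `m`, so every larger range of
summation gives the same value. This allows one common range when several components are compared.
-/
theorem extend_apply (u : ι → PtTotal V N) (a : PtTotal V F) {M : ℕ} (hM : m < M) :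
    b.extend u a m q = ∑ p ∈ Finset.range M, ∑ i, ptWedge (b.coord i a p) (u i) m q := by
  refine Finset.sum_subset (Finset.range_subset_range.2 hM) fun p _ hp => ?_
  refine Finset.sum_eq_zero fun i _ => ptWedge_of_lt ?_ _ _
  simp at hp
  omega

theorem extend_ptWedge (u : ι → PtTotal V N) (σ : V [⋀^Fin k]→L[ℝ] ℝ) (a : PtTotal V F) :
    b.extend u (ptWedge σ a) = ptWedge σ (b.extend u a) := by
  refine (ptWedge_ext (fun m q h => ?_) fun r q => ?_).symm
  · rw [extend_apply b u _ (Nat.lt_succ_self m)]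
    refine Finset.sum_eq_zero fun p hp => Finset.sum_eq_zero fun i _ => ?_
    rw [coord_ptWedge_of_lt b i (by simp at hp; omega), ptWedge_zero_left]
    rfl
  · rw [extend_apply b u _ (show k + r < k + (r + 1) by omega), Finset.sum_range_add,
      extend_apply b u a (Nat.lt_succ_self r), Finset.sum_eq_zero fun p hp => ?_, zero_add,
      altWedge_sum_right]
    · refine Finset.sum_congr rfl fun p _ => ?_
      rw [altWedge_sum_right]
      refine Finset.sum_congr rfl fun i _ => ?_
      rw [coord_ptWedge b i rfl, ptWedge_ptWedge, ptWedge_of_add rfl]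
    · refine Finset.sum_eq_zero fun i _ => ?_
      rw [coord_ptWedge_of_lt b i (by simpa using hp), ptWedge_zero_left]
      rfl

/-- A map that is linear over the exterior algebra is determined by its values on the basis.
Composition of such maps is thus composition of their matrices, which later gives the inverse of a
frame and the change of frame. -/
theorem extend_extend (u : ι → PtTotal V N) (w : ι → PtTotal V F) (a : PtTotal V F) :
    b.extend (fun i => b.extend u (w i)) a = b.extend u (b.extend w a) := by
  funext m q
  -- In degree `m` only components of degree at most `m` of the inner form matter, so it may be
  -- replaced by a finite sum of mixed forms, to which linearity of `b.extend u` applies.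
  have h : b.extend u (b.extend w a) m q =
      b.extend u (∑ p ∈ Finset.range (m + 1), ∑ i, ptWedge (b.coord i a p) (w i)) m q := by
    rw [extend_apply b u _ (Nat.lt_succ_self m), extend_apply b u _ (Nat.lt_succ_self m)]
    refine Finset.sum_congr rfl fun p hp => Finset.sum_congr rfl fun i _ => ?_
    have h1 : b.coord i (b.extend w a) p =
        b.coord i (∑ p ∈ Finset.range (m + 1), ∑ i, ptWedge (b.coord i a p) (w i)) p := by
      rw [coord, coord, extend_apply b w a (Finset.mem_range.1 hp)]
      simp only [Finset.sum_apply]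
    rw [h1]
  rw [h, extend_apply b _ a (Nat.lt_succ_self m)]
  simp only [map_sum, Finset.sum_apply, extend_ptWedge]

theorem extend_const (a : PtTotal V F) : b.extend (b.const V) a = a := by
  funext m q
  rw [extend_apply b _ a (Nat.lt_succ_self m), Finset.sum_range_succ, Finset.sum_eq_zero, zero_add]
  · ext v
    rw [ContinuousAlternatingMap.sum_apply]
    simp only [const, ptWedge_ptConst]
    exact b.sum_eq (fun q => a m q v) q
  · intro p hp
    refine Finset.sum_eq_zero fun i _ => ptWedge_ptConst_of_ne ?_ _ _
    simp at hp
    omega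

theorem extend_homogeneous {u : ι → PtTotal V N} {d r : ℤ}
    (hu : ∀ i, PtHomogeneous (b.deg i + d) (u i)) {a : PtTotal V F} (ha : PtHomogeneous r a) :
    PtHomogeneous (r + d) (b.extend u a) := by
  intro m q h
  rw [extend_apply b u a (Nat.lt_succ_self m)]
  refine Finset.sum_eq_zero fun p _ => Finset.sum_eq_zero fun i _ => ?_
  by_cases h1 : (p : ℤ) + b.deg i = r
  · exact (hu i).ptWedge _ m q (by omega)
  · rw [coord_eq_zero b (ha _ _ h1), ptWedge_zero_left]
    rfl

theorem extend_ptConst (u : ι → PtTotal V N) (x : ∀ q, F q) :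
    b.extend u (ptConst V x) = ∑ i, b.ε i (x (b.deg i)) • u i := by
  funext m q
  rw [extend_apply b u _ (Nat.lt_succ_self m), Finset.sum_range_succ', Finset.sum_eq_zero, zero_add]
  · simp only [Finset.sum_apply]
    refine Finset.sum_congr rfl fun i _ => ?_
    rw [ptWedge_of_add (zero_add m), altWedge_zero_form_left]
    rfl
  · intro p _
    refine Finset.sum_eq_zero fun i _ => ?_
    rw [coord_eq_zero b (ptConst_succ _), ptWedge_zero_left]
    rfl

end GradedBasis

end PointwiseTotal

theorem contDiff_altWedge {V N : Type*} [NormedAddCommGroup V] [NormedSpace ℝ V]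
    [NormedAddCommGroup N] [NormedSpace ℝ N] {k p m : ℕ} (h : k + p = m) :
    ContDiff ℝ ∞ fun q : (V [⋀^Fin k]→L[ℝ] ℝ) × (V [⋀^Fin p]→L[ℝ] N) => altWedge h q.1 q.2 :=
  (altWedgeL V N h).isBoundedBilinearMap.contDiff

theorem ContDiffAt.altWedge {Z V N : Type*} [NormedAddCommGroup Z] [NormedSpace ℝ Z]
    [NormedAddCommGroup V] [NormedSpace ℝ V] [NormedAddCommGroup N] [NormedSpace ℝ N] {k p m : ℕ}
    (h : k + p = m) {σ : Z → V [⋀^Fin k]→L[ℝ] ℝ} {a : Z → V [⋀^Fin p]→L[ℝ] N} {z : Z}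
    (hσ : ContDiffAt ℝ ∞ σ z) (ha : ContDiffAt ℝ ∞ a z) :
    ContDiffAt ℝ ∞ (fun y => altWedge h (σ y) (a y)) z :=
  ContDiffAt.comp (g := fun q : (V [⋀^Fin k]→L[ℝ] ℝ) × (V [⋀^Fin p]→L[ℝ] N) =>
    _root_.altWedge h q.1 q.2) (f := fun y => (σ y, a y)) z (contDiff_altWedge h).contDiffAt
      (hσ.prodMk ha)

/-! ### The operator d + A on functions with values in mixed forms -/

section ConnectionOperator

variable {Z V : Type*} [NormedAddCommGroup Z] [NormedSpace ℝ Z] [NormedAddCommGroup V]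
  [NormedSpace ℝ V] {N F : ℤ → Type*} [∀ q, NormedAddCommGroup (N q)] [∀ q, NormedSpace ℝ (N q)]
  [∀ q, NormedAddCommGroup (F q)] [∀ q, NormedSpace ℝ (F q)]
  {ι : Type*} [Fintype ι] {k p m : ℕ} {q : ℤ}

/-- All components of `f` are smooth at `z`. -/
def TotalSmoothAt (f : Z → PtTotal V N) (z : Z) : Prop :=
  ∀ p q, ContDiffAt ℝ ∞ (fun y => f y p q) z

namespace TotalSmoothAt

variable {f g : Z → PtTotal V N} {z : Z}

theorem const (a : PtTotal V N) : TotalSmoothAt (fun _ : Z => a) z := fun _ _ => contDiffAt_const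

theorem add (hf : TotalSmoothAt f z) (hg : TotalSmoothAt g z) :
    TotalSmoothAt (fun y => f y + g y) z := fun p q => (hf p q).add (hg p q)

theorem smul (c : ℝ) (hf : TotalSmoothAt f z) : TotalSmoothAt (fun y => c • f y) z :=
  fun p q => (contDiff_const_smul c).contDiffAt.comp z (hf p q)

theorem congr_of_eventuallyEq (hf : TotalSmoothAt f z) (h : g =ᶠ[𝓝 z] f) : TotalSmoothAt g z :=
  fun p q => (hf p q).congr_of_eventuallyEq (h.mono fun _ hy => congrFun (congrFun hy p) q)

theorem comp {Z' : Type*} [NormedAddCommGroup Z'] [NormedSpace ℝ Z'] {φ : Z' → Z} {z' : Z'}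
    (hf : TotalSmoothAt f (φ z')) (hφ : ContDiffAt ℝ ∞ φ z') :
    TotalSmoothAt (fun y => f (φ y)) z' := fun p q => (hf p q).comp z' hφ

theorem parity (hf : TotalSmoothAt f z) : TotalSmoothAt (fun y => ptParity V N (f y)) z :=
  fun p q => (contDiff_const_smul ((-1 : ℝ) ^ p)).contDiffAt.comp z (hf p q)

theorem ptWedge {σ : Z → V [⋀^Fin k]→L[ℝ] ℝ} (hσ : ContDiffAt ℝ ∞ σ z) (hf : TotalSmoothAt f z) :
    TotalSmoothAt (fun y => ptWedge (σ y) (f y)) z := by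
  intro m q
  rcases lt_or_ge m k with h | h
  · simp only [ptWedge_of_lt h]
    exact contDiffAt_const
  · simp only [ptWedge_of_add (Nat.add_sub_of_le h)]
    exact hσ.altWedge (Nat.add_sub_of_le h) (hf (m - k) q)

theorem coord (b : GradedBasis F ι) {a : Z → PtTotal V F} (ha : TotalSmoothAt a z) (i : ι) (p : ℕ) :
    ContDiffAt ℝ ∞ (fun y => b.coord i (a y) p) z :=
  (ContinuousLinearMap.compContinuousAlternatingMapCLM (ι := Fin p) ℝ V (F (b.deg i)) ℝ
    (b.ε i)).contDiff.contDiffAt.comp z (ha p (b.deg i))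

theorem sum {κ : Type*} (s : Finset κ) {f : κ → Z → PtTotal V N}
    (h : ∀ i ∈ s, TotalSmoothAt (f i) z) : TotalSmoothAt (fun y => ∑ i ∈ s, f i y) z := by
  intro p q
  simp only [Finset.sum_apply]
  exact ContDiffAt.sum fun i hi => h i hi p q

theorem extend (b : GradedBasis F ι) {u : Z → ι → PtTotal V N} {a : Z → PtTotal V F}
    (hu : ∀ i, TotalSmoothAt (fun y => u y i) z) (ha : TotalSmoothAt a z) :
    TotalSmoothAt (fun y => b.extend (u y) (a y)) z := by
  intro m q
  simp only [b.extend_apply _ _ (Nat.lt_succ_self m)]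
  exact ContDiffAt.sum fun p _ => ContDiffAt.sum fun i _ => ptWedge (ha.coord b i p) (hu i) m q

theorem differentiableAt (hf : TotalSmoothAt f z) (p : ℕ) (q : ℤ) :
    DifferentiableAt ℝ (fun y => f y p q) z := (hf p q).differentiableAt (by simp)

end TotalSmoothAt

/-- The exterior derivative on forms of mixed degree. -/
def dTotal (f : V → PtTotal V N) (y : V) : PtTotal V N
  | 0, _ => 0
  | p + 1, q => extDeriv (fun z => f z p q) y

theorem dTotal_zero (f : V → PtTotal V N) (y : V) : dTotal f y 0 q = 0 := rfl

theorem dTotal_succ (f : V → PtTotal V N) (y : V) :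
    dTotal f y (p + 1) q = extDeriv (fun z => f z p q) y := rfl

theorem TotalSmoothAt.dTotal {f : V → PtTotal V N} {y : V} (hf : TotalSmoothAt f y) :
    TotalSmoothAt (dTotal f) y
  | 0, _ => contDiffAt_const
  | p + 1, q => contDiffAt_extDeriv (hf p q)

theorem dTotal_congr {f g : V → PtTotal V N} {y : V} (h : f =ᶠ[𝓝 y] g) :
    dTotal f y = dTotal g y := by
  funext p q
  cases p with
  | zero => rfl
  | succ p => exact Filter.EventuallyEq.extDeriv_eq (h.mono fun z hz => congrFun (congrFun hz p) q)

theorem dTotal_add {f g : V → PtTotal V N} {y : V} (hf : TotalSmoothAt f y)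
    (hg : TotalSmoothAt g y) : dTotal (fun z => f z + g z) y = dTotal f y + dTotal g y := by
  funext p q
  cases p with
  | zero => exact (add_zero _).symm
  | succ p => exact extDeriv_fun_add (hf.differentiableAt p q) (hg.differentiableAt p q)

theorem dTotal_const (a : PtTotal V N) (y : V) : dTotal (fun _ => a) y = 0 := by
  funext p q
  cases p with
  | zero => rfl
  | succ p =>
    rw [dTotal_succ, extDeriv, fderiv_fun_const]
    ext v
    rw [ContinuousAlternatingMap.alternatizeUncurryFin_apply]
    exact Finset.sum_eq_zero fun i _ => smul_zero _

theorem dTotal_sum {κ : Type*} (s : Finset κ) {f : κ → V → PtTotal V N} {y : V}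
    (h : ∀ i ∈ s, TotalSmoothAt (f i) y) :
    dTotal (fun z => ∑ i ∈ s, f i z) y = ∑ i ∈ s, dTotal (f i) y := by
  induction s using Finset.cons_induction with
  | empty => simpa using dTotal_const (0 : PtTotal V N) y
  | cons i s hi ih =>
    simp only [Finset.sum_cons]
    rw [dTotal_add (h i (by simp)) (.sum s fun j hj => h j (by simp [hj])),
      ih fun j hj => h j (by simp [hj])]

theorem dTotal_dTotal {f : V → PtTotal V N} {y : V} (hf : TotalSmoothAt f y) :
    dTotal (dTotal f) y = 0 := by
  funext p q
  match p with
  | 0 => rfl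
  | 1 =>
    exact congrFun (congrFun (dTotal_const (0 : PtTotal V N) y) 1) q
  | p + 2 =>
    exact extDeriv_extDeriv_apply (hf p q)
      (by rw [minSmoothness_of_isRCLikeNormedField]; exact WithTop.coe_le_coe.2 le_top)

theorem ptHomogeneous_dTotal {f : V → PtTotal V N} {d : ℤ} (y : V)
    (h : ∀ᶠ z in 𝓝 y, PtHomogeneous d (f z)) : PtHomogeneous (d + 1) (dTotal f y) := by
  intro p q hp
  cases p with
  | zero => rfl
  | succ p =>
    have h1 : (fun z => f z p q) =ᶠ[𝓝 y] fun _ => 0 :=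
      h.mono fun z hz => hz p q (by push_cast at hp; omega)
    rw [dTotal_succ, h1.extDeriv_eq]
    exact congrFun (congrFun (dTotal_const (0 : PtTotal V N) y) (p + 1)) q

variable (b : GradedBasis F ι)

theorem GradedBasis.coord_dTotal_succ {a : V → PtTotal V F} {y : V} (ha : TotalSmoothAt a y) (i : ι)
    (p : ℕ) : b.coord i (dTotal a y) (p + 1) = extDeriv (fun z => b.coord i (a z) p) y := by
  have h1 := ((ContinuousLinearMap.compContinuousAlternatingMapCLM (ι := Fin p) ℝ V (F (b.deg i)) ℝ
    (b.ε i)).hasFDerivAt.comp y (ha.differentiableAt p (b.deg i)).hasFDerivAt).fderiv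
  have h2 : fderiv ℝ (fun z => b.coord i (a z) p) y =
    (ContinuousLinearMap.compContinuousAlternatingMapCLM (ι := Fin p) ℝ V (F (b.deg i)) ℝ
      (b.ε i)).comp (fderiv ℝ (fun z => a z p (b.deg i)) y) := h1
  ext v
  rw [extDeriv, h2, GradedBasis.coord, dTotal_succ, extDeriv]
  simp [ContinuousAlternatingMap.alternatizeUncurryFin_apply, map_sum]

theorem GradedBasis.ptParity_extend (u : ι → PtTotal V N) (a : PtTotal V F) :
    ptParity V N (b.extend u a) = b.extend (fun i => ptParity V N (u i)) (ptParity V F a) := by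
  funext m q
  rw [ptParity_apply, b.extend_apply _ _ (Nat.lt_succ_self m),
    b.extend_apply _ _ (Nat.lt_succ_self m), Finset.smul_sum]
  refine Finset.sum_congr rfl fun p _ => ?_
  rw [Finset.smul_sum]
  refine Finset.sum_congr rfl fun i _ => ?_
  have h3 : b.coord i (ptParity V F a) p = (-1 : ℝ) ^ p • b.coord i a p := by
    ext v
    exact map_smul (b.ε i) _ _
  rw [h3, ptWedge_smul_left, ← ptParity_ptWedge]
  rfl

/-- The operator `d + A`, where `A a = β (±a)` is the product with the family of forms `β`. -/
def connOp (β : V → ι → PtTotal V F) (f : V → PtTotal V F) (y : V) : PtTotal V F :=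
  dTotal f y + b.extend (β y) (ptParity V F (f y))

theorem connOp_congr (β : V → ι → PtTotal V F) {f g : V → PtTotal V F} {y : V}
    (h : f =ᶠ[𝓝 y] g) : connOp b β f y = connOp b β g y := by
  rw [connOp, connOp, dTotal_congr h, h.eq_of_nhds]

theorem TotalSmoothAt.connOp {β : V → ι → PtTotal V F} {f : V → PtTotal V F} {y : V}
    (hβ : ∀ i, TotalSmoothAt (fun z => β z i) y) (hf : TotalSmoothAt f y) :
    TotalSmoothAt (connOp b β f) y :=
  hf.dTotal.add (.extend b hβ hf.parity)

variable [FiniteDimensional ℝ V]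

theorem dTotal_ptWedge {σ : V → V [⋀^Fin k]→L[ℝ] ℝ} {f : V → PtTotal V N} {y : V}
    (hσ : ContDiffAt ℝ ∞ σ y) (hf : TotalSmoothAt f y) :
    dTotal (fun z => ptWedge (σ z) (f z)) y =
      ptWedge (extDeriv σ y) (f y) + (-1 : ℝ) ^ k • ptWedge (σ y) (dTotal f y) := by
  have hσ' := hσ.differentiableAt (by simp)
  funext m q
  simp only [Pi.add_apply, Pi.smul_apply]
  cases m with
  | zero =>
    rw [ptWedge_of_lt (by omega), dTotal_zero, zero_add]
    cases k with
    | zero =>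
      rw [ptWedge_of_add (add_zero 0), dTotal_zero, altWedge_zero_right, smul_zero]
    | succ k => rw [ptWedge_of_lt (by omega), smul_zero]
  | succ m =>
    rw [dTotal_succ]
    rcases lt_trichotomy (m + 1) k with h | h | h
    · simp only [ptWedge_of_lt h, ptWedge_of_lt (show m + 1 < k + 1 by omega),
        ptWedge_of_lt (show m < k by omega), smul_zero, add_zero]
      exact congrFun (congrFun (dTotal_const (0 : PtTotal V N) y) (m + 1)) q
    · subst h
      simp only [ptWedge_of_lt (show m + 1 < m + 1 + 1 by omega),
        ptWedge_of_lt (show m < m + 1 by omega), ptWedge_of_add (add_zero (m + 1)), dTotal_zero,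
        altWedge_zero_right, smul_zero, add_zero]
      exact congrFun (congrFun (dTotal_const (0 : PtTotal V N) y) (m + 1)) q
    · obtain ⟨p, rfl⟩ : ∃ p, m = k + p := ⟨m - k, by omega⟩
      simp only [ptWedge_of_add (show k + p = k + p from rfl),
        ptWedge_of_add (show k + 1 + p = k + p + 1 by omega),
        ptWedge_of_add (show k + (p + 1) = k + p + 1 by omega), dTotal_succ]
      exact extDeriv_altWedge _ _ _ hσ' (hf.differentiableAt p q)

/-- This is d(∑ aᵢ ∧ sᵢ) = ∑ daᵢ ∧ sᵢ + ∑ (-1)ᵖ aᵢ ∧ dsᵢ; the sign is carried by `ptParity`, so both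
sums are again values of `b.extend`. -/
theorem dTotal_extend {s : V → ι → PtTotal V N} {a : V → PtTotal V F} {y : V}
    (hs : ∀ i, TotalSmoothAt (fun z => s z i) y) (ha : TotalSmoothAt a y) :
    dTotal (fun z => b.extend (s z) (a z)) y = b.extend (s y) (dTotal a y) +
      b.extend (fun i => dTotal (fun z => s z i) y) (ptParity V F (a y)) := by
  funext m q
  cases m with
  | zero =>
    rw [Pi.add_apply, Pi.add_apply, b.extend_apply _ _ zero_lt_one, b.extend_apply _ _ zero_lt_one,
      Finset.sum_range_one, Finset.sum_range_one, Finset.sum_eq_zero fun i _ => ?_,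
      Finset.sum_eq_zero fun i _ => ?_, add_zero]
    · rfl
    · rw [ptWedge_of_add (add_zero 0), dTotal_zero, altWedge_zero_right]
    · rw [b.coord_eq_zero (dTotal_zero _ _), ptWedge_zero_left]
      rfl
  | succ m =>
    have h1 : dTotal (fun z => b.extend (s z) (a z)) y (m + 1) q =
        dTotal (fun z => ∑ p ∈ Finset.range (m + 1), ∑ i,
          ptWedge (b.coord i (a z) p) (s z i)) y (m + 1) q := by
      rw [dTotal_succ, dTotal_succ]
      congr 1
      funext z
      rw [b.extend_apply _ _ (Nat.lt_succ_self m)]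
      simp only [Finset.sum_apply]
    have h2 (p : ℕ) (i : ι) : TotalSmoothAt (fun z => ptWedge (b.coord i (a z) p) (s z i)) y :=
      .ptWedge (ha.coord b i p) (hs i)
    -- Since d raises the degree, the sum over the coordinates of `dTotal a` is shifted by one and
    -- loses its term of degree 0. In the other sum the top term vanishes because `dTotal` has no
    -- component of degree 0.
    rw [h1, dTotal_sum _ fun p _ => .sum _ fun i _ => h2 p i, Pi.add_apply, Pi.add_apply,
      b.extend_apply _ _ (Nat.lt_succ_self (m + 1)), b.extend_apply _ _ (Nat.lt_succ_self (m + 1)),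
      Finset.sum_range_succ' _ (m + 1), Finset.sum_range_succ _ (m + 1),
      Finset.sum_eq_zero (s := Finset.univ) (f := fun i =>
        ptWedge (b.coord i (dTotal a y) 0) (s y i) (m + 1) q) fun i _ => ?_, add_zero,
      Finset.sum_eq_zero (s := Finset.univ) (f := fun i =>
        ptWedge (b.coord i (ptParity V F (a y)) (m + 1)) (dTotal (fun z => s z i) y) (m + 1) q)
        fun i _ => ?_, add_zero, ← Finset.sum_add_distrib]
    · simp only [Finset.sum_apply]
      refine Finset.sum_congr rfl fun p _ => ?_
      rw [dTotal_sum _ fun i _ => h2 p i, ← Finset.sum_add_distrib]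
      simp only [Finset.sum_apply]
      refine Finset.sum_congr rfl fun i _ => ?_
      rw [dTotal_ptWedge (ha.coord b i p) (hs i), b.coord_dTotal_succ ha]
      have h3 : b.coord i (ptParity V F (a y)) p = (-1 : ℝ) ^ p • b.coord i (a y) p := by
        ext v
        exact map_smul (b.ε i) _ _
      rw [h3, ptWedge_smul_left]
      rfl
    · rw [ptWedge_of_add (add_zero (m + 1)), dTotal_zero, altWedge_zero_right]
    · rw [b.coord_eq_zero (dTotal_zero _ _), ptWedge_zero_left]
      rfl

theorem connOp_ptWedge (β : V → ι → PtTotal V F) {σ : V → V [⋀^Fin k]→L[ℝ] ℝ} {f : V → PtTotal V F}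
    {y : V} (hσ : ContDiffAt ℝ ∞ σ y) (hf : TotalSmoothAt f y) :
    connOp b β (fun z => ptWedge (σ z) (f z)) y =
      ptWedge (extDeriv σ y) (f y) + (-1 : ℝ) ^ k • ptWedge (σ y) (connOp b β f y) := by
  rw [connOp, dTotal_ptWedge hσ hf, ptParity_ptWedge, map_smul, b.extend_ptWedge, connOp,
    ptWedge_add, smul_add, add_assoc]

/-- The change of frame formula: in a frame `s` the operator acts by d on coefficients plus
multiplication by the images of the frame forms. -/
theorem connOp_extend (β : V → ι → PtTotal V F) {s : V → ι → PtTotal V F} {a : V → PtTotal V F}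
    {y : V} (hs : ∀ i, TotalSmoothAt (fun z => s z i) y) (ha : TotalSmoothAt a y) :
    connOp b β (fun z => b.extend (s z) (a z)) y = b.extend (s y) (dTotal a y) +
      b.extend (fun i => connOp b β (fun z => s z i) y) (ptParity V F (a y)) := by
  rw [connOp, dTotal_extend b hs ha, b.ptParity_extend, ← b.extend_extend, add_assoc]
  congr 1
  funext m q
  simp only [b.extend_apply _ _ (Nat.lt_succ_self m), Pi.add_apply, ← Finset.sum_add_distrib]
  refine Finset.sum_congr rfl fun p _ => Finset.sum_congr rfl fun i _ => ?_
  rw [connOp, ptWedge_add]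
  rfl

end ConnectionOperator

/-! ### Reduction of mixed forms to finitely many components -/

section Truncation

instance {V N : Type*} [NormedAddCommGroup V] [NormedSpace ℝ V] [FiniteDimensional ℝ V]
    [NormedAddCommGroup N] [NormedSpace ℝ N] [FiniteDimensional ℝ N] (p : ℕ) :
    FiniteDimensional ℝ (V [⋀^Fin p]→L[ℝ] N) :=
  FiniteDimensional.of_injective
    ({ toFun := fun f => f.toMultilinearMap
       map_add' := fun _ _ => rfl
       map_smul' := fun _ _ => rfl } :
      (V [⋀^Fin p]→L[ℝ] N) →ₗ[ℝ] MultilinearMap ℝ (fun _ : Fin p => V) N)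
    fun _ _ h => ContinuousAlternatingMap.ext fun v => congrArg (fun F => F v) h

theorem ContinuousAlternatingMap.subsingleton_of_finrank_lt {V N : Type*} [NormedAddCommGroup V]
    [NormedSpace ℝ V] [FiniteDimensional ℝ V] [AddCommGroup N] [Module ℝ N] [TopologicalSpace N]
    {p : ℕ} (hp : Module.finrank ℝ V < p) : Subsingleton (V [⋀^Fin p]→L[ℝ] N) := by
  refine subsingleton_of_forall_eq 0 fun f => ?_
  ext v
  refine f.toAlternatingMap.map_linearDependent v fun h => ?_
  have := h.fintype_card_le_finrank
  simp at this
  omega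

variable {V : Type*} {F : ℤ → Type*} [NormedAddCommGroup V] [NormedSpace ℝ V]
  [∀ q, NormedAddCommGroup (F q)] [∀ q, NormedSpace ℝ (F q)] {p : ℕ} {q : ℤ}

variable (V F) in
/-- The components of a form of mixed degree with indices in `T`. -/
abbrev Truncated (T : Finset (ℕ × ℤ)) := ∀ i : T, V [⋀^Fin i.1.1]→L[ℝ] F i.1.2

variable (V F) in
/-- Truncation of forms of mixed degree. -/
def truncate (T : Finset (ℕ × ℤ)) : PtTotal V F →ₗ[ℝ] Truncated V F T where
  toFun a := fun i => a i.1.1 i.1.2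
  map_add' _ _ := rfl
  map_smul' _ _ := rfl

variable (V F) in
/-- Extension by zero of the components with indices in `T`. -/
def untruncate (T : Finset (ℕ × ℤ)) : Truncated V F T →ₗ[ℝ] PtTotal V F where
  toFun w := fun p q => if h : (p, q) ∈ T then w ⟨(p, q), h⟩ else 0
  map_add' a b := by
    funext p q
    by_cases h : (p, q) ∈ T <;> simp [h]
  map_smul' c a := by
    funext p q
    by_cases h : (p, q) ∈ T <;> simp [h]

theorem untruncate_of_mem {T : Finset (ℕ × ℤ)} (w : Truncated V F T) (h : (p, q) ∈ T) :
    untruncate V F T w p q = w ⟨(p, q), h⟩ := dif_pos h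

theorem untruncate_of_notMem {T : Finset (ℕ × ℤ)} (w : Truncated V F T) (h : (p, q) ∉ T) :
    untruncate V F T w p q = 0 := dif_neg h

theorem totalSmoothAt_untruncate {Z : Type*} [NormedAddCommGroup Z] [NormedSpace ℝ Z]
    {T : Finset (ℕ × ℤ)} {s : Z → Truncated V F T} {z : Z} (hs : ContDiffAt ℝ ∞ s z) :
    TotalSmoothAt (fun y => untruncate V F T (s y)) z := by
  intro p q
  by_cases h : (p, q) ∈ T
  · simp only [untruncate_of_mem _ h]
    exact contDiffAt_pi.1 hs ⟨(p, q), h⟩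
  · simp only [untruncate_of_notMem _ h]
    exact contDiffAt_const

theorem TotalSmoothAt.truncate {Z : Type*} [NormedAddCommGroup Z] [NormedSpace ℝ Z]
    (T : Finset (ℕ × ℤ)) {f : Z → PtTotal V F} {z : Z} (hf : TotalSmoothAt f z) :
    ContDiffAt ℝ ∞ (fun y => truncate V F T (f y)) z :=
  contDiffAt_pi.2 fun i => hf i.1.1 i.1.2

variable (V F) in
/-- The index set `T` contains the degrees of all nonzero forms. -/
def IsFullIndexSet (T : Finset (ℕ × ℤ)) : Prop :=
  ∀ p q, (p, q) ∉ T → Subsingleton (V [⋀^Fin p]→L[ℝ] F q)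

/-- Forms of degree above the dimension vanish, and only finitely many `F q` are nonzero. Mixed
forms are thus equivalent to points of a finite-dimensional normed space, where the Volterra theory
applies. -/
theorem exists_isFullIndexSet [FiniteDimensional ℝ V] (hF : {q : ℤ | Nontrivial (F q)}.Finite) :
    ∃ T, IsFullIndexSet V F T := by
  refine ⟨Finset.range (Module.finrank ℝ V + 1) ×ˢ hF.toFinset, fun p q h => ?_⟩
  by_cases hp : Module.finrank ℝ V < p
  · exact ContinuousAlternatingMap.subsingleton_of_finrank_lt hp
  · have hq : ¬ Nontrivial (F q) := fun hq => h (by simp; exact ⟨by omega, hq⟩)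
    rw [not_nontrivial_iff_subsingleton] at hq
    exact ⟨fun f g => ContinuousAlternatingMap.ext fun v => Subsingleton.elim _ _⟩

theorem IsFullIndexSet.untruncate_truncate {T : Finset (ℕ × ℤ)} (hT : IsFullIndexSet V F T)
    (a : PtTotal V F) : untruncate V F T (truncate V F T a) = a := by
  funext p q
  by_cases h : (p, q) ∈ T
  · exact untruncate_of_mem _ h
  · have := hT p q h
    exact Subsingleton.elim _ _

end Truncation

/-- The kernel vanishes for `y = c` and every `t`; compactness of the unit interval makes it small
for all `t` simultaneously. -/
theorem eventually_forall_norm_le {B W : Type*} [NormedAddCommGroup B] [NormedAddCommGroup W]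
    {k : ℝ × B → W} (hk : Continuous k) (c : B) (h0 : ∀ t, k (t, c) = 0) :
    ∀ᶠ y in 𝓝 c, ∀ t ∈ Set.Icc (0 : ℝ) 1, ‖k (t, y)‖ ≤ 1 / 2 := by
  refine isCompact_Icc.eventually_forall_of_forall_eventually fun t _ => ?_
  have h1 : Continuous fun z : B × ℝ => k (z.2, z.1) := hk.comp (by fun_prop)
  have h2 : ∀ᶠ z in 𝓝 (c, t), ‖k (z.2, z.1)‖ < 1 / 2 :=
    h1.norm.continuousAt.eventually_lt continuousAt_const (by simp [h0])
  exact h2.mono fun _ hz => hz.le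

open AffineMap in
/-- Uniqueness for homogeneous linear Volterra equations along the rays through `c`. -/
theorem eventually_eq_zero_of_volterra {B W : Type*} [NormedAddCommGroup B] [NormedSpace ℝ B]
    [FiniteDimensional ℝ B] [NormedAddCommGroup W] [NormedSpace ℝ W] {k : ℝ × B → W →L[ℝ] W}
    (hk : Continuous k) (c : B) (h0 : ∀ t, k (t, c) = 0) {R : B → W} (hR : Continuous R)
    (h : ∀ᶠ y in 𝓝 c, R y + ∫ t in (0 : ℝ)..1, k (t, y) (R (lineMap c y t)) = 0) :
    ∀ᶠ y in 𝓝 c, R y = 0 := by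
  obtain ⟨r, hr, hball⟩ := Metric.nhds_basis_closedBall.eventually_iff.1
    (h.and (eventually_forall_norm_le hk c h0))
  -- A closed ball about `c` contains the rays from `c` to its points. At a maximum point of ‖R‖ the
  -- equation with a kernel of norm at most 1/2 gives ‖R z‖ ≤ ‖R z‖ / 2.
  obtain ⟨z, hz, hmax⟩ := (isCompact_closedBall c r).exists_isMaxOn
    ⟨c, Metric.mem_closedBall_self hr.le⟩ hR.norm.continuousOn
  have h1 : ‖R z‖ ≤ ‖R z‖ / 2 := by
    have h2 : R z = -∫ t in (0 : ℝ)..1, k (t, z) (R (lineMap c z t)) :=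
      eq_neg_of_add_eq_zero_left (hball hz).1
    have h3 := intervalIntegral.norm_integral_le_of_norm_le_const (a := (0 : ℝ)) (b := 1)
      (f := fun t => k (t, z) (R (lineMap c z t))) (C := ‖R z‖ / 2) fun t ht => by
        rw [Set.uIoc_of_le zero_le_one] at ht
        have ht' : t ∈ Set.Icc (0 : ℝ) 1 := ⟨ht.1.le, ht.2⟩
        have h4 : lineMap c z t ∈ Metric.closedBall c r :=
          (convex_closedBall c r).lineMap_mem (Metric.mem_closedBall_self hr.le) hz ht'
        have h5 := (k (t, z)).le_of_opNorm_le_of_le ((hball hz).2 t ht') (hmax h4)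
        linarith
    calc ‖R z‖ = ‖∫ t in (0 : ℝ)..1, k (t, z) (R (lineMap c z t))‖ := by
          conv_lhs => rw [h2, norm_neg]
      _ ≤ _ := by simpa using h3
  filter_upwards [Metric.closedBall_mem_nhds c hr] with y hy
  have h6 : ‖R y‖ ≤ ‖R z‖ := hmax hy
  exact norm_le_zero_iff.1 (by linarith)

open AffineMap in
-- Multiplication of the kernel by a bump function of `y` makes it small everywhere without changing
-- the equation near `c`. The cutoff depends on the end point of the ray only, so where it is one
-- the original integral is recovered.
theorem exists_contDiff_volterra_near {B : Type u} {W : Type max u v}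
    [NormedAddCommGroup B] [NormedSpace ℝ B] [FiniteDimensional ℝ B] [NormedAddCommGroup W]
    [NormedSpace ℝ W] [CompleteSpace W] (k : ℝ × B → W →L[ℝ] W) (hk : ContDiff ℝ ∞ k) (c : B)
    (h0 : ∀ t, k (t, c) = 0) (w : W) :
    ∃ s : B → W, ContDiff ℝ ∞ s ∧
      ∀ᶠ y in 𝓝 c, s y + ∫ t in (0 : ℝ)..1, k (t, y) (s (lineMap c y t)) = w := by
  obtain ⟨r, hr, h⟩ := Metric.eventually_nhds_iff_ball.1
    (eventually_forall_norm_le hk.continuous c h0)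
  let ψ : ContDiffBump c := ⟨r / 2, r, by positivity, by linarith⟩
  obtain ⟨s, hs, hsw⟩ := exists_contDiff_volterra.{u, max u v}
    (ContinuousLinearMap.id ℝ (W →L[ℝ] W))
    ContinuousLinearMap.norm_id_le (fun z => ψ z.2 • k z)
    ((ψ.contDiff.comp contDiff_snd).smul hk) c
    (fun t ht y => by
      by_cases hy : y ∈ Metric.ball c r
      · rw [norm_smul, Real.norm_of_nonneg ψ.nonneg]
        exact (mul_le_of_le_one_left (norm_nonneg _) ψ.le_one).trans (h y hy t ht)
      · have h0 : ψ y = 0 := ψ.zero_of_le_dist (by simpa using hy)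
        simp [h0]) w
  refine ⟨s, hs, ?_⟩
  filter_upwards [ψ.eventuallyEq_one] with y hy
  have h1 := hsw y
  simpa [hy] using h1

/-! ### The composition of the homotopy operator and A as a Volterra operator -/

section Volterra

open AffineMap

variable {V : Type u} {F : ℤ → Type v} [NormedAddCommGroup V] [NormedSpace ℝ V]
  [∀ q, NormedAddCommGroup (F q)] [∀ q, NormedSpace ℝ (F q)] {ι : Type*} [Fintype ι]
  (b : GradedBasis F ι) {p : ℕ} {q : ℤ} {d : ℤ}

/-- Multiplication by the connection form `β`. -/
def connForm (β : V → ι → PtTotal V F) (y : V) : PtTotal V F →ₗ[ℝ] PtTotal V F :=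
  (b.extend (β y)).comp (ptParity V F)

theorem connForm_apply (β : V → ι → PtTotal V F) (y : V) (a : PtTotal V F) :
    connForm b β y a = b.extend (β y) (ptParity V F a) := rfl

theorem connOp_eq (β : V → ι → PtTotal V F) (f : V → PtTotal V F) (y : V) :
    connOp b β f y = dTotal f y + connForm b β y (f y) := rfl

theorem totalSmoothAt_connForm {Z : Type*} [NormedAddCommGroup Z] [NormedSpace ℝ Z]
    {β : V → ι → PtTotal V F} {g : Z → V} {f : Z → PtTotal V F} {z : Z}
    (hβ : ∀ i, TotalSmoothAt (fun y => β y i) (g z)) (hg : ContDiffAt ℝ ∞ g z)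
    (hf : TotalSmoothAt f z) : TotalSmoothAt (fun y => connForm b β (g y) (f y)) z := by
  have h1 : ∀ i, TotalSmoothAt (fun y => β (g y) i) z := fun i => (hβ i).comp hg
  have h2 := TotalSmoothAt.extend b h1 hf.parity
  simp only [connForm_apply]
  exact h2

theorem ptHomogeneous_parity {a : PtTotal V F} (h : PtHomogeneous d a) :
    PtHomogeneous d (ptParity V F a) := by
  intro p q hpq
  rw [ptParity_apply, h p q hpq]
  exact smul_zero ((-1 : ℝ) ^ p)

theorem ptHomogeneous_connForm {β : V → ι → PtTotal V F} {y : V}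
    (hβ : ∀ i, PtHomogeneous (b.deg i + 1) (β y i)) {a : PtTotal V F} (h : PtHomogeneous d a) :
    PtHomogeneous (d + 1) (connForm b β y a) := by
  rw [connForm_apply]
  exact b.extend_homogeneous hβ (ptHomogeneous_parity h)

/-- Contraction with `x`, with the weights which occur in the homotopy operator. -/
def coneContraction (x : V) (t : ℝ) : PtTotal V F →ₗ[ℝ] PtTotal V F where
  toFun a := fun p q => t ^ p • curryLeftCLM V (F q) p (a (p + 1) q) x
  map_add' a a' := by
    funext p q
    exact smul_add (t ^ p) ((a (p + 1) q).curryLeft x) ((a' (p + 1) q).curryLeft x)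
  map_smul' r a := by
    funext p q
    exact smul_comm (t ^ p) r ((a (p + 1) q).curryLeft x)

/-- The composition of the connection form `β` and the Poincaré homotopy operator. -/
def homotopyConn (β : V → ι → PtTotal V F) (c : V) (f : V → PtTotal V F) (y : V) : PtTotal V F :=
  fun _ q => poincareHomotopy c (fun z => connForm b β z (f z) _ q) y

variable [FiniteDimensional ℝ V] [∀ q, FiniteDimensional ℝ (F q)]

/-- The kernel of the operator `homotopyConn` on truncated forms. -/
def volterraKernel (β : V → ι → PtTotal V F) (c : V) (T : Finset (ℕ × ℤ)) (z : ℝ × V) :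
    Truncated V F T →L[ℝ] Truncated V F T :=
  LinearMap.toContinuousLinearMap (((truncate V F T).comp (coneContraction (z.2 - c) z.1)).comp
    ((connForm b β (lineMap c z.2 z.1)).comp (untruncate V F T)))

theorem volterraKernel_center (β : V → ι → PtTotal V F) (c : V) (T : Finset (ℕ × ℤ)) (t : ℝ) :
    volterraKernel b β c T (t, c) = 0 := by
  ext1 w
  funext i
  change t ^ i.1.1 • curryLeftCLM V (F i.1.2) i.1.1 _ (c - c) = 0
  rw [sub_self, map_zero, smul_zero]

variable {β : V → ι → PtTotal V F} (hβ : ∀ i y, TotalSmoothAt (fun y => β y i) y) (c : V)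
  (T : Finset (ℕ × ℤ))
include hβ

theorem contDiff_volterraKernel : ContDiff ℝ ∞ (volterraKernel b β c T) := by
  refine contDiff_clm_apply_iff.2 fun w => contDiff_pi.2 fun i => ?_
  have h1 : ContDiff ℝ ∞ fun z : ℝ × V =>
      connForm b β (lineMap c z.2 z.1) (untruncate V F T w) (i.1.1 + 1) i.1.2 :=
    contDiff_iff_contDiffAt.2 fun z => totalSmoothAt_connForm b (fun j => hβ j _)
      (contDiff_lineMap_uncurry c).contDiffAt (.const _) _ _
  change ContDiff ℝ ∞ fun z : ℝ × V => z.1 ^ i.1.1 • curryLeftCLM V (F i.1.2) i.1.1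
    (connForm b β (lineMap c z.2 z.1) (untruncate V F T w) (i.1.1 + 1) i.1.2) (z.2 - c)
  have h2 : ContDiff ℝ ∞ fun z : ℝ × V => curryLeftCLM V (F i.1.2) i.1.1
    (connForm b β (lineMap c z.2 z.1) (untruncate V F T w) (i.1.1 + 1) i.1.2) := by fun_prop
  exact (contDiff_fst.pow _).smul (h2.clm_apply (contDiff_snd.sub contDiff_const))

theorem exists_contDiff_truncated_solution (w : Truncated V F T) :
    ∃ s : V → Truncated V F T, ContDiff ℝ ∞ s ∧ ∀ᶠ y in 𝓝 c,
      s y + ∫ t in (0 : ℝ)..1, volterraKernel b β c T (t, y) (s (lineMap c y t)) = w := by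
  have hcomplete : CompleteSpace (Truncated V F T) := FiniteDimensional.complete ℝ _
  exact exists_contDiff_volterra_near.{u, v} _ (contDiff_volterraKernel b hβ c T) c
    (volterraKernel_center b β c T) w

/-- The composition K A is an integral along rays with a fibrewise linear kernel. The form must have
no components outside `T`, since A could otherwise feed them into `T` unseen by the truncated
kernel. -/
theorem truncate_homotopyConn {f : V → PtTotal V F} (hf : ∀ y, TotalSmoothAt f y)
    (h : ∀ y, untruncate V F T (truncate V F T (f y)) = f y) (y : V) :
    truncate V F T (homotopyConn b β c f y) =
      ∫ t in (0 : ℝ)..1, volterraKernel b β c T (t, y) (truncate V F T (f (lineMap c y t))) := by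
  funext i
  have hl : Continuous fun t : ℝ => lineMap c y t := lineMap_continuous
  have h1 : Continuous fun t : ℝ =>
      volterraKernel b β c T (t, y) (truncate V F T (f (lineMap c y t))) := by
    have h2 : Continuous fun y => truncate V F T (f y) :=
      (contDiff_iff_contDiffAt.2 fun y => (hf y).truncate T).continuous
    exact ((contDiff_volterraKernel b hβ c T).continuous.comp
      (f := fun t : ℝ => (t, y)) (by fun_prop)).clm_apply (h2.comp hl)
  refine Eq.trans ?_ ((ContinuousLinearMap.proj (R := ℝ)
    (φ := fun i : T => V [⋀^Fin i.1.1]→L[ℝ] F i.1.2) i).intervalIntegral_comp_comm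
      (h1.intervalIntegrable 0 1))
  refine intervalIntegral.integral_congr fun t _ => ?_
  change t ^ _ • _ = t ^ _ • curryLeftCLM V (F i.1.2) i.1.1 (connForm b β (lineMap c y t)
    (untruncate V F T (truncate V F T (f (lineMap c y t)))) (i.1.1 + 1) i.1.2) (y - c)
  rw [h]

end Volterra

/-! ### Solutions of S + K A S = e and their images under d + A -/

section FlatFrame

open AffineMap

variable {V : Type u} {F : ℤ → Type v} [NormedAddCommGroup V] [NormedSpace ℝ V]
  [∀ q, NormedAddCommGroup (F q)] [∀ q, NormedSpace ℝ (F q)] {ι : Type*} [Fintype ι]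
  (b : GradedBasis F ι) {p m : ℕ} {q : ℤ} {d : ℤ}

theorem truncate_untruncate {T : Finset (ℕ × ℤ)} (w : Truncated V F T) :
    truncate V F T (untruncate V F T w) = w :=
  funext fun i => untruncate_of_mem w i.2

theorem poincareHomotopy_zero (c : V) (y : V) :
    poincareHomotopy c (fun _ => (0 : V [⋀^Fin (p + 1)]→L[ℝ] F q)) y = 0 := by
  rw [poincareHomotopy_apply]
  refine (intervalIntegral.integral_congr (g := fun _ => 0) fun t _ => ?_).trans
    intervalIntegral.integral_zero
  exact smul_zero (t ^ p)

theorem poincareHomotopy_center (c : V) (η : V → V [⋀^Fin (p + 1)]→L[ℝ] F q) :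
    poincareHomotopy c η c = 0 := by
  rw [poincareHomotopy_apply]
  refine (intervalIntegral.integral_congr (g := fun _ => 0) fun t _ => ?_).trans
    intervalIntegral.integral_zero
  change t ^ p • curryLeftCLM V (F q) p (η (lineMap c c t)) (c - c) = 0
  rw [sub_self, map_zero, smul_zero]

theorem poincareHomotopy_congr (c : V) {η θ : V → V [⋀^Fin (p + 1)]→L[ℝ] F q} {y : V}
    (h : ∀ t ∈ Set.Icc (0 : ℝ) 1, η (lineMap c y t) = θ (lineMap c y t)) :
    poincareHomotopy c η y = poincareHomotopy c θ y := by
  rw [poincareHomotopy_apply, poincareHomotopy_apply]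
  refine intervalIntegral.integral_congr fun t ht => ?_
  rw [Set.uIcc_of_le zero_le_one] at ht
  change t ^ p • curryLeftCLM V (F q) p (η (lineMap c y t)) (y - c) =
    t ^ p • curryLeftCLM V (F q) p (θ (lineMap c y t)) (y - c)
  rw [h t ht]

theorem poincareHomotopy_neg (c : V) (η : V → V [⋀^Fin (p + 1)]→L[ℝ] F q) (y : V) :
    poincareHomotopy c (fun z => -η z) y = -poincareHomotopy c η y := by
  rw [poincareHomotopy_apply, poincareHomotopy_apply, ← intervalIntegral.integral_neg]
  refine intervalIntegral.integral_congr fun t ht => ?_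
  exact smul_neg (t ^ p) ((η (lineMap c y t)).curryLeft (y - c))

theorem continuous_poincareHomotopy_integrand (c : V) {η : V → V [⋀^Fin (p + 1)]→L[ℝ] F q}
    (hη : ContDiff ℝ ∞ η) (y : V) :
    Continuous fun t : ℝ => t ^ p • (η (lineMap c y t)).curryLeft (y - c) :=
  (contDiff_coneIntegral_integrand (curryLeftCLM V (F q) p) c p hη).continuous.comp
    (f := fun t : ℝ => (t, y)) (by fun_prop)

theorem poincareHomotopy_add (c : V) {η θ : V → V [⋀^Fin (p + 1)]→L[ℝ] F q}
    (hη : ContDiff ℝ ∞ η) (hθ : ContDiff ℝ ∞ θ) (y : V) :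
    poincareHomotopy c (fun z => η z + θ z) y =
      poincareHomotopy c η y + poincareHomotopy c θ y := by
  rw [poincareHomotopy_apply, poincareHomotopy_apply, poincareHomotopy_apply,
    ← intervalIntegral.integral_add
      ((continuous_poincareHomotopy_integrand c hη y).intervalIntegrable _ _)
      ((continuous_poincareHomotopy_integrand c hθ y).intervalIntegrable _ _)]
  refine intervalIntegral.integral_congr fun t ht => ?_
  exact smul_add (t ^ p) ((η (lineMap c y t)).curryLeft (y - c))
    ((θ (lineMap c y t)).curryLeft (y - c))

theorem poincareHomotopy_smul (c : V) (r : ℝ) (η : V → V [⋀^Fin (p + 1)]→L[ℝ] F q) (y : V) :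
    poincareHomotopy c (fun z => r • η z) y = r • poincareHomotopy c η y := by
  rw [poincareHomotopy_apply, poincareHomotopy_apply, ← intervalIntegral.integral_smul]
  refine intervalIntegral.integral_congr fun t ht => ?_
  exact smul_comm (t ^ p) r ((η (lineMap c y t)).curryLeft (y - c))

variable {β : V → ι → PtTotal V F}

theorem contDiff_connForm (hβ : ∀ i y, TotalSmoothAt (fun y => β y i) y) {f : V → PtTotal V F}
    (hf : ∀ y, TotalSmoothAt f y) : ContDiff ℝ ∞ fun y => connForm b β y (f y) p q :=
  contDiff_iff_contDiffAt.2 fun y =>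
    totalSmoothAt_connForm b (g := fun y => y) (fun i => hβ i y) contDiffAt_id (hf y) p q

theorem homotopyConn_center (β : V → ι → PtTotal V F) (c : V) (f : V → PtTotal V F) :
    homotopyConn b β c f c = 0 := by
  funext p q
  exact poincareHomotopy_center c _

theorem homotopyConn_add (hβ : ∀ i y, TotalSmoothAt (fun y => β y i) y) (c : V)
    {f g : V → PtTotal V F} (hf : ∀ y, TotalSmoothAt f y) (hg : ∀ y, TotalSmoothAt g y) (y : V) :
    homotopyConn b β c (fun z => f z + g z) y =
      homotopyConn b β c f y + homotopyConn b β c g y := by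
  funext p q
  refine Eq.trans ?_
    (poincareHomotopy_add c (contDiff_connForm b hβ hf) (contDiff_connForm b hβ hg) y)
  rw [homotopyConn]
  congr 1
  funext z
  rw [map_add]
  rfl

theorem homotopyConn_smul (c : V) (r : ℝ) (f : V → PtTotal V F) (y : V) :
    homotopyConn b β c (fun z => r • f z) y = r • homotopyConn b β c f y := by
  funext p q
  refine Eq.trans ?_ (poincareHomotopy_smul c r (fun z => connForm b β z (f z) (p + 1) q) y)
  rw [homotopyConn]
  congr 1
  funext z
  rw [map_smul]
  rfl

theorem homotopyConn_sum (hβ : ∀ i y, TotalSmoothAt (fun y => β y i) y) (c : V) {κ : Type*}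
    (s : Finset κ) {f : κ → V → PtTotal V F} (hf : ∀ i y, TotalSmoothAt (f i) y) (y : V) :
    homotopyConn b β c (fun z => ∑ i ∈ s, f i z) y = ∑ i ∈ s, homotopyConn b β c (f i) y := by
  induction s using Finset.cons_induction with
  | empty => simpa using homotopyConn_smul b (β := β) c 0 (fun _ => 0) y
  | cons i s hi ih =>
    simp only [Finset.sum_cons]
    rw [homotopyConn_add b hβ c (hf i) (fun y => .sum s fun j _ => hf j y), ih]

/-- A raises the total degree by one and K lowers it by one, so the integral equation respects the
grading. -/
theorem ptHomogeneous_homotopyConn (hβ : ∀ i y, PtHomogeneous (b.deg i + 1) (β y i)) (c : V)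
    {f : V → PtTotal V F} (hf : ∀ y, PtHomogeneous d (f y)) (y : V) :
    PtHomogeneous d (homotopyConn b β c f y) := by
  intro p q h
  refine Eq.trans ?_ (poincareHomotopy_zero c y)
  rw [homotopyConn]
  congr 1
  funext z
  exact ptHomogeneous_connForm b (fun i => hβ i z) (hf z) _ _ (by push_cast; omega)

/-- The value at `c` of the component of degree zero of the connection form. -/
def fiberDifferential (β : V → ι → PtTotal V F) (c : V) (x : ∀ q, F q) : ∀ q, F q :=
  fun q => connForm b β c (ptConst V x) 0 q ![]

/-- Multiplication by forms never lowers the form degree, so in degree zero A sees only the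
functions among the components. -/
theorem connForm_zero_apply (a : PtTotal V F) (c : V) :
    connForm b β c a 0 q ![] = fiberDifferential b β c (fun q => a 0 q ![]) q := by
  have h : connForm b β c a 0 q = connForm b β c (ptConst V fun q => a 0 q ![]) 0 q := by
    rw [connForm_apply, connForm_apply, b.extend_apply _ _ zero_lt_one,
      b.extend_apply _ _ zero_lt_one, Finset.sum_range_one, Finset.sum_range_one]
    refine Finset.sum_congr rfl fun i _ => ?_
    have h1 : b.coord i (ptParity V F a) 0 =
        b.coord i (ptParity V F (ptConst V fun q => a 0 q ![])) 0 := by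
      ext v
      rw [Subsingleton.elim v ![]]
      rfl
    rw [h1]
  rw [h]
  rfl

/-- The differential on the fibre at `c`. -/
def gradedFiberDifferential [∀ q, FiniteDimensional ℝ (F q)] (β : V → ι → PtTotal V F)
    (c : V) (hβd : ∀ i y, PtHomogeneous (b.deg i + 1) (β y i))
    (hflat : ∀ f, (∀ y, TotalSmoothAt f y) → connOp b β (connOp b β f) c = 0) :
    GradedDifferential F := by
  have hadd (x x' : ∀ q, F q) : fiberDifferential b β c (x + x') =
      fiberDifferential b β c x + fiberDifferential b β c x' := by
    funext q
    rw [fiberDifferential, map_add, map_add]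
    rfl
  have hsmul (r : ℝ) (x : ∀ q, F q) : fiberDifferential b β c (r • x) =
      r • fiberDifferential b β c x := by
    funext q
    rw [fiberDifferential, map_smul, map_smul]
    rfl
  have hshape (i j : ℤ) (h : i + 1 ≠ j) (x : F i) :
      fiberDifferential b β c (Pi.single i x) j = 0 := by
    have h1 : PtHomogeneous i (ptConst V (Pi.single i x)) := by
      intro p q hp
      cases p with
      | zero =>
        ext v
        refine Pi.single_eq_of_ne ?_ _
        rintro rfl
        simp at hp
      | succ p => rfl
    have h2 := ptHomogeneous_connForm b (fun i => hβd i c) h1 0 j (by push_cast; omega)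
    rw [fiberDifferential, h2]
    rfl
  -- Flatness at `c` is tested on a constant section: its image under d + A is just the product with
  -- A. In form degree zero a second application has no contribution from d, and what remains is the
  -- square of the fibre differential.
  have hsq (x : ∀ q, F q) : fiberDifferential b β c (fiberDifferential b β c x) = 0 := by
    funext q
    have h1 := congrFun (congrFun (hflat (fun _ => ptConst V x) fun y => .const _) 0) q
    have h2 : connOp b β (fun _ => ptConst V x) = fun y => connForm b β y (ptConst V x) := by
      funext y
      rw [connOp_eq, dTotal_const, zero_add]
    rw [h2, connOp_eq, Pi.add_apply, Pi.add_apply, dTotal_zero, zero_add] at h1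
    have h3 := connForm_zero_apply b (β := β) (q := q) (connForm b β c (ptConst V x)) c
    rw [h1] at h3
    exact h3.symm
  -- The image of a vector of degree `i` sits in degree `i + 1` alone, so the composite of two
  -- components is a component of the square of the full differential.
  have hsingle (i j : ℤ) (h : i + 1 = j) (x : F i) :
      fiberDifferential b β c (Pi.single i x) =
        Pi.single j (fiberDifferential b β c (Pi.single i x) j) := by
    funext k
    by_cases hk : k = j
    · subst hk
      rw [Pi.single_eq_same]
    · rw [Pi.single_eq_of_ne hk, hshape i k (by omega)]
  exact
  { d := fun i j => LinearMap.toContinuousLinearMap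
      { toFun := fun x => fiberDifferential b β c (Pi.single i x) j
        map_add' := fun x x' => by rw [Pi.single_add, hadd]; rfl
        map_smul' := fun r x => by rw [Pi.single_smul, hsmul]; rfl }
    shape := fun i j h => by
      ext x
      exact hshape i j h x
    d_comp_d := fun i j k => by
      ext x
      change fiberDifferential b β c (Pi.single j (fiberDifferential b β c (Pi.single i x) j)) k = 0
      by_cases h : i + 1 = j
      · rw [← hsingle i j h, hsq]
        rfl
      · rw [hshape i j h, Pi.single_zero]
        have h0 := congrFun (hsmul 0 0) k
        rw [zero_smul, zero_smul] at h0
        exact h0 }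

/-- The heart of the argument. With D = d + A, flatness gives d(AS) = -A(DS), so DS + K A DS = dS +
AS - K d(AS). The homotopy formula turns this into d(S + K A S), which vanishes, plus the value of
(AS)₀ at `c`. -/
theorem connOp_add_homotopyConn [∀ q, CompleteSpace (F q)]
    (hβ : ∀ i y, TotalSmoothAt (fun y => β y i) y) (c : V)
    {S : V → PtTotal V F} (hS : ∀ y, TotalSmoothAt S y) {x : ∀ q, F q}
    (hSx : ∀ᶠ y in 𝓝 c, S y + homotopyConn b β c S y = ptConst V x)
    (hflat : ∀ᶠ y in 𝓝 c, connOp b β (connOp b β S) y = 0) :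
    ∀ᶠ y in 𝓝 c, connOp b β S y + homotopyConn b β c (connOp b β S) y =
      ptConst V (fiberDifferential b β c x) := by
  obtain ⟨r, hr, hball⟩ := Metric.eventually_nhds_iff_ball.1 (hSx.and hflat)
  have hc : S c = ptConst V x := by
    have := (hball c (Metric.mem_ball_self hr)).1
    rwa [homotopyConn_center, add_zero] at this
  filter_upwards [Metric.ball_mem_nhds c hr] with y hy
  have hA (p q) : ContDiff ℝ ∞ fun y => connForm b β y (S y) p q := contDiff_connForm b hβ hS
  -- Expansion of D²S = 0 with d² = 0. The equation holds only on the ball about `c`, which is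
  -- enough because rays from `c` to points of the ball stay inside.
  have hAd (z : V) (hz : z ∈ Metric.ball c r) (p : ℕ) (q : ℤ) :
      extDeriv (fun y => connForm b β y (S y) p q) z =
        -connForm b β z (connOp b β S z) (p + 1) q := by
    have h1 := (hball z hz).2
    have hs1 : TotalSmoothAt (fun y => connForm b β y (S y)) z := fun p q => (hA p q).contDiffAt
    have h2 : connOp b β S = fun y => dTotal S y + connForm b β y (S y) := rfl
    rw [connOp_eq] at h1
    nth_rw 1 [h2] at h1
    rw [dTotal_add (hS z).dTotal hs1, dTotal_dTotal (hS z), zero_add] at h1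
    exact eq_neg_of_add_eq_zero_left (congrFun (congrFun h1 (p + 1)) q)
  have hK (p : ℕ) (q : ℤ) : poincareHomotopy c (extDeriv fun y => connForm b β y (S y) p q) y =
      -homotopyConn b β c (connOp b β S) y p q := by
    rw [homotopyConn, ← poincareHomotopy_neg]
    refine poincareHomotopy_congr c fun t ht => hAd _ ?_ p q
    exact (convex_ball c r).lineMap_mem (Metric.mem_ball_self hr) hy ht
  funext p q
  rw [Pi.add_apply, Pi.add_apply, connOp_eq, Pi.add_apply, Pi.add_apply]
  cases p with
  | zero =>
    -- In form degree zero dS contributes nothing, and K d(AS) is AS minus its value at the centre.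
    have h1 := hK 0 q
    rw [poincareHomotopy_extDeriv_zero_form c (hA 0 q)] at h1
    have h2 : connForm b β c (S c) 0 q = ptConst V (fiberDifferential b β c x) 0 q := by
      rw [hc]
      ext v
      rw [Subsingleton.elim v ![]]
      rfl
    rw [dTotal_zero, zero_add, ← h2, sub_eq_iff_eq_add.1 h1]
    abel
  | succ p =>
    rw [dTotal_succ]
    -- In positive degree, dS is replaced by -d(K A S), since S equals a constant minus K A S near
    -- `y`; then dK + Kd = 1 cancels AS.
    have h1 : (fun z => S z p q) =ᶠ[𝓝 y] fun z => ptConst V x p q +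
        (-1 : ℝ) • poincareHomotopy c (fun z => connForm b β z (S z) (p + 1) q) z := by
      filter_upwards [Metric.isOpen_ball.mem_nhds hy] with z hz
      rw [← (hball z hz).1]
      simp [homotopyConn]
    have h2 := extDeriv_poincareHomotopy_add c (hA (p + 1) q) y
    rw [hK] at h2
    have h3 := (contDiff_poincareHomotopy c (hA (p + 1) q)).differentiable (by simp) y
    have h4 : extDeriv (fun _ : V => ptConst V x p q) y = 0 :=
      congrFun (congrFun (dTotal_const (ptConst V x) y) (p + 1)) q
    have h5 : extDeriv (fun z => (-1 : ℝ) •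
        poincareHomotopy c (fun z => connForm b β z (S z) (p + 1) q) z) y =
          (-1 : ℝ) • extDeriv (poincareHomotopy c fun z => connForm b β z (S z) (p + 1) q) y :=
      extDeriv_smul _ _
    have h6 : DifferentiableAt ℝ (fun z => (-1 : ℝ) •
        poincareHomotopy c (fun z => connForm b β z (S z) (p + 1) q) z) y := h3.const_smul (-1 : ℝ)
    have h7 := extDeriv_fun_add (differentiableAt_const (ptConst V x p q)) h6
    rw [h1.extDeriv_eq, h7, h4, h5, ← h2, ptConst_succ, neg_one_smul]
    abel

variable [FiniteDimensional ℝ V] [∀ q, FiniteDimensional ℝ (F q)]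

theorem exists_homotopyConn_solution {T : Finset (ℕ × ℤ)} (hT : IsFullIndexSet V F T)
    (hβ : ∀ i y, TotalSmoothAt (fun y => β y i) y)
    (hβd : ∀ i y, PtHomogeneous (b.deg i + 1) (β y i)) (c : V) {a : PtTotal V F}
    (ha : PtHomogeneous d a) :
    ∃ S : V → PtTotal V F, (∀ y, TotalSmoothAt S y) ∧ (∀ y, PtHomogeneous d (S y)) ∧
      ∀ᶠ y in 𝓝 c, S y + homotopyConn b β c S y = a := by
  -- Restricting to the components of total degree `d` yields a homogeneous solution at once.
  let T' := T.filter fun i => (i.1 : ℤ) + i.2 = d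
  obtain ⟨s, hs, hsw⟩ := exists_contDiff_truncated_solution b hβ c T' (truncate V F T' a)
  have hS1 (y : V) : TotalSmoothAt (fun y => untruncate V F T' (s y)) y :=
    totalSmoothAt_untruncate hs.contDiffAt
  have hS2 (y : V) : PtHomogeneous d (untruncate V F T' (s y)) := fun p q h =>
    untruncate_of_notMem _ (by simp [T', h])
  refine ⟨_, hS1, hS2, ?_⟩
  filter_upwards [hsw] with y hy
  have h1 := truncate_homotopyConn b hβ c T' hS1 (fun y => by rw [truncate_untruncate]) y
  simp only [truncate_untruncate] at h1
  rw [← h1] at hy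
  funext p q
  by_cases hpq : (p, q) ∈ T'
  · have h2 := congrFun hy ⟨(p, q), hpq⟩
    rw [Pi.add_apply, Pi.add_apply, untruncate_of_mem _ hpq]
    exact h2
  -- Outside `T'` the equation is trivial: either there are no nonzero forms with these indices, or
  -- all three terms vanish for reasons of degree.
  · by_cases hd : (p : ℤ) + q = d
    · have := hT p q fun h => hpq (by simp [T', h, hd])
      exact Subsingleton.elim _ _
    · rw [Pi.add_apply, Pi.add_apply, hS2 y p q hd, ha p q hd,
        ptHomogeneous_homotopyConn b hβd c hS2 y p q hd, add_zero]

theorem eventually_eq_zero_of_add_homotopyConn {T : Finset (ℕ × ℤ)} (hT : IsFullIndexSet V F T)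
    (hβ : ∀ i y, TotalSmoothAt (fun y => β y i) y) (c : V) {R : V → PtTotal V F}
    (hR : ∀ y, TotalSmoothAt R y) (h : ∀ᶠ y in 𝓝 c, R y + homotopyConn b β c R y = 0) :
    ∀ᶠ y in 𝓝 c, R y = 0 := by
  have h1 : Continuous fun y => truncate V F T (R y) :=
    (contDiff_iff_contDiffAt.2 fun y => (hR y).truncate T).continuous
  have h2 := eventually_eq_zero_of_volterra (contDiff_volterraKernel b hβ c T).continuous c
    (volterraKernel_center b β c T) h1 (h.mono fun y hy => by
      rw [← truncate_homotopyConn b hβ c T hR (fun y => hT.untruncate_truncate _), ← map_add, hy,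
        map_zero])
  filter_upwards [h2] with y hy
  rw [← hT.untruncate_truncate (R y), hy, map_zero]

/-- The image of `S i` under d + A and the combination of the `S j` with the coefficients of δ eᵢ
solve the same linear Volterra equation, so they agree near `c`. -/
theorem connOp_eq_extend {T : Finset (ℕ × ℤ)} (hT : IsFullIndexSet V F T)
    (hβ : ∀ i y, TotalSmoothAt (fun y => β y i) y) (c : V) {S : ι → V → PtTotal V F}
    (hS : ∀ i y, TotalSmoothAt (S i) y)
    (hSc : ∀ i, ∀ᶠ y in 𝓝 c, S i y + homotopyConn b β c (S i) y = b.const V i)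
    (hflat : ∀ i, ∀ᶠ y in 𝓝 c, connOp b β (connOp b β (S i)) y = 0) (i : ι) :
    ∀ᶠ y in 𝓝 c, connOp b β (S i) y = b.extend (fun j => S j y)
      (ptConst V (fiberDifferential b β c (Pi.single (b.deg i) (b.e i)))) := by
  obtain ⟨x, hx⟩ : ∃ x, x = fiberDifferential b β c (Pi.single (b.deg i) (b.e i)) := ⟨_, rfl⟩
  rw [← hx]
  have hcomplete (q : ℤ) : CompleteSpace (F q) := FiniteDimensional.complete ℝ _
  have h1 := connOp_add_homotopyConn b hβ c (hS i) (hSc i) (hflat i)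
  rw [← hx] at h1
  -- The difference of the two candidates, which satisfies the homogeneous equation.
  let R : V → PtTotal V F := fun y =>
    connOp b β (S i) y + ∑ j, (-b.ε j (x (b.deg j))) • S j y
  have hC (y : V) : TotalSmoothAt (connOp b β (S i)) y :=
    (hS i y).connOp b fun j => hβ j y
  have hsum (y : V) : TotalSmoothAt (fun y => ∑ j, (-b.ε j (x (b.deg j))) • S j y) y :=
    .sum _ fun j _ => (hS j y).smul _
  have hR0 := eventually_eq_zero_of_add_homotopyConn b hT hβ c (R := R)
    (fun y => (hC y).add (hsum y)) (by
      filter_upwards [h1, Filter.eventually_all.2 hSc] with y hy1 hy2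
      change connOp b β (S i) y + _ + homotopyConn b β c (fun y => _ + _) y = 0
      rw [homotopyConn_add b hβ c hC hsum,
        homotopyConn_sum b hβ c _ fun j y => (hS j y).smul _, add_add_add_comm, hy1,
        ← Finset.sum_add_distrib]
      simp only [homotopyConn_smul, ← smul_add, hy2]
      rw [← b.extend_const (ptConst V x), b.extend_ptConst, ← Finset.sum_add_distrib]
      simp)
  filter_upwards [hR0] with y hy
  rw [b.extend_ptConst, ← sub_eq_zero, sub_eq_add_neg, ← Finset.sum_neg_distrib]
  simpa only [R, neg_smul] using hy

end FlatFrame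

/-! ### Invertibility of the frame and conjugation to d + δ -/

section FrameInverse

variable {V : Type u} {F : ℤ → Type v} [NormedAddCommGroup V] [NormedSpace ℝ V]
  [∀ q, NormedAddCommGroup (F q)] [∀ q, NormedSpace ℝ (F q)] {ι : Type*} [Fintype ι]
  (b : GradedBasis F ι) {p m : ℕ} {q : ℤ} {d : ℤ}

theorem GradedBasis.extend_apply_eq_zero {u : ι → PtTotal V F}
    (hu : ∀ i, PtHomogeneous (b.deg i) (u i)) {a : PtTotal V F}
    (ha : ∀ (p : ℕ) (r : ℤ), (p : ℤ) + r = m + q → a p r = 0) : b.extend u a m q = 0 := by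
  rw [b.extend_apply u a (Nat.lt_succ_self m)]
  refine Finset.sum_eq_zero fun p _ => Finset.sum_eq_zero fun i _ => ?_
  by_cases h1 : (p : ℤ) + b.deg i = m + q
  · rw [b.coord_eq_zero (ha _ _ h1), ptWedge_zero_left]
    rfl
  · exact (hu i).ptWedge _ m q (Ne.symm h1)

/-- If a map of degree zero is injective, it reflects homogeneity. -/
theorem GradedBasis.homogeneous_of_extend {u : ι → PtTotal V F}
    (hu : ∀ i, PtHomogeneous (b.deg i) (u i)) (hinj : ∀ a, b.extend u a = 0 → a = 0)
    {a : PtTotal V F} (ha : PtHomogeneous d (b.extend u a)) : PtHomogeneous d a := by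
  -- The part of `a` of total degree `d`. It has the same image as `a`, because the map preserves
  -- total degree and the image of `a` is homogeneous of degree `d`.
  let a₁ : PtTotal V F := fun p q => if (p : ℤ) + q = d then a p q else 0
  have h1 : PtHomogeneous d a₁ := fun p q h => if_neg h
  have h2 : PtHomogeneous (d + 0) (b.extend u a₁) :=
    b.extend_homogeneous (fun i => by rw [add_zero]; exact hu i) h1
  have h3 : a - a₁ = 0 := by
    refine hinj _ ?_
    funext m q
    by_cases h : (m : ℤ) + q = d
    · refine b.extend_apply_eq_zero hu fun p r hp => ?_
      rw [Pi.sub_apply, Pi.sub_apply, sub_eq_zero]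
      exact (if_pos (hp.trans h)).symm
    · rw [map_sub, Pi.sub_apply, Pi.sub_apply, ha m q h, h2 m q (by omega), sub_zero]
      rfl
  rw [sub_eq_zero.1 h3]
  exact h1

/-- The operator `δ` on forms with constant coefficients. -/
def constForm (δ : GradedDifferential F) (_ : V) (i : ι) : PtTotal V F :=
  ptConst V fun q => δ.d (b.deg i) q (b.e i)

theorem constForm_homogeneous (δ : GradedDifferential F) (y : V) (i : ι) :
    PtHomogeneous (b.deg i + 1) (constForm b δ y i) := by
  intro p q h
  cases p with
  | zero =>
    ext v
    change δ.d (b.deg i) q (b.e i) = 0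
    rw [δ.shape _ _ (by simp at h; omega)]
    rfl
  | succ p => rfl

/-- The sign built into `connForm` is the sign (-1)ᵖ in `constantSuperconnection`, and by the shape
of δ only the basis vectors of degree `q - 1` contribute. -/
theorem connForm_constForm (δ : GradedDifferential F) (y : V) (a : PtTotal V F) :
    connForm b (constForm b δ) y a m q =
      (-1 : ℝ) ^ m • (δ.d (q - 1) q).compContinuousAlternatingMap (a m (q - 1)) := by
  rw [connForm_apply, b.extend_apply _ _ (Nat.lt_succ_self m), Finset.sum_range_succ,
    Finset.sum_eq_zero, zero_add]
  · ext v
    rw [ContinuousAlternatingMap.sum_apply]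
    simp only [constForm, ptWedge_ptConst]
    have h1 := b.sum_eq (fun q => ptParity V F a m q v) (q - 1)
    have h2 := congrArg (δ.d (q - 1) q) h1
    rw [map_sum] at h2
    refine Eq.trans (Finset.sum_congr rfl fun i _ => ?_) (h2.trans (map_smul (δ.d (q - 1) q) _ _))
    rw [map_smul]
    refine congrArg (fun x : F q => b.ε i (ptParity V F a m (b.deg i) v) • x) ?_
    by_cases h : b.deg i = q - 1
    · rw [← h, Pi.single_eq_same]
    · rw [Pi.single_eq_of_ne (Ne.symm h), map_zero, δ.shape _ _ (by omega)]
      rfl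
  · intro p hp
    refine Finset.sum_eq_zero fun i _ => ptWedge_ptConst_of_ne ?_ _ _
    simp at hp
    omega

theorem connOp_constForm_zero (δ : GradedDifferential F) (f : V → PtTotal V F) (y : V) :
    connOp b (constForm b δ) f y 0 q =
      (δ.d (q - 1) q).compContinuousAlternatingMap (f y 0 (q - 1)) := by
  rw [connOp_eq, Pi.add_apply, Pi.add_apply, dTotal_zero, zero_add, connForm_constForm, pow_zero,
    one_smul]

theorem connOp_constForm_succ (δ : GradedDifferential F) (f : V → PtTotal V F) (y : V) :
    connOp b (constForm b δ) f y (p + 1) q = extDeriv (fun z => f z p q) y +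
      (-1 : ℝ) ^ (p + 1) • (δ.d (q - 1) q).compContinuousAlternatingMap (f y (p + 1) (q - 1)) := by
  rw [connOp_eq, Pi.add_apply, Pi.add_apply, dTotal_succ, connForm_constForm]

theorem dTotal_parity (f : V → PtTotal V F) (y : V) :
    dTotal (fun z => ptParity V F (f z)) y = -ptParity V F (dTotal f y) := by
  funext p q
  rw [Pi.neg_apply, Pi.neg_apply, ptParity_apply]
  cases p with
  | zero => exact (neg_eq_zero.2 (smul_zero _)).symm
  | succ p =>
    refine (extDeriv_smul ((-1 : ℝ) ^ p) fun z => f z p q).trans ?_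
    rw [dTotal_succ, pow_succ, mul_neg_one, neg_smul, neg_neg]

theorem connForm_constForm_connForm (δ : GradedDifferential F) (y : V) (a : PtTotal V F) :
    connForm b (constForm b δ) y (connForm b (constForm b δ) y a) = 0 := by
  funext m q
  rw [connForm_constForm, connForm_constForm]
  ext v
  change (-1 : ℝ) ^ m • δ.d (q - 1) q
    ((-1 : ℝ) ^ m • δ.d (q - 1 - 1) (q - 1) (a m (q - 1 - 1) v)) = 0
  have h1 : δ.d (q - 1) q (δ.d (q - 1 - 1) (q - 1) (a m (q - 1 - 1) v)) = 0 :=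
    congrArg (fun g => g (a m (q - 1 - 1) v)) (δ.d_comp_d (q - 1 - 1) (q - 1) q)
  rw [map_smul, h1, smul_zero, smul_zero]

variable [FiniteDimensional ℝ V]

/-- The squares of d and of δ vanish, and the mixed terms cancel since d anticommutes with the sign
operator `ptParity`. -/
theorem connOp_constForm_connOp (δ : GradedDifferential F) {f : V → PtTotal V F} {y : V}
    (hf : TotalSmoothAt f y) : connOp b (constForm b δ) (connOp b (constForm b δ) f) y = 0 := by
  have h1 : connOp b (constForm b δ) f = fun z => dTotal f z +
      b.extend (constForm b δ z) (ptParity V F (f z)) := rfl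
  have h2 : TotalSmoothAt (fun z => b.extend (constForm b δ z) (ptParity V F (f z))) y :=
    .extend b (fun i => .const _) hf.parity
  have h3 : b.extend (fun i => dTotal (fun z => constForm b δ z i) y)
      (ptParity V F (ptParity V F (f y))) = 0 := by
    have h4 (i : ι) : dTotal (fun z => constForm b δ z i) y = 0 := dTotal_const _ y
    funext m q
    rw [b.extend_apply _ _ (Nat.lt_succ_self m)]
    simp only [h4, ptWedge_zero]
    simp
  have h6 := dTotal_extend b (s := constForm b δ) (y := y) (fun i => .const _) hf.parity
  rw [connOp_eq, h1, dTotal_add hf.dTotal h2, dTotal_dTotal hf, zero_add, h6, h3, add_zero,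
    dTotal_parity, map_neg, map_add]
  have h5 := connForm_constForm_connForm b δ y (f y)
  rw [connForm_apply b _ y (f y)] at h5
  rw [h5, add_zero, connForm_apply]
  exact neg_add_cancel _

/-- If D acts on the frame by the constant matrix δ, the change of frame formula says that a ↦ ∑ aᵢ
∧ sᵢ intertwines d + δ with D. -/
theorem connOp_extend_frame {β : V → ι → PtTotal V F} {s : V → ι → PtTotal V F}
    {δ : GradedDifferential F} {y : V} (hs : ∀ i, TotalSmoothAt (fun z => s z i) y)
    (hsδ : ∀ i, connOp b β (fun y => s y i) y =
      b.extend (s y) (ptConst V fun q => δ.d (b.deg i) q (b.e i)))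
    {a : V → PtTotal V F} (ha : TotalSmoothAt a y) :
    connOp b β (fun z => b.extend (s z) (a z)) y =
      b.extend (s y) (connOp b (constForm b δ) a y) := by
  rw [connOp_extend b β hs ha]
  simp only [hsδ]
  rw [b.extend_extend, connOp, map_add]
  rfl

variable [∀ q, FiniteDimensional ℝ (F q)]

/-- The extension of a family on truncated forms. -/
def truncatedExtend (T : Finset (ℕ × ℤ)) (u : ι → PtTotal V F) :
    Truncated V F T →L[ℝ] Truncated V F T :=
  LinearMap.toContinuousLinearMap
    ((truncate V F T).comp ((b.extend u).comp (untruncate V F T)))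

theorem contDiff_truncatedExtend (T : Finset (ℕ × ℤ)) {u : V → ι → PtTotal V F}
    (hu : ∀ i y, TotalSmoothAt (fun y => u y i) y) :
    ContDiff ℝ ∞ fun y => truncatedExtend b T (u y) := by
  refine contDiff_clm_apply_iff.2 fun w => contDiff_iff_contDiffAt.2 fun y => ?_
  have h1 := TotalSmoothAt.extend b (fun i => hu i y)
    (TotalSmoothAt.const (z := y) (untruncate V F T w))
  exact h1.truncate T

/-- Invertible operators form an open set on which inversion is smooth. -/
theorem eventually_exists_inverse {W Z : Type*} [NormedAddCommGroup W] [NormedSpace ℝ W]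
    [CompleteSpace W] [NormedAddCommGroup Z] [NormedSpace ℝ Z] {A : Z → W →L[ℝ] W}
    (hA : ContDiff ℝ ∞ A) (c : Z) (hc : A c = ContinuousLinearMap.id ℝ W) :
    ∀ᶠ y in 𝓝 c, ContDiffAt ℝ ∞ (fun y => ContinuousLinearMap.inverse (A y)) y ∧
      ∃ e : W ≃L[ℝ] W, A y = e := by
  have h1 := (ContinuousLinearEquiv.refl ℝ W).nhds
  have h2 : ContinuousAt A c := hA.continuous.continuousAt
  have h3 : A c = ((ContinuousLinearEquiv.refl ℝ W : W ≃L[ℝ] W) : W →L[ℝ] W) := hc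
  rw [ContinuousAt, h3] at h2
  filter_upwards [h2 h1] with y hy
  obtain ⟨e, he⟩ := hy
  refine ⟨?_, e, he.symm⟩
  have h4 := contDiffAt_map_inverse (𝕜 := ℝ) (n := ∞) e
  rw [he] at h4
  exact h4.comp y hA.contDiffAt

theorem exists_inverse_frame {T : Finset (ℕ × ℤ)} (hT : IsFullIndexSet V F T)
    {s : V → ι → PtTotal V F} (hs : ∀ i y, TotalSmoothAt (fun y => s y i) y)
    (hsd : ∀ i y, PtHomogeneous (b.deg i) (s y i)) (c : V) (hc : ∀ i, s c i = b.const V i) :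
    ∃ u : V → ι → PtTotal V F, ∀ᶠ y in 𝓝 c, (∀ i, TotalSmoothAt (fun y => u y i) y) ∧
      (∀ i, PtHomogeneous (b.deg i) (u y i)) ∧ (∀ a, b.extend (s y) (b.extend (u y) a) = a) ∧
      ∀ a, b.extend (u y) (b.extend (s y) a) = a := by
  have hcomplete : CompleteSpace (Truncated V F T) := FiniteDimensional.complete ℝ _
  have hA : truncatedExtend b T (s c) = ContinuousLinearMap.id ℝ _ := by
    have h1 : s c = b.const V := funext hc
    ext1 w
    change truncate V F T (b.extend (s c) (untruncate V F T w)) = w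
    rw [h1, b.extend_const, truncate_untruncate]
  -- The inverse frame consists of the preimages of the constant basis vectors. Linearity over the
  -- exterior algebra then makes its extension a right inverse on all forms.
  refine ⟨fun y i => untruncate V F T (ContinuousLinearMap.inverse (truncatedExtend b T (s y))
    (truncate V F T (b.const V i))), ?_⟩
  filter_upwards [eventually_exists_inverse (contDiff_truncatedExtend b T hs) c hA] with y hy
  obtain ⟨hsm, e, he⟩ := hy
  have hext (w : Truncated V F T) : b.extend (s y) (untruncate V F T w) =
      untruncate V F T (e w) := by
    have h1 : truncatedExtend b T (s y) w = e w := by rw [he]; rfl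
    rw [← h1, ← hT.untruncate_truncate (b.extend _ _)]
    rfl
  have hinj (a : PtTotal V F) (ha : b.extend (s y) a = 0) : a = 0 := by
    rw [← hT.untruncate_truncate a, hext] at ha
    have h1 := congrArg (truncate V F T) ha
    rw [truncate_untruncate, map_zero] at h1
    rw [← hT.untruncate_truncate a, (map_eq_zero_iff e e.injective).1 h1, map_zero]
  have hsu (i : ι) : b.extend (s y) (untruncate V F T
      (ContinuousLinearMap.inverse (truncatedExtend b T (s y)) (truncate V F T (b.const V i)))) =
        b.const V i := by
    rw [hext, he, ContinuousLinearMap.inverse_equiv]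
    change untruncate V F T (e (e.symm _)) = _
    rw [e.apply_symm_apply, hT.untruncate_truncate]
  have hright (a : PtTotal V F) : b.extend (s y) (b.extend (fun i => untruncate V F T
      (ContinuousLinearMap.inverse (truncatedExtend b T (s y)) (truncate V F T (b.const V i)))) a) =
        a := by
    rw [← b.extend_extend]
    simp only [hsu]
    exact b.extend_const a
  refine ⟨fun i => totalSmoothAt_untruncate (hsm.clm_apply contDiffAt_const), fun i => ?_, hright,
    fun a => ?_⟩
  -- The frame map has degree zero and is injective, and it sends `u i` to a basis vector; hence `u
  -- i` has the degree of that vector.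
  · refine b.homogeneous_of_extend (fun i => hsd i y) hinj ?_
    rw [hsu]
    exact b.homogeneous_const i
  · rw [← sub_eq_zero]
    refine hinj _ ?_
    rw [map_sub, hright, sub_self]

/-- Everything on the model space combined. The family β and the test functions are globally smooth,
while flatness is assumed only on a neighbourhood `Ω` of `c`; this is the situation produced by
cutoffs. -/
theorem exists_flat_frame {T : Finset (ℕ × ℤ)} (hT : IsFullIndexSet V F T)
    {β : V → ι → PtTotal V F} (hβ : ∀ i y, TotalSmoothAt (fun y => β y i) y)
    (hβd : ∀ i y, PtHomogeneous (b.deg i + 1) (β y i)) (c : V) {Ω : Set V} (hΩ : Ω ∈ 𝓝 c)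
    (hflat : ∀ f, (∀ y, TotalSmoothAt f y) → ∀ y ∈ Ω, connOp b β (connOp b β f) y = 0) :
    ∃ (δ : GradedDifferential F) (s u : V → ι → PtTotal V F),
      (∀ i y, TotalSmoothAt (fun y => s y i) y) ∧ (∀ i y, PtHomogeneous (b.deg i) (s y i)) ∧
      ∀ᶠ y in 𝓝 c, (∀ i, TotalSmoothAt (fun y => u y i) y) ∧
        (∀ i, PtHomogeneous (b.deg i) (u y i)) ∧ (∀ a, b.extend (s y) (b.extend (u y) a) = a) ∧
        (∀ a, b.extend (u y) (b.extend (s y) a) = a) ∧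
        ∀ i, connOp b β (fun y => s y i) y =
          b.extend (s y) (ptConst V fun q => δ.d (b.deg i) q (b.e i)) := by
  choose S hS hSd hSc using fun i =>
    exists_homotopyConn_solution b hT hβ hβd c (b.homogeneous_const (V := V) i)
  -- The homotopy operator vanishes at the centre, so the frame starts as the constant basis and is
  -- invertible nearby.
  have hc (i : ι) : S i c = b.const V i := by
    have := (hSc i).self_of_nhds
    rwa [homotopyConn_center, add_zero] at this
  obtain ⟨u, hu⟩ := exists_inverse_frame b hT (s := fun y i => S i y) hS hSd c hc
  refine ⟨gradedFiberDifferential b β c hβd fun f hf => hflat f hf c (mem_of_mem_nhds hΩ),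
    fun y i => S i y, u, hS, hSd, ?_⟩
  have h1 := connOp_eq_extend b hT hβ c hS hSc fun i =>
    Filter.mem_of_superset hΩ fun y hy => hflat (S i) (hS i) y hy
  filter_upwards [hu, Filter.eventually_all.2 h1] with y hy1 hy2
  exact ⟨hy1.1, hy1.2.1, hy1.2.2.1, hy1.2.2.2, hy2⟩

end FrameInverse

/-! ### Smoothness of the bundle of alternating forms with values in a bundle -/

section AlternatingBundle

/-- An alternating map is recovered linearly from its values on tuples of basis vectors, and linear
maps between finite-dimensional spaces are smooth. -/
theorem contDiff_continuousAlternatingMap_of_apply {Z V N : Type*} [NormedAddCommGroup Z]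
    [NormedSpace ℝ Z] [NormedAddCommGroup V] [NormedSpace ℝ V] [FiniteDimensional ℝ V]
    [NormedAddCommGroup N] [NormedSpace ℝ N] [FiniteDimensional ℝ N] {p : ℕ}
    {f : Z → V [⋀^Fin p]→L[ℝ] N} (h : ∀ v, ContDiff ℝ ∞ fun z => f z v) : ContDiff ℝ ∞ f := by
  let e := Module.finBasis ℝ V
  let L : (V [⋀^Fin p]→L[ℝ] N) →ₗ[ℝ] (Fin p → Fin (Module.finrank ℝ V)) → N :=
    { toFun := fun a j => a fun i => e (j i)
      map_add' := fun _ _ => rfl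
      map_smul' := fun _ _ => rfl }
  have hL : Function.Injective L := by
    intro a a' haa'
    have h1 : a.toMultilinearMap = a'.toMultilinearMap :=
      Module.Basis.ext_multilinear (fun _ => e) fun j => congrFun haa' j
    exact ContinuousAlternatingMap.ext fun v => congrArg (fun g => g v) h1
  obtain ⟨R, hR⟩ := L.exists_leftInverse_of_injective (LinearMap.ker_eq_bot.2 hL)
  have h1 : ContDiff ℝ ∞ fun z => LinearMap.toContinuousLinearMap R (L (f z)) :=
    (LinearMap.toContinuousLinearMap R).contDiff.comp (contDiff_pi.2 fun j => h _)
  have h2 : f = fun z => LinearMap.toContinuousLinearMap R (L (f z)) :=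
    funext fun z => (congrArg (fun g => g (f z)) hR).symm
  rw [h2]
  exact h1

theorem contDiff_compContinuousLinearMapCLM {V V' N : Type*} [NormedAddCommGroup V]
    [NormedSpace ℝ V] [FiniteDimensional ℝ V] [NormedAddCommGroup V'] [NormedSpace ℝ V']
    [FiniteDimensional ℝ V'] [NormedAddCommGroup N] [NormedSpace ℝ N] [FiniteDimensional ℝ N]
    {p : ℕ} : ContDiff ℝ ∞ fun f : V' →L[ℝ] V =>
      (ContinuousAlternatingMap.compContinuousLinearMapCLM f :
        (V [⋀^Fin p]→L[ℝ] N) →L[ℝ] V' [⋀^Fin p]→L[ℝ] N) := by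
  refine contDiff_clm_apply_iff.2 fun a => contDiff_continuousAlternatingMap_of_apply fun v => ?_
  change ContDiff ℝ ∞ fun f : V' →L[ℝ] V => a.toContinuousMultilinearMap fun i => f (v i)
  exact a.toContinuousMultilinearMap.contDiff.comp (by fun_prop)

variable {B : Type*} [NormedAddCommGroup B] [NormedSpace ℝ B] {M : Type*} [TopologicalSpace M]
  [ChartedSpace B M]
  {F₁ : Type*} [NormedAddCommGroup F₁] [NormedSpace ℝ F₁] [FiniteDimensional ℝ F₁]
  {E₁ : M → Type*} [∀ x, AddCommGroup (E₁ x)] [∀ x, Module ℝ (E₁ x)]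
  [∀ x, TopologicalSpace (E₁ x)] [TopologicalSpace (TotalSpace F₁ E₁)] [FiberBundle F₁ E₁]
  [VectorBundle ℝ F₁ E₁]
  {F₂ : Type*} [NormedAddCommGroup F₂] [NormedSpace ℝ F₂] [FiniteDimensional ℝ F₂]
  {E₂ : M → Type*} [∀ x, AddCommGroup (E₂ x)] [∀ x, Module ℝ (E₂ x)]
  [∀ x, TopologicalSpace (E₂ x)] [∀ x, IsTopologicalAddGroup (E₂ x)]
  [∀ x, ContinuousSMul ℝ (E₂ x)] [TopologicalSpace (TotalSpace F₂ E₂)] [FiberBundle F₂ E₂]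
  [VectorBundle ℝ F₂ E₂]
  [ContMDiffVectorBundle ∞ F₁ E₁ 𝓘(ℝ, B)] [ContMDiffVectorBundle ∞ F₂ E₂ 𝓘(ℝ, B)]
  (p : ℕ)

open Bundle.Pretrivialization

/-- The transition map is a ↦ g ∘ a ∘ f with transition maps f and g of the two bundles; it depends
multilinearly on f and linearly on g. -/
theorem contMDiffOn_continuousAlternatingMapCoordChange
    (e₁ e₁' : Trivialization F₁ (TotalSpace.proj : TotalSpace F₁ E₁ → M))
    (e₂ e₂' : Trivialization F₂ (TotalSpace.proj : TotalSpace F₂ E₂ → M))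
    [MemTrivializationAtlas e₁] [MemTrivializationAtlas e₁']
    [MemTrivializationAtlas e₂] [MemTrivializationAtlas e₂'] :
    ContMDiffOn 𝓘(ℝ, B) 𝓘(ℝ, (F₁ [⋀^Fin p]→L[ℝ] F₂) →L[ℝ] (F₁ [⋀^Fin p]→L[ℝ] F₂)) ∞
      (continuousAlternatingMapCoordChange ℝ (Fin p) e₁ e₁' e₂ e₂')
      (e₁.baseSet ∩ e₂.baseSet ∩ (e₁'.baseSet ∩ e₂'.baseSet)) := by
  have h₁ := (contMDiffOn_coordChangeL (IB := 𝓘(ℝ, B)) e₁' e₁ (n := ∞)).mono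
    (show e₁.baseSet ∩ e₂.baseSet ∩ (e₁'.baseSet ∩ e₂'.baseSet) ⊆ e₁'.baseSet ∩ e₁.baseSet by
      mfld_set_tac)
  have h₂ := (contMDiffOn_coordChangeL (IB := 𝓘(ℝ, B)) e₂ e₂' (n := ∞)).mono
    (show e₁.baseSet ∩ e₂.baseSet ∩ (e₁'.baseSet ∩ e₂'.baseSet) ⊆ e₂.baseSet ∩ e₂'.baseSet by
      mfld_set_tac)
  have h₅ : ContDiff ℝ ∞ fun g : F₂ →L[ℝ] F₂ =>
      ContinuousLinearMap.compContinuousAlternatingMapCLM (ι := Fin p) ℝ F₁ F₂ F₂ g := by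
    refine contDiff_clm_apply_iff.2 fun a => contDiff_continuousAlternatingMap_of_apply fun v => ?_
    change ContDiff ℝ ∞ fun g : F₂ →L[ℝ] F₂ => g (a v)
    fun_prop
  have h₃ := h₅.contMDiff.comp_contMDiffOn h₂
  have h₄ := (contDiff_compContinuousLinearMapCLM (V := F₁) (V' := F₁) (N := F₂)
    (p := p)).contMDiff.comp_contMDiffOn h₁
  exact h₃.clm_comp h₄

instance ContMDiffVectorBundle.continuousAlternatingMap :
    ContMDiffVectorBundle ∞ (F₁ [⋀^Fin p]→L[ℝ] F₂) (fun x => E₁ x [⋀^Fin p]→L[ℝ] E₂ x)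
      𝓘(ℝ, B) := by
  have : (Bundle.ContinuousAlternatingMap.vectorPrebundle ℝ (Fin p) F₁ E₁ F₂ E₂).IsContMDiff
      𝓘(ℝ, B) ∞ :=
    { exists_contMDiffCoordChange := by
        rintro _ ⟨e₁, e₂, he₁, he₂, rfl⟩ _ ⟨e₁', e₂', he₁', he₂', rfl⟩
        exact ⟨continuousAlternatingMapCoordChange ℝ (Fin p) e₁ e₁' e₂ e₂',
          contMDiffOn_continuousAlternatingMapCoordChange p e₁ e₁' e₂ e₂',
          continuousAlternatingMapCoordChange_apply⟩ }
  exact (Bundle.ContinuousAlternatingMap.vectorPrebundle ℝ (Fin p) F₁ E₁ F₂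
    E₂).contMDiffVectorBundle 𝓘(ℝ, B)

end AlternatingBundle

/-! ### Coordinates of bundle-valued forms at a fixed base point -/

section Coordinates

variable {B : Type*} [NormedAddCommGroup B] [NormedSpace ℝ B] [FiniteDimensional ℝ B]
  {M : Type*} [TopologicalSpace M] [ChartedSpace B M] [IsManifold 𝓘(ℝ, B) ∞ M]
  {F : Type*} [NormedAddCommGroup F] [NormedSpace ℝ F] [FiniteDimensional ℝ F]
  {E : M → Type*} [∀ x, AddCommGroup (E x)] [∀ x, Module ℝ (E x)]
  [∀ x, TopologicalSpace (E x)] [∀ x, IsTopologicalAddGroup (E x)]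
  [∀ x, ContinuousSMul ℝ (E x)]
  [TopologicalSpace (TotalSpace F E)] [FiberBundle F E] [VectorBundle ℝ F E] {p : ℕ}

variable (F E) in
/-- `z` belongs to the domain of the preferred trivialization at `x₀` (which is irrelevant if the
bundle has rank zero). -/
def InFrameDomain (x₀ z : M) : Prop :=
  z ∈ (chartAt B x₀).source ∧ (Nontrivial F → z ∈ (trivializationAt F E x₀).baseSet)

theorem subsingleton_fiber [Subsingleton F] (z : M) : Subsingleton (E z) :=
  ((trivializationAt F E z).continuousLinearEquivAt ℝ z
    (mem_baseSet_trivializationAt F E z)).toLinearEquiv.toEquiv.subsingleton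

variable (F) in
/-- The alternating form in the model space with given coordinates. -/
def fromCoord (x₀ z : M) (a : B [⋀^Fin p]→L[ℝ] F) : TangentSpace 𝓘(ℝ, B) z [⋀^Fin p]→L[ℝ] E z :=
  (((trivializationAt F E x₀).symmL ℝ z).compContinuousAlternatingMap
    a).compContinuousLinearMap
      ((trivializationAt B (TangentSpace 𝓘(ℝ, B)) x₀).continuousLinearMapAt ℝ z)

theorem inCoordinates_fromCoord {x₀ z : M} (hz : InFrameDomain (B := B) F E x₀ z)
    (a : B [⋀^Fin p]→L[ℝ] F) :
    ContinuousAlternatingMap.inCoordinates (𝕜 := ℝ) B F x₀ z x₀ z (fromCoord F (E := E) x₀ z a) =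
      a := by
  rcases subsingleton_or_nontrivial F with h | h
  · ext v
    exact Subsingleton.elim _ _
  · have h1 : z ∈ (trivializationAt B (TangentSpace 𝓘(ℝ, B)) x₀).baseSet := hz.1
    ext v
    refine ((trivializationAt F E x₀).continuousLinearMapAt_symmL (hz.2 h) _).trans ?_
    exact congrArg a (funext fun i => (trivializationAt B (TangentSpace 𝓘(ℝ, B))
      x₀).continuousLinearMapAt_symmL h1 (v i))

theorem fromCoord_inCoordinates {x₀ z : M} (hz : InFrameDomain (B := B) F E x₀ z)
    (a : TangentSpace 𝓘(ℝ, B) z [⋀^Fin p]→L[ℝ] E z) :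
    fromCoord F (E := E) x₀ z
      (ContinuousAlternatingMap.inCoordinates (𝕜 := ℝ) B F x₀ z x₀ z a) = a := by
  rcases subsingleton_or_nontrivial F with h | h
  · have := subsingleton_fiber (F := F) (E := E) z
    ext v
    exact Subsingleton.elim _ _
  · have h1 : z ∈ (trivializationAt B (TangentSpace 𝓘(ℝ, B)) x₀).baseSet := hz.1
    ext v
    refine ((trivializationAt F E x₀).symmL_continuousLinearMapAt (hz.2 h) _).trans ?_
    exact congrArg a (funext fun i => (trivializationAt B (TangentSpace 𝓘(ℝ, B))
      x₀).symmL_continuousLinearMapAt h1 (v i))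

variable [ContMDiffVectorBundle ∞ F E 𝓘(ℝ, B)]

/-- Smoothness of a family of forms at a point may be tested in the coordinates at any `x₀`. -/
theorem contMDiffAt_form_iff {U : Opens M}
    (η : ∀ x : U, TangentSpace 𝓘(ℝ, B) (x : M) [⋀^Fin p]→L[ℝ] E x) (x₀ : M) (x : U)
    (hx : InFrameDomain (B := B) F E x₀ (x : M)) :
    ContMDiffAt 𝓘(ℝ, B) (𝓘(ℝ, B).prod 𝓘(ℝ, B [⋀^Fin p]→L[ℝ] F)) ∞ (fun x : U =>
      TotalSpace.mk' (B [⋀^Fin p]→L[ℝ] F)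
        (E := fun x : M => TangentSpace 𝓘(ℝ, B) x [⋀^Fin p]→L[ℝ] E x) (x : M) (η x)) x ↔
    ContMDiffAt 𝓘(ℝ, B) 𝓘(ℝ, B [⋀^Fin p]→L[ℝ] F) ∞ (fun x : U =>
      ContinuousAlternatingMap.inCoordinates (𝕜 := ℝ) B F x₀ (x : M) x₀ (x : M) (η x)) x := by
  -- In rank zero the point need not lie in the domain of the trivialization, but both sides hold
  -- since all forms vanish.
  rcases subsingleton_or_nontrivial F with h | h
  · have h0 : Subsingleton (B [⋀^Fin p]→L[ℝ] F) :=
      ⟨fun f g => ContinuousAlternatingMap.ext fun v => Subsingleton.elim _ _⟩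
    rw [contMDiffAt_totalSpace]
    refine ⟨fun _ => ?_, fun _ => ⟨contMDiff_subtype_val.contMDiffAt, ?_⟩⟩
    · exact (contMDiffAt_const (c := 0)).congr_of_eventuallyEq
        (Filter.Eventually.of_forall fun x => Subsingleton.elim _ _)
    · exact (contMDiffAt_const (c := 0)).congr_of_eventuallyEq
        (Filter.Eventually.of_forall fun x => Subsingleton.elim _ _)
  · rw [((trivializationAt B (TangentSpace 𝓘(ℝ, B)) x₀).continuousAlternatingMap ℝ (Fin p)
      (trivializationAt F E x₀)).contMDiffAt_iff (IB := 𝓘(ℝ, B))]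
    · exact and_iff_right contMDiff_subtype_val.contMDiffAt
    · exact ⟨hx.1, hx.2 h⟩

end Coordinates

/-! ### Forms of mixed degree read in a chart -/

section TotalCoordinates

variable {B : Type*} [NormedAddCommGroup B] [NormedSpace ℝ B] [FiniteDimensional ℝ B]
  {M : Type*} [TopologicalSpace M] [ChartedSpace B M] [IsManifold 𝓘(ℝ, B) ∞ M]
  {F : ℤ → Type*} [∀ q, NormedAddCommGroup (F q)] [∀ q, NormedSpace ℝ (F q)]
  [∀ q, FiniteDimensional ℝ (F q)]
  {E : ℤ → M → Type*} [∀ q x, AddCommGroup (E q x)] [∀ q x, Module ℝ (E q x)]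
  [∀ q x, TopologicalSpace (E q x)] [∀ q x, IsTopologicalAddGroup (E q x)]
  [∀ q x, ContinuousSMul ℝ (E q x)] [∀ q, TopologicalSpace (TotalSpace (F q) (E q))]
  [∀ q, FiberBundle (F q) (E q)] [∀ q, VectorBundle ℝ (F q) (E q)]
  {U : Opens M} {k p m : ℕ} {q : ℤ}

variable (B F E) in
/-- The points in the domains of all preferred trivializations at `x₀`. -/
def frameDomain (x₀ : M) : Set M := {z | ∀ q, InFrameDomain (B := B) (F q) (E q) x₀ z}

theorem frameDomain_subset (x₀ : M) : frameDomain B F E x₀ ⊆ (chartAt B x₀).source :=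
  fun _ hz => (hz 0).1

theorem frameDomain_trivial (x₀ : M) :
    frameDomain B F (fun q => Trivial M (F q)) x₀ = (chartAt B x₀).source :=
  Set.Subset.antisymm (frameDomain_subset x₀) fun _ hz _ => ⟨hz, fun _ => trivial⟩

theorem frameDomain_mem_nhds (hF : {q : ℤ | Nontrivial (F q)}.Finite) (x₀ : M) :
    frameDomain B F E x₀ ∈ 𝓝 x₀ := by
  -- Only the finitely many nonzero `F q` impose a condition; an intersection of trivialization
  -- domains over all integers need not be a neighbourhood.
  have h1 : (chartAt B x₀).source ∩ ⋂ q ∈ {q : ℤ | Nontrivial (F q)},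
      (trivializationAt (F q) (E q) x₀).baseSet ⊆ frameDomain B F E x₀ := by
    intro z hz q
    exact ⟨hz.1, fun hq => by simpa using Set.mem_iInter₂.1 hz.2 q hq⟩
  refine Filter.mem_of_superset (Filter.inter_mem (chart_source_mem_nhds B x₀) ?_) h1
  exact (Filter.biInter_mem hF).2 fun q _ =>
    (trivializationAt (F q) (E q) x₀).open_baseSet.mem_nhds (mem_baseSet_trivializationAt _ _ _)

variable (F) in
/-- The coordinates of alternating forms at `z`. -/
def toCoordAt (x₀ z : M) :
    PtTotal (TangentSpace 𝓘(ℝ, B) z) (fun q => E q z) →ₗ[ℝ] PtTotal B F :=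
  ptMap ((trivializationAt B (TangentSpace 𝓘(ℝ, B)) x₀).symmL ℝ z)
    fun q => (trivializationAt (F q) (E q) x₀).continuousLinearMapAt ℝ z

variable (F) in
/-- The alternating forms at `z` with given coordinates. -/
def fromCoordAt (x₀ z : M) :
    PtTotal B F →ₗ[ℝ] PtTotal (TangentSpace 𝓘(ℝ, B) z) (fun q => E q z) :=
  ptMap ((trivializationAt B (TangentSpace 𝓘(ℝ, B)) x₀).continuousLinearMapAt ℝ z)
    fun q => (trivializationAt (F q) (E q) x₀).symmL ℝ z

theorem toCoordAt_fromCoordAt {x₀ z : M} (hz : z ∈ frameDomain B F E x₀) (a : PtTotal B F) :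
    toCoordAt (E := E) F x₀ z (fromCoordAt F x₀ z a) = a := by
  funext p q
  exact inCoordinates_fromCoord (hz q) (a p q)

theorem fromCoordAt_toCoordAt {x₀ z : M} (hz : z ∈ frameDomain B F E x₀)
    (a : PtTotal (TangentSpace 𝓘(ℝ, B) z) (fun q => E q z)) :
    fromCoordAt (E := E) F x₀ z (toCoordAt F x₀ z a) = a := by
  funext p q
  exact fromCoord_inCoordinates (hz q) (a p q)

/-- The value of a form at a point. -/
def TotalForms.at (η : TotalForms B F E U) (z : M) (hz : z ∈ U) :
    PtTotal (TangentSpace 𝓘(ℝ, B) z) (fun q => E q z) := fun p q => (η p q).1 ⟨z, hz⟩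

open Classical in
/-- The coordinates at `x₀` of a form on `U`, as a function on the model space. -/
def totalCoord (η : TotalForms B F E U) (x₀ : M) (y : B) : PtTotal B F :=
  if h : (extChartAt 𝓘(ℝ, B) x₀).symm y ∈ U then
    toCoordAt F x₀ ((extChartAt 𝓘(ℝ, B) x₀).symm y) (η.at _ h) else 0

theorem totalCoord_of_mem (η : TotalForms B F E U) (x₀ : M) {y : B}
    (h : (extChartAt 𝓘(ℝ, B) x₀).symm y ∈ U) : totalCoord η x₀ y =
      toCoordAt F x₀ ((extChartAt 𝓘(ℝ, B) x₀).symm y) (η.at _ h) := dif_pos h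

theorem totalCoord_of_notMem (η : TotalForms B F E U) (x₀ : M) {y : B}
    (h : (extChartAt 𝓘(ℝ, B) x₀).symm y ∉ U) : totalCoord η x₀ y = 0 := dif_neg h

theorem extChartAt_symm_apply {x₀ z : M} (hz : z ∈ (chartAt B x₀).source) :
    (extChartAt 𝓘(ℝ, B) x₀).symm (extChartAt 𝓘(ℝ, B) x₀ z) = z :=
  (extChartAt 𝓘(ℝ, B) x₀).left_inv (by rwa [extChartAt_source])

theorem totalCoord_apply (η : TotalForms B F E U) {x₀ z : M} (hz : z ∈ (chartAt B x₀).source)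
    (hU : z ∈ U) : totalCoord η x₀ (extChartAt 𝓘(ℝ, B) x₀ z) = toCoordAt F x₀ z (η.at z hU) := by
  have h := extChartAt_symm_apply hz
  have h1 : (extChartAt 𝓘(ℝ, B) x₀).symm (extChartAt 𝓘(ℝ, B) x₀ z) ∈ U := by rwa [h]
  rw [totalCoord_of_mem η x₀ h1]
  generalize (extChartAt 𝓘(ℝ, B) x₀).symm (extChartAt 𝓘(ℝ, B) x₀ z) = w at h h1
  subst h
  rfl

theorem totalCoord_add (η θ : TotalForms B F E U) (x₀ : M) (y : B) :
    totalCoord (η + θ) x₀ y = totalCoord η x₀ y + totalCoord θ x₀ y := by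
  by_cases h : (extChartAt 𝓘(ℝ, B) x₀).symm y ∈ U
  · rw [totalCoord_of_mem _ _ h, totalCoord_of_mem _ _ h, totalCoord_of_mem _ _ h, ← map_add]
    rfl
  · rw [totalCoord_of_notMem _ _ h, totalCoord_of_notMem _ _ h, totalCoord_of_notMem _ _ h,
      add_zero]

theorem totalCoord_smul (c : ℝ) (η : TotalForms B F E U) (x₀ : M) (y : B) :
    totalCoord (c • η) x₀ y = c • totalCoord η x₀ y := by
  by_cases h : (extChartAt 𝓘(ℝ, B) x₀).symm y ∈ U
  · rw [totalCoord_of_mem _ _ h, totalCoord_of_mem _ _ h, ← map_smul]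
    rfl
  · rw [totalCoord_of_notMem _ _ h, totalCoord_of_notMem _ _ h, smul_zero]

theorem totalCoord_sum {κ : Type*} (s : Finset κ) (η : κ → TotalForms B F E U) (x₀ : M) (y : B) :
    totalCoord (∑ i ∈ s, η i) x₀ y = ∑ i ∈ s, totalCoord (η i) x₀ y := by
  induction s using Finset.cons_induction with
  | empty => simpa using totalCoord_smul (0 : ℝ) (0 : TotalForms B F E U) x₀ y
  | cons i s hi ih => rw [Finset.sum_cons, Finset.sum_cons, totalCoord_add, ih]

theorem at_totalWedge (σ : Form B ℝ (Trivial M ℝ) U k) (η : TotalForms B F E U) (z : M)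
    (hz : z ∈ U) : (totalWedge σ η).at z hz = ptWedge (σ.1 ⟨z, hz⟩) (η.at z hz) := by
  funext m q
  by_cases h : k ≤ m
  · rw [ptWedge, dif_pos h, TotalForms.at, totalWedge, dif_pos h]
    rfl
  · rw [ptWedge, dif_neg h, TotalForms.at, totalWedge, dif_neg h]
    rfl

theorem totalCoord_totalWedge (σ : Form B ℝ (Trivial M ℝ) U k) (η : TotalForms B F E U) (x₀ : M)
    (y : B) : totalCoord (totalWedge σ η) x₀ y =
      ptWedge (formInChart σ x₀ y) (totalCoord η x₀ y) := by
  by_cases h : (extChartAt 𝓘(ℝ, B) x₀).symm y ∈ U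
  · rw [totalCoord_of_mem _ _ h, totalCoord_of_mem _ _ h, at_totalWedge, toCoordAt, ptMap_ptWedge,
      formInChart, formCoord_of_mem _ _ _ h]
  · rw [totalCoord_of_notMem _ _ h, totalCoord_of_notMem _ _ h, ptWedge_zero]

theorem totalCoord_totalRestrict {W : Opens M} (hUW : U ≤ W) (η : TotalForms B F E W) (x₀ : M)
    {y : B} (h : (extChartAt 𝓘(ℝ, B) x₀).symm y ∈ U) :
    totalCoord (totalRestrict hUW η) x₀ y = totalCoord η x₀ y := by
  rw [totalCoord_of_mem _ _ h, totalCoord_of_mem _ _ (hUW h)]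
  rfl

theorem ptHomogeneous_totalCoord {d : ℤ} {η : TotalForms B F E U} (hη : IsHomogeneousForm d η)
    (x₀ : M) (y : B) : PtHomogeneous d (totalCoord η x₀ y) := by
  intro p q hpq
  by_cases h : (extChartAt 𝓘(ℝ, B) x₀).symm y ∈ U
  · rw [totalCoord_of_mem _ _ h]
    ext v
    change (trivializationAt (F q) (E q) x₀).continuousLinearMapAt ℝ _ (((η p q).1 ⟨_, h⟩) _) = 0
    rw [hη p q hpq]
    exact map_zero _
  · rw [totalCoord_of_notMem _ _ h]
    rfl

/-- On the frame domain coordinates determine the form, so identities between operators on forms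
reduce to identities in the model space. -/
theorem TotalForms.ext_coord {x₀ : M} (hU : (U : Set M) ⊆ frameDomain B F E x₀)
    {η θ : TotalForms B F E U} (h : ∀ z ∈ U, totalCoord η x₀ (extChartAt 𝓘(ℝ, B) x₀ z) =
      totalCoord θ x₀ (extChartAt 𝓘(ℝ, B) x₀ z)) : η = θ := by
  funext p q
  refine Subtype.ext (funext fun z => ?_)
  have h1 := h z z.2
  rw [totalCoord_apply η (frameDomain_subset x₀ (hU z.2)) z.2,
    totalCoord_apply θ (frameDomain_subset x₀ (hU z.2)) z.2] at h1
  have h2 := congrArg (fromCoordAt (E := E) F x₀ z) h1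
  rw [fromCoordAt_toCoordAt (hU z.2), fromCoordAt_toCoordAt (hU z.2)] at h2
  exact congrFun (congrFun h2 p) q

theorem isHomogeneousForm_of_coord {d : ℤ} {x₀ : M} (hU : (U : Set M) ⊆ frameDomain B F E x₀)
    {η : TotalForms B F E U}
    (h : ∀ z ∈ U, PtHomogeneous d (totalCoord η x₀ (extChartAt 𝓘(ℝ, B) x₀ z))) :
    IsHomogeneousForm d η := by
  intro p q hpq
  refine Subtype.ext (funext fun z => ?_)
  have h1 := h z z.2 p q hpq
  rw [totalCoord_apply η (frameDomain_subset x₀ (hU z.2)) z.2] at h1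
  have h2 := fromCoord_inCoordinates (hU z.2 q) ((η p q).1 z)
  refine h2.symm.trans ((congrArg (fromCoord (F q) (E := E q) x₀ z) h1).trans ?_)
  ext v
  exact map_zero ((trivializationAt (F q) (E q) x₀).symmL ℝ (z : M))

theorem formD_apply_coord {V : Type*} [NormedAddCommGroup V] [NormedSpace ℝ V]
    (η : Form B V (Trivial M V) U p) {x₀ z : M} (hz : z ∈ (chartAt B x₀).source) (hU : z ∈ U)
    (hd : DifferentiableAt ℝ (formInChart η x₀) (extChartAt 𝓘(ℝ, B) x₀ z)) :
    formInChart (formD η) x₀ (extChartAt 𝓘(ℝ, B) x₀ z) =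
      extDeriv (formInChart η x₀) (extChartAt 𝓘(ℝ, B) x₀ z) := by
  rw [formInChart, extChartAt_symm_apply hz, formCoord_of_mem _ _ _ hU]
  exact formDAt_eq η x₀ ⟨z, hU⟩ hz hd

theorem totalCoord_trivial (η : TotalForms B F (fun q => Trivial M (F q)) U) (x₀ : M) (y : B) :
    totalCoord η x₀ y p q = formInChart (η p q) x₀ y := by
  rw [formInChart]
  by_cases h : (extChartAt 𝓘(ℝ, B) x₀).symm y ∈ U
  · rw [totalCoord_of_mem _ _ h, formCoord_of_mem _ _ _ h]
    exact inCoordinates_trivial x₀ _ _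
  · rw [totalCoord_of_notMem _ _ h, formCoord_of_not_mem _ _ _ h]
    rfl

variable [∀ q, ContMDiffVectorBundle ∞ (F q) (E q) 𝓘(ℝ, B)]

/-- The form smoothness criterion at a movable point, composed with the inverse chart. It is stated
for any `f` with the right values so as to cover both `totalCoord` and `formInChart`. -/
theorem contDiffAt_coord {N : Type*} [NormedAddCommGroup N] [NormedSpace ℝ N]
    [FiniteDimensional ℝ N] {G : M → Type*} [∀ x, AddCommGroup (G x)] [∀ x, Module ℝ (G x)]
    [∀ x, TopologicalSpace (G x)] [∀ x, IsTopologicalAddGroup (G x)] [∀ x, ContinuousSMul ℝ (G x)]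
    [TopologicalSpace (TotalSpace N G)] [FiberBundle N G] [VectorBundle ℝ N G]
    [ContMDiffVectorBundle ∞ N G 𝓘(ℝ, B)] (η : Form B N G U p) {x₀ z : M}
    (hz : InFrameDomain (B := B) N G x₀ z) (hU : z ∈ U) {f : B → B [⋀^Fin p]→L[ℝ] N}
    (hf : ∀ y (h : (extChartAt 𝓘(ℝ, B) x₀).symm y ∈ U), f y =
      ContinuousAlternatingMap.inCoordinates (𝕜 := ℝ) B N x₀ ((extChartAt 𝓘(ℝ, B) x₀).symm y) x₀
        ((extChartAt 𝓘(ℝ, B) x₀).symm y) (η.1 ⟨_, h⟩))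
    (hf0 : ∀ y, (extChartAt 𝓘(ℝ, B) x₀).symm y ∉ U → f y = 0) :
    ContDiffAt ℝ ∞ f (extChartAt 𝓘(ℝ, B) x₀ z) := by
  have hzs := hz.1
  have h1 : ContMDiffAt 𝓘(ℝ, B) 𝓘(ℝ, B [⋀^Fin p]→L[ℝ] N) ∞ (fun x : U =>
      ContinuousAlternatingMap.inCoordinates (𝕜 := ℝ) B N x₀ (x : M) x₀ (x : M) (η.1 x))
        ⟨z, hU⟩ := (contMDiffAt_form_iff η.1 x₀ ⟨z, hU⟩ hz).1 (η.2 ⟨z, hU⟩)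
  classical
  -- Extension by zero gives a function on all of `M` to compose with the inverse chart; `U` is
  -- open, so smoothness at `z` is unaffected.
  let g : M → B [⋀^Fin p]→L[ℝ] N := fun x => if h : x ∈ U then
    ContinuousAlternatingMap.inCoordinates (𝕜 := ℝ) B N x₀ x x₀ x (η.1 ⟨x, h⟩) else 0
  have h2 : ContMDiffAt 𝓘(ℝ, B) 𝓘(ℝ, B [⋀^Fin p]→L[ℝ] N) ∞ (fun x : U => g x) ⟨z, hU⟩ := by
    refine h1.congr_of_eventuallyEq (Filter.Eventually.of_forall fun x => ?_)
    exact dif_pos x.2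
  have h3 : ContMDiffAt 𝓘(ℝ, B) 𝓘(ℝ, B) ∞ (extChartAt 𝓘(ℝ, B) x₀).symm
      (extChartAt 𝓘(ℝ, B) x₀ z) :=
    (contMDiffOn_extChartAt_symm x₀).contMDiffAt
      (extChartAt_target_mem_nhds' ((extChartAt 𝓘(ℝ, B) x₀).map_source
        (by rwa [extChartAt_source])))
  have h4 : ContMDiffAt 𝓘(ℝ, B) 𝓘(ℝ, B [⋀^Fin p]→L[ℝ] N) ∞
      (g ∘ (extChartAt 𝓘(ℝ, B) x₀).symm) (extChartAt 𝓘(ℝ, B) x₀ z) := by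
    refine ContMDiffAt.comp _ ?_ h3
    rw [extChartAt_symm_apply hzs]
    exact contMDiffAt_subtype_iff.1 h2
  refine h4.contDiffAt.congr_of_eventuallyEq (Filter.Eventually.of_forall fun y => ?_)
  by_cases h : (extChartAt 𝓘(ℝ, B) x₀).symm y ∈ U
  · simp only [hf y h, g, Function.comp_apply, dif_pos h]
  · simp only [hf0 y h, g, Function.comp_apply, dif_neg h]

theorem totalSmoothAt_totalCoord (η : TotalForms B F E U) {x₀ z : M}
    (hz : z ∈ frameDomain B F E x₀) (hU : z ∈ U) :
    TotalSmoothAt (totalCoord η x₀) (extChartAt 𝓘(ℝ, B) x₀ z) := by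
  intro p q
  refine contDiffAt_coord (η p q) (hz q) hU (fun y h => ?_) fun y h => ?_
  · rw [totalCoord_of_mem _ _ h]
    rfl
  · rw [totalCoord_of_notMem _ _ h]
    rfl

theorem formInChart_contDiffAt' {V : Type*} [NormedAddCommGroup V] [NormedSpace ℝ V]
    [FiniteDimensional ℝ V] (η : Form B V (Trivial M V) U p) {x₀ z : M}
    (hz : z ∈ (chartAt B x₀).source) (hU : z ∈ U) :
    ContDiffAt ℝ ∞ (formInChart η x₀) (extChartAt 𝓘(ℝ, B) x₀ z) := by
  refine contDiffAt_coord η ⟨hz, fun _ => trivial⟩ hU (fun y h => ?_) fun y h => ?_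
  · exact (formCoord_of_mem _ _ _ h).trans (inCoordinates_trivial x₀ _ _).symm
  · exact formCoord_of_not_mem _ _ _ h

theorem contMDiffAt_of_coord {f : B → B [⋀^Fin p]→L[ℝ] F q}
    (η : ∀ x : U, TangentSpace 𝓘(ℝ, B) (x : M) [⋀^Fin p]→L[ℝ] E q x) (x₀ : M) (x : U)
    (hx : InFrameDomain (B := B) (F q) (E q) x₀ (x : M))
    (hf : ContDiffAt ℝ ∞ f (extChartAt 𝓘(ℝ, B) x₀ x))
    (h : ∀ᶠ z : U in 𝓝 x, ContinuousAlternatingMap.inCoordinates (𝕜 := ℝ) B (F q) x₀ (z : M) x₀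
      (z : M) (η z) = f (extChartAt 𝓘(ℝ, B) x₀ z)) :
    ContMDiffAt 𝓘(ℝ, B) (𝓘(ℝ, B).prod 𝓘(ℝ, B [⋀^Fin p]→L[ℝ] F q)) ∞ (fun x : U =>
      TotalSpace.mk' (B [⋀^Fin p]→L[ℝ] F q)
        (E := fun x : M => TangentSpace 𝓘(ℝ, B) x [⋀^Fin p]→L[ℝ] E q x) (x : M) (η x)) x := by
  refine (contMDiffAt_form_iff η x₀ x hx).2 ?_
  have h1 : ContMDiffAt 𝓘(ℝ, B) 𝓘(ℝ, B [⋀^Fin p]→L[ℝ] F q) ∞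
      (fun z : M => f (extChartAt 𝓘(ℝ, B) x₀ z)) (x : M) :=
    hf.contMDiffAt.comp (x : M) (contMDiffAt_extChartAt' hx.1)
  exact (contMDiffAt_subtype_iff.2 h1).congr_of_eventuallyEq h

/-- The form on `U` with given coordinates. -/
def ofCoord {x₀ : M} (hU : (U : Set M) ⊆ frameDomain B F E x₀) (f : B → PtTotal B F)
    (hf : ∀ z ∈ U, TotalSmoothAt f (extChartAt 𝓘(ℝ, B) x₀ z)) : TotalForms B F E U :=
  fun p q => ⟨fun z => fromCoord (F q) x₀ z (f (extChartAt 𝓘(ℝ, B) x₀ z) p q), fun z =>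
    contMDiffAt_of_coord _ x₀ z (hU z.2 q) (hf z z.2 p q) (Filter.Eventually.of_forall fun w =>
      inCoordinates_fromCoord (hU w.2 q) _)⟩

theorem totalCoord_ofCoord {x₀ : M} (hU : (U : Set M) ⊆ frameDomain B F E x₀) (f : B → PtTotal B F)
    (hf : ∀ z ∈ U, TotalSmoothAt f (extChartAt 𝓘(ℝ, B) x₀ z)) {z : M} (hz : z ∈ U) :
    totalCoord (ofCoord hU f hf) x₀ (extChartAt 𝓘(ℝ, B) x₀ z) = f (extChartAt 𝓘(ℝ, B) x₀ z) := by
  rw [totalCoord_apply _ (frameDomain_subset x₀ (hU hz)) hz]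
  exact toCoordAt_fromCoordAt (hU hz) _

/-- A property of points near the image of `z ∈ U` in the chart follows from that of points of
`U`. -/
theorem eventually_chart {x₀ z : M} (hz : z ∈ (chartAt B x₀).source) (hU : z ∈ U) {P : B → Prop}
    (h : ∀ w ∈ U, P (extChartAt 𝓘(ℝ, B) x₀ w)) : ∀ᶠ y in 𝓝 (extChartAt 𝓘(ℝ, B) x₀ z), P y := by
  have hz' : z ∈ (extChartAt 𝓘(ℝ, B) x₀).source := by rwa [extChartAt_source]
  have h1 : ∀ᶠ y in 𝓝 (extChartAt 𝓘(ℝ, B) x₀ z), (extChartAt 𝓘(ℝ, B) x₀).symm y ∈ U := by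
    refine (continuousAt_extChartAt_symm' hz').eventually ?_
    rw [extChartAt_symm_apply hz]
    exact U.isOpen.mem_nhds hU
  filter_upwards [h1, extChartAt_target_mem_nhds' ((extChartAt 𝓘(ℝ, B) x₀).map_source hz')]
    with y hy hyt
  have h2 := h _ hy
  rwa [(extChartAt 𝓘(ℝ, B) x₀).right_inv hyt] at h2

end TotalCoordinates

/-! ### The constant system satisfies the axioms of a flat superconnection -/

section ConstantSystem

variable {B : Type*} [NormedAddCommGroup B] [NormedSpace ℝ B] [FiniteDimensional ℝ B]
  {M : Type*} [TopologicalSpace M] [ChartedSpace B M] [IsManifold 𝓘(ℝ, B) ∞ M]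
  {F : ℤ → Type*} [∀ q, NormedAddCommGroup (F q)] [∀ q, NormedSpace ℝ (F q)]
  [∀ q, FiniteDimensional ℝ (F q)]
  {U : Opens M} {k p m : ℕ} {q : ℤ} {ι : Type*} [Fintype ι]

theorem formInChart_add {V : Type*} [NormedAddCommGroup V] [NormedSpace ℝ V]
    (η θ : Form B V (Trivial M V) U p) (x₀ : M) (y : B) :
    formInChart (η + θ) x₀ y = formInChart η x₀ y + formInChart θ x₀ y := by
  by_cases hy : (extChartAt 𝓘(ℝ, B) x₀).symm y ∈ U
  · simp only [formInChart, formCoord_of_mem _ _ _ hy]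
    rfl
  · simp only [formInChart, formCoord_of_not_mem _ _ _ hy, add_zero]

theorem formInChart_smul {V : Type*} [NormedAddCommGroup V] [NormedSpace ℝ V] (c : ℝ)
    (η : Form B V (Trivial M V) U p) (x₀ : M) (y : B) :
    formInChart (c • η) x₀ y = c • formInChart η x₀ y := by
  by_cases hy : (extChartAt 𝓘(ℝ, B) x₀).symm y ∈ U
  · simp only [formInChart, formCoord_of_mem _ _ _ hy]
    rfl
  · simp only [formInChart, formCoord_of_not_mem _ _ _ hy, smul_zero]

theorem formInChart_formMap {V V' : Type*} [NormedAddCommGroup V] [NormedSpace ℝ V]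
    [NormedAddCommGroup V'] [NormedSpace ℝ V'] (g : V →L[ℝ] V')
    (η : Form B V (Trivial M V) U p) (x₀ : M) (y : B) :
    formInChart (formMap g η) x₀ y = g.compContinuousAlternatingMap (formInChart η x₀ y) := by
  by_cases hy : (extChartAt 𝓘(ℝ, B) x₀).symm y ∈ U
  · simp only [formInChart, formCoord_of_mem _ _ _ hy]
    rfl
  · simp only [formInChart, formCoord_of_not_mem _ _ _ hy]
    ext v
    exact (map_zero g).symm

/-- The constant superconnection in coordinates. -/
theorem totalCoord_constantSuperconnection (b : GradedBasis F ι) (δ : GradedDifferential F)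
    (η : TotalForms B F (fun q => Trivial M (F q)) U) {x₀ z : M}
    (hz : z ∈ (chartAt B x₀).source) (hU : z ∈ U) :
    totalCoord (constantSuperconnection U δ η) x₀ (extChartAt 𝓘(ℝ, B) x₀ z) =
      connOp b (constForm b δ) (totalCoord η x₀) (extChartAt 𝓘(ℝ, B) x₀ z) := by
  funext p q
  rw [totalCoord_trivial]
  cases p with
  | zero =>
    rw [connOp_constForm_zero, totalCoord_trivial]
    exact formInChart_formMap _ _ _ _
  | succ p =>
    rw [connOp_constForm_succ]
    simp only [totalCoord_trivial]
    have h1 := ((formInChart_contDiffAt' (η p q) hz hU).differentiableAt (by simp))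
    rw [← formD_apply_coord (η p q) hz hU h1, ← formInChart_formMap, ← formInChart_smul,
      ← formInChart_add]
    rfl

/-- Here, as for the Leibniz rule and flatness below, the property is read off in one chart from the
operator `connOp`; the basis `b` is auxiliary. -/
theorem isHomogeneousForm_constantSuperconnection (b : GradedBasis F ι) {x₀ : M}
    (hU : (U : Set M) ⊆ (chartAt B x₀).source) (δ : GradedDifferential F) {d : ℤ}
    {η : TotalForms B F (fun q => Trivial M (F q)) U} (hη : IsHomogeneousForm d η) :
    IsHomogeneousForm (d + 1) (constantSuperconnection U δ η) := by
  have hU' : (U : Set M) ⊆ frameDomain B F (fun q => Trivial M (F q)) x₀ := by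
    rwa [frameDomain_trivial]
  refine isHomogeneousForm_of_coord hU' fun z hz => ?_
  rw [totalCoord_constantSuperconnection b δ η (hU hz) hz, connOp_eq]
  intro p q hpq
  rw [Pi.add_apply, Pi.add_apply,
    ptHomogeneous_dTotal _ (.of_forall fun y => ptHomogeneous_totalCoord hη x₀ y) p q hpq,
    ptHomogeneous_connForm b (fun i => constForm_homogeneous b δ _ i)
      (ptHomogeneous_totalCoord hη x₀ _) p q hpq, add_zero]

theorem constantSuperconnection_totalWedge (b : GradedBasis F ι) {x₀ : M}
    (hU : (U : Set M) ⊆ (chartAt B x₀).source) (δ : GradedDifferential F)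
    (σ : Form B ℝ (Trivial M ℝ) U k) (η : TotalForms B F (fun q => Trivial M (F q)) U) :
    constantSuperconnection U δ (totalWedge σ η) = totalWedge (formD σ) η +
      (-1 : ℝ) ^ k • totalWedge σ (constantSuperconnection U δ η) := by
  have hU' : (U : Set M) ⊆ frameDomain B F (fun q => Trivial M (F q)) x₀ := by
    rwa [frameDomain_trivial]
  refine TotalForms.ext_coord hU' fun z hz => ?_
  have h1 := formInChart_contDiffAt' σ (hU hz) hz
  have h2 : totalCoord (totalWedge σ η) x₀ = fun y =>
    ptWedge (formInChart σ x₀ y) (totalCoord η x₀ y) :=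
      funext fun y => totalCoord_totalWedge σ η x₀ y
  rw [totalCoord_constantSuperconnection b δ _ (hU hz) hz, totalCoord_add, totalCoord_smul,
    totalCoord_totalWedge, totalCoord_totalWedge,
    totalCoord_constantSuperconnection b δ _ (hU hz) hz, h2,
    connOp_ptWedge b _ h1 (totalSmoothAt_totalCoord η (hU' hz) hz),
    formD_apply_coord σ (hU hz) hz (h1.differentiableAt (by simp))]

theorem totalCoord_zero {E : ℤ → M → Type*} [∀ q x, AddCommGroup (E q x)]
    [∀ q x, Module ℝ (E q x)] [∀ q x, TopologicalSpace (E q x)]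
    [∀ q x, IsTopologicalAddGroup (E q x)] [∀ q x, ContinuousSMul ℝ (E q x)]
    [∀ q, TopologicalSpace (TotalSpace (F q) (E q))]
    [∀ q, FiberBundle (F q) (E q)] [∀ q, VectorBundle ℝ (F q) (E q)] (x₀ : M) (y : B) :
    totalCoord (0 : TotalForms B F E U) x₀ y = 0 := by
  simpa using totalCoord_smul (0 : ℝ) (0 : TotalForms B F E U) x₀ y

theorem constantSuperconnection_constantSuperconnection (b : GradedBasis F ι) {x₀ : M}
    (hU : (U : Set M) ⊆ (chartAt B x₀).source) (δ : GradedDifferential F)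
    (η : TotalForms B F (fun q => Trivial M (F q)) U) :
    constantSuperconnection U δ (constantSuperconnection U δ η) = 0 := by
  have hU' : (U : Set M) ⊆ frameDomain B F (fun q => Trivial M (F q)) x₀ := by
    rwa [frameDomain_trivial]
  refine TotalForms.ext_coord hU' fun z hz => ?_
  have h1 : totalCoord (constantSuperconnection U δ η) x₀ =ᶠ[𝓝 (extChartAt 𝓘(ℝ, B) x₀ z)]
      connOp b (constForm b δ) (totalCoord η x₀) :=
    eventually_chart (hU hz) hz fun w hw =>
      totalCoord_constantSuperconnection b δ η (hU hw) hw
  rw [totalCoord_constantSuperconnection b δ _ (hU hz) hz, connOp_congr b _ h1,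
    connOp_constForm_connOp b δ (totalSmoothAt_totalCoord η (hU' hz) hz), totalCoord_zero]

end ConstantSystem

/-! ### From a frame to an isomorphism of local systems -/

section FrameIso

variable {B : Type*} [NormedAddCommGroup B] [NormedSpace ℝ B] [FiniteDimensional ℝ B]
  {M : Type*} [TopologicalSpace M] [ChartedSpace B M] [IsManifold 𝓘(ℝ, B) ∞ M]
  {F : ℤ → Type*} [∀ q, NormedAddCommGroup (F q)] [∀ q, NormedSpace ℝ (F q)]
  [∀ q, FiniteDimensional ℝ (F q)]
  {E : ℤ → M → Type*} [∀ q x, AddCommGroup (E q x)] [∀ q x, Module ℝ (E q x)]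
  [∀ q x, TopologicalSpace (E q x)] [∀ q x, IsTopologicalAddGroup (E q x)]
  [∀ q x, ContinuousSMul ℝ (E q x)] [∀ q, TopologicalSpace (TotalSpace (F q) (E q))]
  [∀ q, FiberBundle (F q) (E q)] [∀ q, VectorBundle ℝ (F q) (E q)]
  [∀ q, ContMDiffVectorBundle ∞ (F q) (E q) 𝓘(ℝ, B)]
  {ι : Type*} [Fintype ι] {b : GradedBasis F ι} {U : Opens M} {k p m : ℕ} {q : ℤ}

variable (E b U) in
/-- `s` is a smooth homogeneous frame of the module of forms on `U`, in the coordinates at `x₀`,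
and `u` describes the inverse of the corresponding isomorphism. -/
structure IsFramePair (x₀ : M) (s u : B → ι → PtTotal B F) : Prop where
  subset : (U : Set M) ⊆ frameDomain B F E x₀
  smooth_left : ∀ z ∈ U, ∀ i, TotalSmoothAt (fun y => s y i) (extChartAt 𝓘(ℝ, B) x₀ z)
  smooth_right : ∀ z ∈ U, ∀ i, TotalSmoothAt (fun y => u y i) (extChartAt 𝓘(ℝ, B) x₀ z)
  homogeneous_left : ∀ z ∈ U, ∀ i, PtHomogeneous (b.deg i) (s (extChartAt 𝓘(ℝ, B) x₀ z) i)
  homogeneous_right : ∀ z ∈ U, ∀ i, PtHomogeneous (b.deg i) (u (extChartAt 𝓘(ℝ, B) x₀ z) i)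
  left_right : ∀ z ∈ U, ∀ a, b.extend (s (extChartAt 𝓘(ℝ, B) x₀ z))
    (b.extend (u (extChartAt 𝓘(ℝ, B) x₀ z)) a) = a
  right_left : ∀ z ∈ U, ∀ a, b.extend (u (extChartAt 𝓘(ℝ, B) x₀ z))
    (b.extend (s (extChartAt 𝓘(ℝ, B) x₀ z)) a) = a

namespace IsFramePair

variable {x₀ : M} {s u : B → ι → PtTotal B F} (h : IsFramePair E b U x₀ s u)
include h

theorem subset_source : (U : Set M) ⊆ (chartAt B x₀).source :=
  h.subset.trans (frameDomain_subset x₀)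

theorem subset_trivial : (U : Set M) ⊆ frameDomain B F (fun q => Trivial M (F q)) x₀ := by
  rw [frameDomain_trivial]
  exact h.subset_source

/-- The form on `U` with given coefficients with respect to the frame. -/
def inv (η : TotalForms B F (fun q => Trivial M (F q)) U) : TotalForms B F E U :=
  ofCoord h.subset (fun y => b.extend (s y) (totalCoord η x₀ y)) fun z hz =>
    .extend b (h.smooth_left z hz) (totalSmoothAt_totalCoord η (h.subset_trivial hz) hz)

/-- The coefficients of a form on `U` with respect to the frame. -/
def map (η : TotalForms B F E U) : TotalForms B F (fun q => Trivial M (F q)) U :=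
  ofCoord h.subset_trivial (fun y => b.extend (u y) (totalCoord η x₀ y)) fun z hz =>
    .extend b (h.smooth_right z hz) (totalSmoothAt_totalCoord η (h.subset hz) hz)

theorem totalCoord_inv (η : TotalForms B F (fun q => Trivial M (F q)) U) {z : M} (hz : z ∈ U) :
    totalCoord (h.inv η) x₀ (extChartAt 𝓘(ℝ, B) x₀ z) =
      b.extend (s (extChartAt 𝓘(ℝ, B) x₀ z)) (totalCoord η x₀ (extChartAt 𝓘(ℝ, B) x₀ z)) :=
  totalCoord_ofCoord h.subset _ _ hz

theorem totalCoord_map (η : TotalForms B F E U) {z : M} (hz : z ∈ U) :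
    totalCoord (h.map η) x₀ (extChartAt 𝓘(ℝ, B) x₀ z) =
      b.extend (u (extChartAt 𝓘(ℝ, B) x₀ z)) (totalCoord η x₀ (extChartAt 𝓘(ℝ, B) x₀ z)) :=
  totalCoord_ofCoord h.subset_trivial _ _ hz

/-- The isomorphism given by the frame. -/
def equiv : TotalForms B F E U ≃ₗ[ℝ] TotalForms B F (fun q => Trivial M (F q)) U where
  toFun := h.map
  invFun := h.inv
  map_add' η θ := TotalForms.ext_coord h.subset_trivial fun z hz => by
    rw [totalCoord_add, h.totalCoord_map _ hz, h.totalCoord_map _ hz, h.totalCoord_map _ hz,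
      totalCoord_add, map_add]
  map_smul' c η := TotalForms.ext_coord h.subset_trivial fun z hz => by
    rw [RingHom.id_apply, totalCoord_smul, h.totalCoord_map _ hz, h.totalCoord_map _ hz,
      totalCoord_smul, map_smul]
  left_inv η := TotalForms.ext_coord h.subset fun z hz => by
    rw [h.totalCoord_inv _ hz, h.totalCoord_map _ hz, h.left_right z hz]
  right_inv η := TotalForms.ext_coord h.subset_trivial fun z hz => by
    rw [h.totalCoord_map _ hz, h.totalCoord_inv _ hz, h.right_left z hz]

theorem homogeneous_map {d : ℤ} {η : TotalForms B F E U} (hη : IsHomogeneousForm d η) :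
    IsHomogeneousForm d (h.equiv η) := by
  refine isHomogeneousForm_of_coord h.subset_trivial fun z hz => ?_
  have h1 := b.extend_homogeneous (d := 0) (fun i => by
    rw [add_zero]; exact h.homogeneous_right z hz i) (ptHomogeneous_totalCoord hη x₀
      (extChartAt 𝓘(ℝ, B) x₀ z))
  rw [add_zero] at h1
  change PtHomogeneous d (totalCoord (h.map η) x₀ (extChartAt 𝓘(ℝ, B) x₀ z))
  rw [h.totalCoord_map _ hz]
  exact h1

theorem homogeneous_inv {d : ℤ} {η : TotalForms B F (fun q => Trivial M (F q)) U}
    (hη : IsHomogeneousForm d η) : IsHomogeneousForm d (h.equiv.symm η) := by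
  refine isHomogeneousForm_of_coord h.subset fun z hz => ?_
  have h1 := b.extend_homogeneous (d := 0) (fun i => by
    rw [add_zero]; exact h.homogeneous_left z hz i) (ptHomogeneous_totalCoord hη x₀
      (extChartAt 𝓘(ℝ, B) x₀ z))
  rw [add_zero] at h1
  change PtHomogeneous d (totalCoord (h.inv η) x₀ (extChartAt 𝓘(ℝ, B) x₀ z))
  rw [h.totalCoord_inv _ hz]
  exact h1

theorem equiv_totalWedge (σ : Form B ℝ (Trivial M ℝ) U k) (η : TotalForms B F E U) :
    h.equiv (totalWedge σ η) = totalWedge σ (h.equiv η) := by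
  refine TotalForms.ext_coord h.subset_trivial fun z hz => ?_
  change totalCoord (h.map _) x₀ _ = totalCoord (totalWedge σ (h.map η)) x₀ _
  rw [totalCoord_totalWedge, h.totalCoord_map _ hz, h.totalCoord_map _ hz, totalCoord_totalWedge,
    b.extend_ptWedge]

theorem equiv_symm_totalWedge (σ : Form B ℝ (Trivial M ℝ) U k)
    (η : TotalForms B F (fun q => Trivial M (F q)) U) :
    h.equiv.symm (totalWedge σ η) = totalWedge σ (h.equiv.symm η) := by
  rw [LinearEquiv.symm_apply_eq, h.equiv_totalWedge, LinearEquiv.apply_symm_apply]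

/-- The operator on forms on `U` which is given by `d + δ` in terms of the frame. -/
def conjOp (δ : GradedDifferential F) : TotalForms B F E U →ₗ[ℝ] TotalForms B F E U :=
  (h.equiv.symm.toLinearMap.comp (constantSuperconnection U δ)).comp h.equiv.toLinearMap

theorem conjOp_apply (δ : GradedDifferential F) (η : TotalForms B F E U) :
    h.conjOp δ η = h.equiv.symm (constantSuperconnection U δ (h.equiv η)) := rfl

theorem equiv_conjOp (δ : GradedDifferential F) (η : TotalForms B F E U) :
    h.equiv (h.conjOp δ η) = constantSuperconnection U δ (h.equiv η) := by
  rw [conjOp_apply, LinearEquiv.apply_symm_apply]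

theorem conjOp_homogeneous (δ : GradedDifferential F) {d : ℤ} {η : TotalForms B F E U}
    (hη : IsHomogeneousForm d η) : IsHomogeneousForm (d + 1) (h.conjOp δ η) := by
  rw [conjOp_apply]
  exact h.homogeneous_inv
    (isHomogeneousForm_constantSuperconnection b h.subset_source δ (h.homogeneous_map hη))

theorem conjOp_totalWedge (δ : GradedDifferential F) (σ : Form B ℝ (Trivial M ℝ) U k)
    (η : TotalForms B F E U) : h.conjOp δ (totalWedge σ η) =
      totalWedge (formD σ) η + (-1 : ℝ) ^ k • totalWedge σ (h.conjOp δ η) := by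
  rw [conjOp_apply, conjOp_apply, h.equiv_totalWedge,
    constantSuperconnection_totalWedge b h.subset_source δ, map_add, map_smul,
    h.equiv_symm_totalWedge, h.equiv_symm_totalWedge, LinearEquiv.symm_apply_apply]

theorem conjOp_conjOp (δ : GradedDifferential F) (η : TotalForms B F E U) :
    h.conjOp δ (h.conjOp δ η) = 0 := by
  rw [conjOp_apply, equiv_conjOp,
    constantSuperconnection_constantSuperconnection b h.subset_source δ, map_zero]

/-- The flat superconnection on `E|_U` which is given by `d + δ` in terms of the frame. -/
def superconnection (δ : GradedDifferential F) : FlatSuperconnection B F E U where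
  D := h.conjOp δ
  degree_one _ _ hη := h.conjOp_homogeneous δ hη
  leibniz _ σ η := h.conjOp_totalWedge δ σ η
  flat η := h.conjOp_conjOp δ η

theorem superconnection_D (δ : GradedDifferential F) : (h.superconnection δ).D = h.conjOp δ := rfl

/-- The frame identifies the superconnection with the constant one. -/
def localSystemIso (δ : GradedDifferential F) :
    LocalSystemIso (h.superconnection δ).D (constantSuperconnection (B := B) U δ) where
  Φ := h.equiv
  degree_zero _ _ hη := h.homogeneous_map hη
  wedge_linear _ σ η := h.equiv_totalWedge σ η
  comm η := h.equiv_conjOp δ η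

/-- A superconnection on `M` restricts to the superconnection given by a frame, if it has the
same matrix with respect to this frame. -/
theorem isRestriction {D : FlatSuperconnection B F E (⊤ : Opens M)} {β : B → ι → PtTotal B F}
    (hD : ∀ η : TotalForms B F E (⊤ : Opens M), ∀ z ∈ U,
      totalCoord (D.D η) x₀ (extChartAt 𝓘(ℝ, B) x₀ z) =
        connOp b β (totalCoord η x₀) (extChartAt 𝓘(ℝ, B) x₀ z))
    {δ : GradedDifferential F} (hδ : ∀ z ∈ U, ∀ i, connOp b β (fun y => s y i)
      (extChartAt 𝓘(ℝ, B) x₀ z) = b.extend (s (extChartAt 𝓘(ℝ, B) x₀ z))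
        (ptConst B fun q => δ.d (b.deg i) q (b.e i))) :
    D.IsRestriction le_top (h.superconnection δ) := by
  intro η
  refine TotalForms.ext_coord h.subset fun z hz => ?_
  have hmem {w : M} (hw : w ∈ U) :
      (extChartAt 𝓘(ℝ, B) x₀).symm (extChartAt 𝓘(ℝ, B) x₀ w) ∈ U := by
    rwa [extChartAt_symm_apply (h.subset_source hw)]
  -- The coefficients of the restricted form in the frame. In terms of θ both sides are computed by
  -- `connOp_extend_frame`.
  obtain ⟨θ, hθ⟩ : ∃ θ, θ = h.equiv (totalRestrict le_top η) := ⟨_, rfl⟩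
  have h1 : totalRestrict le_top η = h.inv θ := by
    rw [hθ]
    exact (h.equiv.symm_apply_apply _).symm
  have h2 : totalCoord η x₀ =ᶠ[𝓝 (extChartAt 𝓘(ℝ, B) x₀ z)]
      fun y => b.extend (s y) (totalCoord θ x₀ y) :=
    eventually_chart (h.subset_source hz) hz fun w hw => by
      beta_reduce
      rw [← h.totalCoord_inv _ hw, ← h1, totalCoord_totalRestrict _ _ _ (hmem hw)]
  have h3 : h.conjOp δ (totalRestrict le_top η) = h.inv (constantSuperconnection U δ θ) := by
    rw [hθ]
    rfl
  rw [superconnection_D, h3, totalCoord_totalRestrict _ _ _ (hmem hz), hD η z hz,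
    connOp_congr b β h2,
    connOp_extend_frame b (h.smooth_left z hz) (hδ z hz)
      (totalSmoothAt_totalCoord θ (h.subset_trivial hz) hz), h.totalCoord_inv _ hz,
    totalCoord_constantSuperconnection b δ θ (h.subset_source hz) hz]

end IsFramePair

end FrameIso

/-! ### A finite homogeneous basis of the fibre -/

section ExistsGradedBasis

theorem exists_gradedBasis {F : ℤ → Type*} [∀ q, NormedAddCommGroup (F q)]
    [∀ q, NormedSpace ℝ (F q)] [∀ q, FiniteDimensional ℝ (F q)]
    (hF : {q : ℤ | Nontrivial (F q)}.Finite) :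
    Nonempty (GradedBasis F (Σ q : hF.toFinset, Fin (Module.finrank ℝ (F q)))) := by
  refine ⟨⟨fun i => i.1, fun i => Module.finBasis ℝ (F i.1) i.2, fun i =>
    LinearMap.toContinuousLinearMap ((Module.finBasis ℝ (F i.1)).coord i.2), fun a q => ?_⟩⟩
  by_cases hq : q ∈ hF.toFinset
  · rw [Fintype.sum_sigma, Finset.sum_eq_single ⟨q, hq⟩]
    · simp only [Pi.single_eq_same]
      exact (Module.finBasis ℝ (F q)).sum_repr (a q)
    · intro r _ hr
      refine Finset.sum_eq_zero fun j _ => ?_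
      rw [Pi.single_eq_of_ne, smul_zero]
      rintro rfl
      exact hr rfl
    · simp
  · have : Subsingleton (F q) := by
      rw [← not_nontrivial_iff_subsingleton]
      simpa using hq
    exact Subsingleton.elim _ _

end ExistsGradedBasis

/-! ### Expansion of d + A in a constant basis -/

section FiniteExtend

variable {V : Type*} [NormedAddCommGroup V] [NormedSpace ℝ V] [FiniteDimensional ℝ V]
  {F : ℤ → Type*} [∀ q, NormedAddCommGroup (F q)] [∀ q, NormedSpace ℝ (F q)]
  {ι : Type*} [Fintype ι] (b : GradedBasis F ι)

/-- Forms above the dimension vanish, so one range of summation serves all components and the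
extension becomes an honest finite sum of mixed forms. -/
theorem GradedBasis.extend_eq_sum (u : ι → PtTotal V F) (a : PtTotal V F) :
    b.extend u a = ∑ p ∈ Finset.range (Module.finrank ℝ V + 1), ∑ i,
      ptWedge (b.coord i a p) (u i) := by
  funext m q
  by_cases h : m < Module.finrank ℝ V + 1
  · rw [b.extend_apply u a h]
    simp only [Finset.sum_apply]
  · have := ContinuousAlternatingMap.subsingleton_of_finrank_lt (V := V) (N := F q) (p := m)
      (by omega)
    exact Subsingleton.elim _ _

theorem GradedBasis.coord_ptParity (i : ι) (a : PtTotal V F) (p : ℕ) :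
    b.coord i (ptParity V F a) p = (-1 : ℝ) ^ p • b.coord i a p := by
  ext v
  exact map_smul (b.ε i) _ _

/-- The operator `d + A` on a form with given coordinates with respect to a constant basis. -/
theorem connOp_eq_sum (β : V → ι → PtTotal V F) {a : V → PtTotal V F} {y : V}
    (ha : TotalSmoothAt a y) :
    connOp b β a y = ∑ p ∈ Finset.range (Module.finrank ℝ V + 1), ∑ i,
      (ptWedge (extDeriv (fun z => b.coord i (a z) p) y) (b.const V i) +
        (-1 : ℝ) ^ p • ptWedge (b.coord i (a y) p) (β y i)) := by
  have h1 : a = fun z => ∑ p ∈ Finset.range (Module.finrank ℝ V + 1), ∑ i,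
      ptWedge (b.coord i (a z) p) (b.const V i) := funext fun z => by
    rw [← b.extend_eq_sum, b.extend_const]
  have h2 (p : ℕ) (i : ι) :
      TotalSmoothAt (fun z => ptWedge (b.coord i (a z) p) (b.const V i)) y :=
    .ptWedge (ha.coord b i p) (.const _)
  have h3 : dTotal a y = ∑ p ∈ Finset.range (Module.finrank ℝ V + 1), ∑ i,
      ptWedge (extDeriv (fun z => b.coord i (a z) p) y) (b.const V i) := by
    conv_lhs => rw [h1]
    rw [dTotal_sum _ fun p _ => .sum _ fun i _ => h2 p i]
    refine Finset.sum_congr rfl fun p _ => ?_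
    rw [dTotal_sum _ fun i _ => h2 p i]
    refine Finset.sum_congr rfl fun i _ => ?_
    rw [dTotal_ptWedge (ha.coord b i p) (.const _), dTotal_const, ptWedge_zero, smul_zero,
      add_zero]
  rw [connOp, h3, b.extend_eq_sum]
  simp only [Finset.sum_add_distrib, b.coord_ptParity, ptWedge_smul_left]

end FiniteExtend

/-! ### Global forms built from local coordinates -/

section Cutoff

variable {B : Type*} [NormedAddCommGroup B] [NormedSpace ℝ B] [FiniteDimensional ℝ B]
  {M : Type*} [TopologicalSpace M] [T2Space M] [ChartedSpace B M] [IsManifold 𝓘(ℝ, B) ∞ M]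
  {N : Type*} [NormedAddCommGroup N] [NormedSpace ℝ N] [FiniteDimensional ℝ N]
  {G : M → Type*} [∀ x, AddCommGroup (G x)] [∀ x, Module ℝ (G x)]
  [∀ x, TopologicalSpace (G x)] [∀ x, IsTopologicalAddGroup (G x)] [∀ x, ContinuousSMul ℝ (G x)]
  [TopologicalSpace (TotalSpace N G)] [FiberBundle N G] [VectorBundle ℝ N G] {p : ℕ}

theorem eventually_inFrameDomain {x₀ z : M} (hz : InFrameDomain (B := B) N G x₀ z) :
    ∀ᶠ w in 𝓝 z, InFrameDomain (B := B) N G x₀ w := by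
  refine Filter.Eventually.and ((chartAt B x₀).open_source.mem_nhds hz.1) ?_
  by_cases h : Nontrivial N
  · filter_upwards [(trivializationAt N G x₀).open_baseSet.mem_nhds (hz.2 h)] with w hw _
    exact hw
  · exact .of_forall fun w hw => absurd hw h

theorem fromCoord_smul (x₀ z : M) (c : ℝ) (a : B [⋀^Fin p]→L[ℝ] N) :
    fromCoord N (E := G) x₀ z (c • a) = c • fromCoord N (E := G) x₀ z a := by
  ext v
  exact map_smul ((trivializationAt N G x₀).symmL ℝ z) c _

theorem contDiffAt_bump_symm {x₀ z : M} (χ : SmoothBumpFunction 𝓘(ℝ, B) x₀)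
    (hz : z ∈ (chartAt B x₀).source) :
    ContDiffAt ℝ ∞ (fun y => χ ((extChartAt 𝓘(ℝ, B) x₀).symm y)) (extChartAt 𝓘(ℝ, B) x₀ z) := by
  have h3 : ContMDiffAt 𝓘(ℝ, B) 𝓘(ℝ, B) ∞ (extChartAt 𝓘(ℝ, B) x₀).symm
      (extChartAt 𝓘(ℝ, B) x₀ z) :=
    (contMDiffOn_extChartAt_symm x₀).contMDiffAt
      (extChartAt_target_mem_nhds' ((extChartAt 𝓘(ℝ, B) x₀).map_source
        (by rwa [extChartAt_source])))
  exact (χ.contMDiffAt.comp _ h3).contDiffAt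

variable [ContMDiffVectorBundle ∞ N G 𝓘(ℝ, B)]

/-- The form with coordinates `f` at `x₀`, multiplied by a bump function and extended by zero. -/
def cutoffForm {x₀ : M} (χ : SmoothBumpFunction 𝓘(ℝ, B) x₀)
    (hχ : ∀ z ∈ tsupport χ, InFrameDomain (B := B) N G x₀ z) (f : B → B [⋀^Fin p]→L[ℝ] N)
    (hf : ∀ z ∈ tsupport χ, ContDiffAt ℝ ∞ f (extChartAt 𝓘(ℝ, B) x₀ z)) :
    Form B N G (⊤ : Opens M) p :=
  ⟨fun z => fromCoord N x₀ z (χ z • f (extChartAt 𝓘(ℝ, B) x₀ z)), fun z => by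
    by_cases hz : (z : M) ∈ tsupport χ
    · refine contMDiffAt_of_coord (F := fun _ => N) (E := fun _ => G) (q := 0)
        (f := fun y => χ ((extChartAt 𝓘(ℝ, B) x₀).symm y) • f y) _ x₀ z (hχ z hz) ?_ ?_
      · exact (contDiffAt_bump_symm χ (hχ z hz).1).smul (hf z hz)
      · filter_upwards [continuous_subtype_val.continuousAt.eventually
          (eventually_inFrameDomain (hχ z hz))] with w hw
        rw [extChartAt_symm_apply hw.1]
        exact inCoordinates_fromCoord hw _
    -- Away from the support of the bump function the form agrees locally with the zero form,
    -- whatever the trivialization does there.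
    · refine ContMDiffAt.congr_of_eventuallyEq ((0 : Form B N G (⊤ : Opens M) p).2 z) ?_
      filter_upwards [continuous_subtype_val.continuousAt.eventually
        (notMem_tsupport_iff_eventuallyEq.1 hz)] with w hw
      have hw' : χ (w : M) = 0 := hw
      rw [hw', fromCoord_smul, zero_smul]
      rfl⟩

theorem cutoffForm_apply {x₀ : M} (χ : SmoothBumpFunction 𝓘(ℝ, B) x₀)
    (hχ : ∀ z ∈ tsupport χ, InFrameDomain (B := B) N G x₀ z) (f : B → B [⋀^Fin p]→L[ℝ] N)
    (hf : ∀ z ∈ tsupport χ, ContDiffAt ℝ ∞ f (extChartAt 𝓘(ℝ, B) x₀ z)) (z : (⊤ : Opens M)) :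
    (cutoffForm (G := G) χ hχ f hf).1 z =
      fromCoord N x₀ z (χ z • f (extChartAt 𝓘(ℝ, B) x₀ z)) := rfl

/-- The scalar form with coordinates `f` at `x₀`, multiplied by a bump function. -/
def cutoffScalar {x₀ : M} (χ : SmoothBumpFunction 𝓘(ℝ, B) x₀) (f : B → B [⋀^Fin p]→L[ℝ] ℝ)
    (hf : ∀ z ∈ tsupport χ, ContDiffAt ℝ ∞ f (extChartAt 𝓘(ℝ, B) x₀ z)) :
    Form B ℝ (Trivial M ℝ) (⊤ : Opens M) p :=
  cutoffForm χ (fun _ hz => ⟨χ.tsupport_subset_chartAt_source hz, fun _ => trivial⟩) f hf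

theorem formInChart_cutoffScalar {x₀ : M} (χ : SmoothBumpFunction 𝓘(ℝ, B) x₀)
    (f : B → B [⋀^Fin p]→L[ℝ] ℝ)
    (hf : ∀ z ∈ tsupport χ, ContDiffAt ℝ ∞ f (extChartAt 𝓘(ℝ, B) x₀ z)) {z : M}
    (hz : z ∈ (chartAt B x₀).source) :
    formInChart (cutoffScalar χ f hf) x₀ (extChartAt 𝓘(ℝ, B) x₀ z) =
      χ z • f (extChartAt 𝓘(ℝ, B) x₀ z) := by
  rw [formInChart, extChartAt_symm_apply hz, formCoord_of_mem _ _ _ (Opens.mem_top z)]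
  refine (inCoordinates_trivial x₀ z _).symm.trans ?_
  exact inCoordinates_fromCoord (F := ℝ) (E := Trivial M ℝ) ⟨hz, fun _ => trivial⟩ _

end Cutoff

/-! ### Locality of superconnections and their coordinate expression -/

section Locality

variable {B : Type*} [NormedAddCommGroup B] [NormedSpace ℝ B] [FiniteDimensional ℝ B]
  {M : Type*} [TopologicalSpace M] [T2Space M] [ChartedSpace B M] [IsManifold 𝓘(ℝ, B) ∞ M]
  {F : ℤ → Type*} [∀ q, NormedAddCommGroup (F q)] [∀ q, NormedSpace ℝ (F q)]
  [∀ q, FiniteDimensional ℝ (F q)]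
  {E : ℤ → M → Type*} [∀ q x, AddCommGroup (E q x)] [∀ q x, Module ℝ (E q x)]
  [∀ q x, TopologicalSpace (E q x)] [∀ q x, IsTopologicalAddGroup (E q x)]
  [∀ q x, ContinuousSMul ℝ (E q x)] [∀ q, TopologicalSpace (TotalSpace (F q) (E q))]
  [∀ q, FiberBundle (F q) (E q)] [∀ q, VectorBundle ℝ (F q) (E q)]
  {ι : Type*} [Fintype ι] (b : GradedBasis F ι)

theorem TotalForms.ext_at {U : Opens M} {η θ : TotalForms B F E U}
    (h : ∀ z (hz : z ∈ U), η.at z hz = θ.at z hz) : η = θ := by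
  funext p q
  exact Subtype.ext (funext fun z => congrFun (congrFun (h z z.2) p) q)

theorem ptWedge_zero_form {V : Type*} [NormedAddCommGroup V] [NormedSpace ℝ V] {N : ℤ → Type*}
    [∀ q, AddCommGroup (N q)] [∀ q, Module ℝ (N q)] [∀ q, TopologicalSpace (N q)]
    [∀ q, IsTopologicalAddGroup (N q)] [∀ q, ContinuousSMul ℝ (N q)]
    (a : V [⋀^Fin 0]→L[ℝ] ℝ) (c : PtTotal V N) : ptWedge a c = a ![] • c := by
  funext p q
  rw [ptWedge_of_add (zero_add p), altWedge_zero_form_left]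
  rfl

/-- A bump function as a form of degree zero. -/
def bumpForm {x₀ : M} (χ : SmoothBumpFunction 𝓘(ℝ, B) x₀) :
    Form B ℝ (Trivial M ℝ) (⊤ : Opens M) 0 :=
  cutoffScalar χ (fun _ => ContinuousAlternatingMap.constOfIsEmpty ℝ B (Fin 0) 1)
    fun _ _ => contDiffAt_const

theorem at_totalWedge_bumpForm {x₀ : M} (χ : SmoothBumpFunction 𝓘(ℝ, B) x₀)
    (η : TotalForms B F E (⊤ : Opens M)) (z : M) :
    (totalWedge (bumpForm χ) η).at z (Opens.mem_top _) = χ z • η.at z (Opens.mem_top _) := by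
  rw [at_totalWedge]
  refine (ptWedge_zero_form (V := B) _ _).trans ?_
  have h1 : (bumpForm χ).1 ⟨z, Opens.mem_top _⟩ ![] = χ z := by
    change fromCoord ℝ (E := Trivial M ℝ) x₀ z
      (χ z • ContinuousAlternatingMap.constOfIsEmpty ℝ B (Fin 0) (1 : ℝ)) ![] = χ z
    rw [fromCoord_smul]
    have h2 : (trivializationAt ℝ (Trivial M ℝ) x₀).symmL ℝ z = ContinuousLinearMap.id ℝ ℝ :=
      Trivial.symmL_trivialization ℝ M ℝ z
    rw [fromCoord, h2]
    exact mul_one (χ z)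
  rw [← h1]
  rfl

/-- Superconnections are local operators. -/
theorem FlatSuperconnection.at_eq_zero (D : FlatSuperconnection B F E (⊤ : Opens M))
    {η : TotalForms B F E (⊤ : Opens M)} {z : M} (h : ∀ᶠ w in 𝓝 z, η.at w (Opens.mem_top _) = 0) :
    (D.D η).at z (Opens.mem_top _) = 0 := by
  -- With χ supported where η vanishes, χ η = 0, and the Leibniz rule gives 0 = dχ ∧ η + χ Dη. At
  -- `z` the first term vanishes and χ = 1.
  obtain ⟨χ, -, hχ⟩ := (SmoothBumpFunction.nhds_basis_tsupport (I := 𝓘(ℝ, B)) z).mem_iff.1 h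
  have h1 : totalWedge (bumpForm χ) η = 0 := by
    refine TotalForms.ext_at fun w hw => ?_
    refine (at_totalWedge_bumpForm χ η w).trans ?_
    by_cases hw' : w ∈ tsupport χ
    · have h2 : η.at w (Opens.mem_top _) = 0 := hχ hw'
      rw [h2, smul_zero]
      rfl
    · rw [image_eq_zero_of_notMem_tsupport hw', zero_smul]
      rfl
  have h2 := D.leibniz 0 (bumpForm χ) η
  rw [h1, map_zero, pow_zero, one_smul] at h2
  have h3 : (0 : PtTotal (TangentSpace 𝓘(ℝ, B) z) (fun q => E q z)) =
      (totalWedge (formD (bumpForm χ)) η).at z (Opens.mem_top _) +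
        (totalWedge (bumpForm χ) (D.D η)).at z (Opens.mem_top _) :=
    congrArg (fun θ : TotalForms B F E (⊤ : Opens M) => θ.at z (Opens.mem_top _)) h2
  rw [at_totalWedge, h.self_of_nhds, ptWedge_zero, zero_add, at_totalWedge_bumpForm, χ.eq_one,
    one_smul] at h3
  exact h3.symm

/-- Locality of superconnections in coordinates. -/
theorem FlatSuperconnection.totalCoord_congr (D : FlatSuperconnection B F E (⊤ : Opens M))
    {η θ : TotalForms B F E (⊤ : Opens M)} {x₀ z : M}
    (hz : ∀ᶠ w in 𝓝 z, w ∈ frameDomain B F E x₀)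
    (h : ∀ᶠ w in 𝓝 z, totalCoord η x₀ (extChartAt 𝓘(ℝ, B) x₀ w) =
      totalCoord θ x₀ (extChartAt 𝓘(ℝ, B) x₀ w)) :
    totalCoord (D.D η) x₀ (extChartAt 𝓘(ℝ, B) x₀ z) =
      totalCoord (D.D θ) x₀ (extChartAt 𝓘(ℝ, B) x₀ z) := by
  have hzs := frameDomain_subset x₀ hz.self_of_nhds
  have h1 : (D.D (η - θ)).at z (Opens.mem_top _) = 0 := by
    refine D.at_eq_zero ?_
    filter_upwards [hz, h] with w hw hw'
    have hws := frameDomain_subset x₀ hw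
    rw [totalCoord_apply η hws (Opens.mem_top _), totalCoord_apply θ hws (Opens.mem_top _)] at hw'
    have h2 := congrArg (fromCoordAt (E := E) F x₀ w) hw'
    rw [fromCoordAt_toCoordAt hw, fromCoordAt_toCoordAt hw] at h2
    exact sub_eq_zero.2 h2
  rw [map_sub] at h1
  rw [totalCoord_apply _ hzs (Opens.mem_top _), totalCoord_apply _ hzs (Opens.mem_top _)]
  exact congrArg _ (sub_eq_zero.1 h1)

variable [∀ q, ContMDiffVectorBundle ∞ (F q) (E q) 𝓘(ℝ, B)]

/-- The total form with coordinates `f` at `x₀`, multiplied by a bump function. -/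
def cutoffTotal {x₀ : M} (χ : SmoothBumpFunction 𝓘(ℝ, B) x₀)
    (hχ : tsupport χ ⊆ frameDomain B F E x₀) (f : B → PtTotal B F)
    (hf : ∀ z ∈ tsupport χ, TotalSmoothAt f (extChartAt 𝓘(ℝ, B) x₀ z)) :
    TotalForms B F E (⊤ : Opens M) :=
  fun p q => cutoffForm χ (fun _ hz => hχ hz q) (fun y => f y p q) fun z hz => hf z hz p q

theorem totalCoord_cutoffTotal {x₀ : M} (χ : SmoothBumpFunction 𝓘(ℝ, B) x₀)
    (hχ : tsupport χ ⊆ frameDomain B F E x₀) (f : B → PtTotal B F)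
    (hf : ∀ z ∈ tsupport χ, TotalSmoothAt f (extChartAt 𝓘(ℝ, B) x₀ z)) {z : M}
    (hz : z ∈ frameDomain B F E x₀) :
    totalCoord (cutoffTotal χ hχ f hf) x₀ (extChartAt 𝓘(ℝ, B) x₀ z) =
      χ z • f (extChartAt 𝓘(ℝ, B) x₀ z) := by
  rw [totalCoord_apply _ (frameDomain_subset x₀ hz) (Opens.mem_top _)]
  exact toCoordAt_fromCoordAt hz (χ z • f (extChartAt 𝓘(ℝ, B) x₀ z))

theorem isHomogeneousForm_cutoffTotal {x₀ : M} (χ : SmoothBumpFunction 𝓘(ℝ, B) x₀)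
    (hχ : tsupport χ ⊆ frameDomain B F E x₀) (f : B → PtTotal B F)
    (hf : ∀ z ∈ tsupport χ, TotalSmoothAt f (extChartAt 𝓘(ℝ, B) x₀ z)) {d : ℤ}
    (hd : ∀ y, PtHomogeneous d (f y)) : IsHomogeneousForm d (cutoffTotal χ hχ f hf) := by
  intro p q hpq
  refine Subtype.ext (funext fun z => ?_)
  rw [cutoffTotal, cutoffForm_apply, hd _ p q hpq, smul_zero]
  ext v
  exact map_zero ((trivializationAt (F q) (E q) x₀).symmL ℝ (z : M))

/-- The forms obtained from the constant basis in the coordinates at `x₀`. -/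
def cutoffBasis {x₀ : M} (χ : SmoothBumpFunction 𝓘(ℝ, B) x₀)
    (hχ : tsupport χ ⊆ frameDomain B F E x₀) (i : ι) : TotalForms B F E (⊤ : Opens M) :=
  cutoffTotal χ hχ (fun _ => b.const B i) fun _ _ => .const _

variable {b}

theorem eventually_chart_of_eventually {x₀ z : M} (hz : z ∈ (chartAt B x₀).source) {P : B → Prop}
    (h : ∀ᶠ w in 𝓝 z, P (extChartAt 𝓘(ℝ, B) x₀ w)) :
    ∀ᶠ y in 𝓝 (extChartAt 𝓘(ℝ, B) x₀ z), P y := by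
  obtain ⟨W, hW, hWo, hzW⟩ := eventually_nhds_iff.1 h
  exact eventually_chart (U := ⟨W, hWo⟩) hz hzW fun w hw => hW w hw

/-- The coordinate expression of a superconnection near a point where the bump function is
one. -/
theorem FlatSuperconnection.totalCoord_eq_connOp (D : FlatSuperconnection B F E (⊤ : Opens M))
    {x₀ : M} (χ : SmoothBumpFunction 𝓘(ℝ, B) x₀) (hχ : tsupport χ ⊆ frameDomain B F E x₀)
    (η : TotalForms B F E (⊤ : Opens M)) {z : M} (hz : ∀ᶠ w in 𝓝 z, w ∈ frameDomain B F E x₀)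
    (hz1 : ∀ᶠ w in 𝓝 z, χ w = 1) :
    totalCoord (D.D η) x₀ (extChartAt 𝓘(ℝ, B) x₀ z) =
      connOp b (fun y i => totalCoord (D.D (cutoffBasis b χ hχ i)) x₀ y) (totalCoord η x₀)
        (extChartAt 𝓘(ℝ, B) x₀ z) := by
  have hzf := hz.self_of_nhds
  have hzs := frameDomain_subset x₀ hzf
  have hsm (p : ℕ) (i : ι) (w : M) (hw : w ∈ frameDomain B F E x₀) :
      ContDiffAt ℝ ∞ (fun y => b.coord i (totalCoord η x₀ y) p) (extChartAt 𝓘(ℝ, B) x₀ w) :=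
    (totalSmoothAt_totalCoord η hw (Opens.mem_top _)).coord b i p
  -- Near `z`, where χ = 1, η equals the global form ∑ (χ aᵢ) ∧ (χ eᵢ). By locality D may be
  -- computed on this sum, where the Leibniz rule for global scalar forms applies.
  obtain ⟨σ, hσ⟩ : ∃ σ : ∀ p : ℕ, ι → Form B ℝ (Trivial M ℝ) (⊤ : Opens M) p,
      ∀ p i, ∀ w ∈ frameDomain B F E x₀, formInChart (σ p i) x₀ (extChartAt 𝓘(ℝ, B) x₀ w) =
        χ w • b.coord i (totalCoord η x₀ (extChartAt 𝓘(ℝ, B) x₀ w)) p :=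
    ⟨fun p i => cutoffScalar χ (fun y => b.coord i (totalCoord η x₀ y) p)
      fun w hw => hsm p i w (hχ hw), fun p i w hw =>
        formInChart_cutoffScalar χ _ _ (frameDomain_subset x₀ hw)⟩
  have hE (i : ι) (w : M) (hw : w ∈ frameDomain B F E x₀) :
      totalCoord (cutoffBasis b χ hχ i) x₀ (extChartAt 𝓘(ℝ, B) x₀ w) = χ w • b.const B i :=
    totalCoord_cutoffTotal χ hχ _ _ hw
  have h1 : ∀ᶠ w in 𝓝 z, totalCoord η x₀ (extChartAt 𝓘(ℝ, B) x₀ w) =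
      totalCoord (∑ p ∈ Finset.range (Module.finrank ℝ B + 1), ∑ i,
        totalWedge (σ p i) (cutoffBasis b χ hχ i)) x₀ (extChartAt 𝓘(ℝ, B) x₀ w) := by
    filter_upwards [hz, hz1] with w hw hw1
    simp only [totalCoord_sum, totalCoord_totalWedge]
    conv_lhs => rw [← b.extend_const (totalCoord η x₀ _), b.extend_eq_sum]
    refine Finset.sum_congr rfl fun p _ => Finset.sum_congr rfl fun i _ => ?_
    rw [hσ p i w hw, hE i w hw, hw1, one_smul, one_smul]
  rw [D.totalCoord_congr hz h1,
    connOp_eq_sum b _ (totalSmoothAt_totalCoord η hzf (Opens.mem_top _))]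
  simp only [map_sum, totalCoord_sum]
  refine Finset.sum_congr rfl fun p _ => Finset.sum_congr rfl fun i _ => ?_
  have h2 : formInChart (σ p i) x₀ =ᶠ[𝓝 (extChartAt 𝓘(ℝ, B) x₀ z)]
      fun y => b.coord i (totalCoord η x₀ y) p := by
    refine eventually_chart_of_eventually hzs ?_
    filter_upwards [hz, hz1] with w hw hw1
    rw [hσ p i w hw, hw1, one_smul]
  have h3 : DifferentiableAt ℝ (formInChart (σ p i) x₀) (extChartAt 𝓘(ℝ, B) x₀ z) :=
    ((hsm p i z hzf).congr_of_eventuallyEq h2).differentiableAt (by simp)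
  rw [D.leibniz, totalCoord_add, totalCoord_smul, totalCoord_totalWedge, totalCoord_totalWedge,
    formD_apply_coord _ hzs (Opens.mem_top _) h3, h2.extDeriv_eq, h2.eq_of_nhds, hE i z hzf,
    hz1.self_of_nhds, one_smul]

end Locality

/-! ### Local normal form of a superconnection and existence of the frame -/

section LocalConnection

theorem TotalSmoothAt.smul_fun {Z V : Type*} [NormedAddCommGroup Z] [NormedSpace ℝ Z]
    [NormedAddCommGroup V] [NormedSpace ℝ V] {N : ℤ → Type*} [∀ q, NormedAddCommGroup (N q)]
    [∀ q, NormedSpace ℝ (N q)] {ψ : Z → ℝ} {f : Z → PtTotal V N} {z : Z}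
    (hψ : ContDiffAt ℝ ∞ ψ z) (hf : TotalSmoothAt f z) : TotalSmoothAt (fun y => ψ y • f y) z :=
  fun p q => hψ.smul (hf p q)

theorem PtHomogeneous.smul {V : Type*} [NormedAddCommGroup V] [NormedSpace ℝ V] {N : ℤ → Type*}
    [∀ q, NormedAddCommGroup (N q)] [∀ q, NormedSpace ℝ (N q)] {d : ℤ} {a : PtTotal V N}
    (ha : PtHomogeneous d a) (c : ℝ) : PtHomogeneous d (c • a) := fun p q h => by
  rw [Pi.smul_apply, Pi.smul_apply, ha p q h, smul_zero]

variable {B : Type*} [NormedAddCommGroup B] [NormedSpace ℝ B] [FiniteDimensional ℝ B]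
  {M : Type*} [TopologicalSpace M] [T2Space M] [ChartedSpace B M] [IsManifold 𝓘(ℝ, B) ∞ M]
  {F : ℤ → Type*} [∀ q, NormedAddCommGroup (F q)] [∀ q, NormedSpace ℝ (F q)]
  [∀ q, FiniteDimensional ℝ (F q)]
  {E : ℤ → M → Type*} [∀ q x, AddCommGroup (E q x)] [∀ q x, Module ℝ (E q x)]
  [∀ q x, TopologicalSpace (E q x)] [∀ q x, IsTopologicalAddGroup (E q x)]
  [∀ q x, ContinuousSMul ℝ (E q x)] [∀ q, TopologicalSpace (TotalSpace (F q) (E q))]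
  [∀ q, FiberBundle (F q) (E q)] [∀ q, VectorBundle ℝ (F q) (E q)]
  [∀ q, ContMDiffVectorBundle ∞ (F q) (E q) 𝓘(ℝ, B)]
  {ι : Type*} [Fintype ι] (b : GradedBasis F ι)

/-- Near every point a flat superconnection has the form `d + A` in suitable coordinates. -/
theorem FlatSuperconnection.exists_connOp (hF : {q : ℤ | Nontrivial (F q)}.Finite)
    (D : FlatSuperconnection B F E (⊤ : Opens M)) (x₀ : M) :
    ∃ (O : Opens M) (β : B → ι → PtTotal B F), x₀ ∈ O ∧
      (O : Set M) ⊆ frameDomain B F E x₀ ∧ (∀ i y, TotalSmoothAt (fun y => β y i) y) ∧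
      (∀ i y, PtHomogeneous (b.deg i + 1) (β y i)) ∧
      (∀ η : TotalForms B F E (⊤ : Opens M), ∀ z ∈ O,
        totalCoord (D.D η) x₀ (extChartAt 𝓘(ℝ, B) x₀ z) =
          connOp b β (totalCoord η x₀) (extChartAt 𝓘(ℝ, B) x₀ z)) ∧
      ∀ f, (∀ y, TotalSmoothAt f y) → ∀ z ∈ O,
        connOp b β (connOp b β f) (extChartAt 𝓘(ℝ, B) x₀ z) = 0 := by
  have hx₀ := mem_chart_source B x₀
  obtain ⟨χ, -, hχ⟩ := (SmoothBumpFunction.nhds_basis_tsupport (I := 𝓘(ℝ, B)) x₀).mem_iff.1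
    (frameDomain_mem_nhds (B := B) (E := E) hF x₀)
  have hdom : ∀ᶠ y in 𝓝 (extChartAt 𝓘(ℝ, B) x₀ x₀),
      ∃ z ∈ frameDomain B F E x₀, extChartAt 𝓘(ℝ, B) x₀ z = y :=
    eventually_chart_of_eventually (B := B) (M := M) hx₀ (by
      filter_upwards [frameDomain_mem_nhds (B := B) (F := F) (E := E) hF x₀] with w hw
      exact ⟨w, hw, rfl⟩)
  -- The second cutoff lives on the model space. Its support lies in the image of the frame domain,
  -- where coordinates of forms are smooth, and it makes β smooth on the whole model space, as the
  -- integral equation requires.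
  obtain ⟨ψ, hψ⟩ : ∃ ψ : ContDiffBump (extChartAt 𝓘(ℝ, B) x₀ x₀), ∀ y ∈ tsupport ψ,
      ∃ z ∈ frameDomain B F E x₀, extChartAt 𝓘(ℝ, B) x₀ z = y := by
    obtain ⟨r, hr, hball⟩ := Metric.nhds_basis_closedBall.mem_iff.1 hdom
    refine ⟨⟨r / 2, r, half_pos hr, half_lt_self hr⟩, fun y hy => hball ?_⟩
    rwa [ContDiffBump.tsupport_eq] at hy
  -- The connection forms are the coordinates of D(χ eᵢ), multiplied by ψ; on the set `W` below both
  -- cutoffs equal one.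
  obtain ⟨β, hβ⟩ : ∃ β : B → ι → PtTotal B F,
    ∀ y i, β y i = ψ y • totalCoord (D.D (cutoffBasis b χ hχ i)) x₀ y := ⟨_, fun _ _ => rfl⟩
  have hO : ∀ᶠ w in 𝓝 x₀, w ∈ frameDomain B F E x₀ ∧ χ w = 1 ∧ ψ (extChartAt 𝓘(ℝ, B) x₀ w) = 1 :=
    Filter.Eventually.and (frameDomain_mem_nhds (B := B) (E := E) hF x₀) (χ.eventuallyEq_one.and
      ((continuousAt_extChartAt (I := 𝓘(ℝ, B)) x₀).eventually ψ.eventuallyEq_one))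
  obtain ⟨W, hW, hWo, hxW⟩ := eventually_nhds_iff.1 hO
  have hD (η : TotalForms B F E (⊤ : Opens M)) (z : M) (hz : z ∈ W) :
      totalCoord (D.D η) x₀ (extChartAt 𝓘(ℝ, B) x₀ z) =
        connOp b β (totalCoord η x₀) (extChartAt 𝓘(ℝ, B) x₀ z) := by
    have hzW : ∀ᶠ w in 𝓝 z, w ∈ W := hWo.mem_nhds hz
    rw [D.totalCoord_eq_connOp (b := b) χ hχ η (hzW.mono fun w hw => (hW w hw).1)
      (hzW.mono fun w hw => (hW w hw).2.1)]
    have h1 : β (extChartAt 𝓘(ℝ, B) x₀ z) = fun i =>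
        totalCoord (D.D (cutoffBasis b χ hχ i)) x₀ (extChartAt 𝓘(ℝ, B) x₀ z) := funext fun i => by
      rw [hβ, (hW z hz).2.2, one_smul]
    rw [connOp, connOp, h1]
  refine ⟨⟨W, hWo⟩, β, hxW, fun z hz => (hW z hz).1, fun i y => ?_, fun i y => ?_, hD,
    fun f hf z hz => ?_⟩
  · simp only [hβ]
    by_cases hy : y ∈ tsupport ψ
    · obtain ⟨z, hz, rfl⟩ := hψ y hy
      exact .smul_fun ψ.contDiffAt (totalSmoothAt_totalCoord _ hz (Opens.mem_top z))
    · refine TotalSmoothAt.congr_of_eventuallyEq (.const 0) ?_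
      filter_upwards [notMem_tsupport_iff_eventuallyEq.1 hy] with w hw
      rw [hw, Pi.zero_apply, zero_smul]
  · rw [hβ]
    exact (ptHomogeneous_totalCoord (D.degree_one _ _ (isHomogeneousForm_cutoffTotal χ hχ _ _
      fun _ => b.homogeneous_const i)) x₀ y).smul _
  -- A function on the model space becomes, after a cutoff, the coordinates on `W` of a global form
  -- η, so flatness follows from D(D η) = 0.
  · obtain ⟨η, hη⟩ : ∃ η : TotalForms B F E (⊤ : Opens M),
        ∀ w ∈ W, totalCoord η x₀ (extChartAt 𝓘(ℝ, B) x₀ w) = f (extChartAt 𝓘(ℝ, B) x₀ w) :=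
      ⟨cutoffTotal χ hχ f fun _ _ => hf _, fun w hw => by
        rw [totalCoord_cutoffTotal χ hχ f _ (hW w hw).1, (hW w hw).2.1, one_smul]⟩
    have hs {w : M} (hw : w ∈ W) := frameDomain_subset x₀ (hW w hw).1
    have h1 {w : M} (hw : w ∈ W) : totalCoord η x₀ =ᶠ[𝓝 (extChartAt 𝓘(ℝ, B) x₀ w)] f :=
      eventually_chart (U := ⟨W, hWo⟩) (hs hw) hw hη
    have h2 : connOp b β f =ᶠ[𝓝 (extChartAt 𝓘(ℝ, B) x₀ z)] totalCoord (D.D η) x₀ :=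
      eventually_chart (U := ⟨W, hWo⟩) (hs hz) hz fun w hw => by
        rw [hD η w hw, connOp_congr b β (h1 hw)]
    rw [connOp_congr b β h2, ← hD _ z hz, D.flat, totalCoord_zero]

/-- Every point has a neighbourhood on which a flat superconnection is given by a frame. -/
theorem FlatSuperconnection.exists_isFramePair (hF : {q : ℤ | Nontrivial (F q)}.Finite)
    (D : FlatSuperconnection B F E (⊤ : Opens M)) (x₀ : M) :
    ∃ (U : Opens M) (δ : GradedDifferential F) (s u : B → ι → PtTotal B F)
      (h : IsFramePair E b U x₀ s u), x₀ ∈ U ∧ D.IsRestriction le_top (h.superconnection δ) := by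
  obtain ⟨O, β, hxO, hO, hβ, hβd, hD, hflat⟩ := D.exists_connOp b hF x₀
  obtain ⟨T, hT⟩ := exists_isFullIndexSet (V := B) hF
  have hx₀ := mem_chart_source B x₀
  obtain ⟨δ, s, u, hs, hsd, hsu⟩ := exists_flat_frame b hT hβ hβd (extChartAt 𝓘(ℝ, B) x₀ x₀)
    (Ω := {y | ∃ z ∈ O, extChartAt 𝓘(ℝ, B) x₀ z = y})
    (eventually_chart hx₀ hxO fun w hw => ⟨w, hw, rfl⟩) (by
      rintro f hf _ ⟨z, hz, rfl⟩
      exact hflat f hf z hz)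
  obtain ⟨W, hW, hWo, hxW⟩ := eventually_nhds_iff.1
    ((continuousAt_extChartAt (I := 𝓘(ℝ, B)) x₀).eventually hsu)
  have h : IsFramePair E b (O ⊓ ⟨W, hWo⟩) x₀ s u :=
    { subset := fun z hz => hO hz.1
      smooth_left := fun z _ i => hs i _
      smooth_right := fun z hz => (hW z hz.2).1
      homogeneous_left := fun z _ i => hsd i _
      homogeneous_right := fun z hz => (hW z hz.2).2.1
      left_right := fun z hz => (hW z hz.2).2.2.1
      right_left := fun z hz => (hW z hz.2).2.2.2.1 }
  exact ⟨_, δ, s, u, h, ⟨hxO, hxW⟩,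
    h.isRestriction (fun η z hz => hD η z hz.1) fun z hz => (hW z hz.2).2.2.2.2⟩

end LocalConnection

end

/-! ### The theorem -/

theorem corollary5p4
    {B : Type*} [NormedAddCommGroup B] [NormedSpace ℝ B] [FiniteDimensional ℝ B]
    {M : Type*} [TopologicalSpace M] [T2Space M] [ChartedSpace B M] [IsManifold 𝓘(ℝ, B) ∞ M]
    {F : ℤ → Type*} [∀ q, NormedAddCommGroup (F q)] [∀ q, NormedSpace ℝ (F q)]
    [∀ q, FiniteDimensional ℝ (F q)] (hF : {q : ℤ | Nontrivial (F q)}.Finite)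
    {E : ℤ → M → Type*} [∀ q x, AddCommGroup (E q x)] [∀ q x, Module ℝ (E q x)]
    [∀ q x, TopologicalSpace (E q x)] [∀ q x, IsTopologicalAddGroup (E q x)]
    [∀ q x, ContinuousSMul ℝ (E q x)] [∀ q, TopologicalSpace (TotalSpace (F q) (E q))]
    [∀ q, FiberBundle (F q) (E q)] [∀ q, VectorBundle ℝ (F q) (E q)]
    [∀ q, ContMDiffVectorBundle ∞ (F q) (E q) 𝓘(ℝ, B)]
    (D : FlatSuperconnection B F E (⊤ : Opens M)) (x : M) :
    ∃ U : Opens M, x ∈ U ∧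
      ∃ (DU : FlatSuperconnection B F E U) (δ : GradedDifferential F),
        D.IsRestriction le_top DU ∧
          Nonempty (LocalSystemIso DU.D (constantSuperconnection (B := B) U δ)) := by
  obtain ⟨b⟩ := exists_gradedBasis hF
  obtain ⟨U, δ, s, u, h, hx, hD⟩ := D.exists_isFramePair b hF x
  exact ⟨U, hx, h.superconnection δ, δ, hD, ⟨h.localSystemIso δ⟩⟩
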